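/- Let $F=F(q)$ be a fixed finite field with $q$ elements. Conventions. A boolean circuit is built from AND, OR and NOT gates of fan-in at most two; an arithmetic circuit over $F$ is built from $+,-,*$ gates and constants of $F$. An arithmetic circuit with $N$ inputs is identically zero if the function $F^N\to F$ that it computes is zero everywhere on $F^N$. For a boolean circuit $C$, $A_C$ denotes its gate-by-gate arithmetization ($a\wedge b\mapsto ab$, $a\vee b\mapsto 1-(1-a)(1-b)$, $\neg a\mapsto 1-a$). A normalized 3SAT instance with at most $n$ variables is either one of the constants TRUE, FALSE or a conjunction of a nonempty set of distinct clauses over $x_1,\dots,x_n$, each clause being a nonempty set of at most three literals in distinct variables. For $n\ge 1$, such an instance $f$ is given by its binary encoding $E(n,f)\in\{0,1\}^{m}$, $m=8n^4$: the characteristic vector of the set of clauses, where literals are numbered $0,\dots,2n-1$ and a clause has the position whose base-$2n$ digits are the numbers of its literals in increasing order (the largest repeated if there are fewer than three); FALSE and TRUE are encoded by the strings whose only $1$ is at position $1$, respectively $2$. Put $one_n=E(n,\mathrm{TRUE})$, $zero_n=E(n,\mathrm{FALSE})$. A boolean circuit $C_n$ with $m$ inputs decides 3SAT on the instances with at most $n$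 variables if for all of them $C_n(E(n,f))=1$ exactly when $f$ is satisfiable. For $b\in\{0,1\}$ and an instance $g(x_1,x_2,\dots)$, $g(b,x_2,\dots)$ is the normalized instance obtained by substituting $b$ for $x_1$, simplifying, and renumbering the variables down by one; constants are left unchanged. Statement. There is a deterministic Turing machine that, given $1^n$ ($n\ge1$) and a boolean circuit $C_n$ with $m=8n^4$ inputs, outputs in time polynomial in the length of this input an arithmetic circuit $A^*_{C_n}$ over $F$ with $m+3$ inputs $f=(f_1,\dots,f_m),y_0,y_1,y_2$ such that $$C_n \text{ decides 3SAT on all instances with at most } n \text{ variables}\iff A^*_{C_n}\text{ is identically zero}.$$ Moreover, for every $n\ge 1$ there are, depending only on $n$ (and not on $C_n$), a boolean circuit $V_n$ on $m$ bits that accepts exactly the strings $E(n,g)$ with $g$ a normalized instance with at most $n$ variables, and boolean circuits $S_{n,0},S_{n,1}$ with $m$ input and $m$ output bits that map $E(n,g)$ to $E(n,g(0,x_2,\dots))$ and $E(n,g(1,x_2,\dots))$ for every such $g$, such that the polynomial computed by $A^*_{C_n}$ is $H(f,y_0,y_1,y_2)\cdot G_n(f)$, where $$H=y_0\,(A_{C_n}(one_n)-1)+y_1A_{C_n}(zero_n)+y_2\Bigl(A_{C_n}(f)-\bigl(1-(1-A_{C_n}(A_{S_{n,0}}(f)))(1-A_{C_n}(A_{S_{n,1}}(f)))\bigr)\Bigr),$$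 $$G_n(f)=R(f_1)\cdots R(f_m)\,A_{V_n}(f),\qquad R(x)=1-(x(x-1))^{q-1}.$$ -/

import Mathlib

open Turing

/-! ### Circuits -/

/-- Values of all wires of a straight-line program: starting from the list `x` of the values of the
input wires, every gate appends the value it computes from the wires that precede it. -/
def runGates {G R : Type} (ev : G → (ℕ → R) → R) (d : R) (gates : List G) (x : List R) : List R :=
  gates.foldl (fun v g => v ++ [ev g (fun i => v.getD i d)]) x

/-- The gates of a boolean circuit; the arguments are numbers of wires. -/
inductive BoolGate : Type
  | and (i j : ℕ)
  | or (i j : ℕ)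
  | not (i : ℕ)

/-- All arguments of the gate are among the first `w` wires. -/
def BoolGate.Bounded (w : ℕ) : BoolGate → Prop
  | .and i j => i < w ∧ j < w
  | .or i j => i < w ∧ j < w
  | .not i => i < w

def BoolGate.eval : BoolGate → (ℕ → Bool) → Bool
  | .and i j, v => v i && v j
  | .or i j, v => v i || v j
  | .not i, v => !(v i)

/-- Arithmetization of a single gate over a commutative ring. -/
def BoolGate.arith {R : Type} [CommRing R] : BoolGate → (ℕ → R) → R
  | .and i j, v => v i * v j
  | .or i j, v => 1 - (1 - v i) * (1 - v j)
  | .not i, v => 1 - v i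

/-- A boolean circuit with `m` input wires, numbered `0, …, m - 1`; the gate number `t` computes the
wire `m + t` from earlier wires (so there is no feedback, and the fan-out is unbounded), and `out` is
the output wire. -/
structure BoolCircuit (m : ℕ) : Type where
  gates : List BoolGate
  out : ℕ
  gates_bounded : ∀ (t : ℕ) (g : BoolGate), gates[t]? = some g → g.Bounded (m + t)
  out_lt : out < m + gates.length

def BoolCircuit.eval {m : ℕ} (C : BoolCircuit m) (x : Fin m → Bool) : Bool :=
  (runGates BoolGate.eval false C.gates (List.ofFn x)).getD C.out false

/-- The gate-by-gate arithmetization `A_C` of a boolean circuit `C`, evaluated at a tuple of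
elements of a commutative ring (for instance, of polynomials). -/
def BoolCircuit.arith {m : ℕ} (C : BoolCircuit m) {R : Type} [CommRing R] (x : Fin m → R) : R :=
  (runGates BoolGate.arith 0 C.gates (List.ofFn x)).getD C.out 0

/-- The gates of an arithmetic circuit over `F`: constants of `F`, `+`, `-` and `*`. -/
inductive ArithGate (F : Type) : Type
  | const (a : F)
  | add (i j : ℕ)
  | sub (i j : ℕ)
  | mul (i j : ℕ)

/-- All arguments of the gate are among the first `w` wires. -/
def ArithGate.Bounded {F : Type} (w : ℕ) : ArithGate F → Prop
  | .const _ => True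
  | .add i j => i < w ∧ j < w
  | .sub i j => i < w ∧ j < w
  | .mul i j => i < w ∧ j < w

def ArithGate.eval {F R : Type} [Field F] [CommRing R] [Algebra F R] :
    ArithGate F → (ℕ → R) → R
  | .const a, _ => algebraMap F R a
  | .add i j, v => v i + v j
  | .sub i j, v => v i - v j
  | .mul i j, v => v i * v j

/-- An arithmetic circuit over `F` with `N` input wires, organised as a boolean circuit is. -/
structure ArithCircuit (F : Type) (N : ℕ) : Type where
  gates : List (ArithGate F)
  out : ℕ
  gates_bounded : ∀ (t : ℕ) (g : ArithGate F), gates[t]? = some g → g.Bounded (N + t)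
  out_lt : out < N + gates.length

/-- The value of an arithmetic circuit at a tuple of elements of a commutative `F`-algebra. -/
def ArithCircuit.eval {F : Type} [Field F] {N : ℕ} (A : ArithCircuit F N) {R : Type} [CommRing R]
    [Algebra F R] (x : Fin N → R) : R :=
  (runGates ArithGate.eval 0 A.gates (List.ofFn x)).getD A.out 0

/-- The formal polynomial computed by an arithmetic circuit. -/
noncomputable def ArithCircuit.poly {F : Type} [Field F] {N : ℕ} (A : ArithCircuit F N) :
    MvPolynomial (Fin N) F :=
  A.eval (R := MvPolynomial (Fin N) F) MvPolynomial.X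

/-- The function `F ^ N → F` computed by the circuit is identically zero. -/
def ArithCircuit.IdenticallyZero {F : Type} [Field F] {N : ℕ} (A : ArithCircuit F N) : Prop :=
  ∀ x : Fin N → F, A.eval x = 0

/-! ### Circuits as strings over finite alphabets -/

inductive BoolSym : Type
  | tick | sep | and | or | not
  deriving DecidableEq

instance : Fintype BoolSym where
  elems := {.tick, .sep, .and, .or, .not}
  complete := by intro x; cases x <;> simp

def BoolSym.unary (i : ℕ) : List BoolSym := List.replicate i .tick ++ [.sep]

def BoolGate.code : BoolGate → List BoolSym
  | .and i j => .and :: (BoolSym.unary i ++ BoolSym.unary j)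
  | .or i j => .or :: (BoolSym.unary i ++ BoolSym.unary j)
  | .not i => .not :: BoolSym.unary i

/-- The string that represents the number `n` (in unary) together with a boolean circuit on `8 n ^ 4`
inputs. Its length is bounded by a polynomial in `n` and the number of gates. -/
def encodeBoolCircuit (p : Σ n : ℕ, BoolCircuit (8 * n ^ 4)) : List BoolSym :=
  BoolSym.unary p.1 ++ p.2.gates.flatMap BoolGate.code ++ BoolSym.unary p.2.out

inductive ArithSym (F : Type) : Type
  | tick | sep | add | sub | mul
  | const (a : F)
  deriving DecidableEq, Fintype

def ArithSym.unary {F : Type} (i : ℕ) : List (ArithSym F) := List.replicate i .tick ++ [.sep]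

def ArithGate.code {F : Type} : ArithGate F → List (ArithSym F)
  | .const a => [.const a]
  | .add i j => .add :: (ArithSym.unary i ++ ArithSym.unary j)
  | .sub i j => .sub :: (ArithSym.unary i ++ ArithSym.unary j)
  | .mul i j => .mul :: (ArithSym.unary i ++ ArithSym.unary j)

/-- The string that represents an arithmetic circuit and its number of inputs. -/
def encodeArithCircuit {F : Type} (p : Σ N : ℕ, ArithCircuit F N) : List (ArithSym F) :=
  ArithSym.unary p.1 ++ p.2.gates.flatMap ArithGate.code ++ ArithSym.unary p.2.out

/-! ### Normalized 3SAT instances and their binary encoding -/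

/-- A literal: the number of its variable (the variables are numbered from `0`), and `true` for the
variable itself, `false` for its negation. -/
abbrev SatLiteral : Type := ℕ × Bool

/-- A clause, the disjunction of a set of literals. -/
abbrev SatClause : Type := Finset SatLiteral

/-- Either a logical constant or the conjunction of a set of clauses. -/
inductive SatInstance : Type
  | const (b : Bool)
  | cnf (φ : Finset SatClause)

/-- Normalized 3SAT instances in the variables `0, …, n - 1`: the two logical constants, and the
nonempty sets of nonempty clauses with at most three literals each, in which no variable appears
in two literals of the same clause. -/
def SatInstance.IsNormalized (n : ℕ) : SatInstance → Prop
  | .const _ => True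
  | .cnf φ => φ.Nonempty ∧ ∀ c ∈ φ, c.Nonempty ∧ c.card ≤ 3 ∧ (∀ l ∈ c, l.1 < n) ∧
      ∀ l ∈ c, ∀ l' ∈ c, l.1 = l'.1 → l = l'

def SatInstance.Satisfiable : SatInstance → Prop
  | .const b => b = true
  | .cnf φ => ∃ a : ℕ → Bool, ∀ c ∈ φ, ∃ l ∈ c, a l.1 = l.2

/-- The instance `g(b, x₂, x₃, …)` obtained from `g(x₁, x₂, …)`: the clauses that became true are
deleted, the literals that became false are deleted, and the other variables are renumbered down by
one. The result is a constant if no clause is left or a clause became empty. -/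
def SatInstance.restrict (b : Bool) : SatInstance → SatInstance
  | .const b' => .const b'
  | .cnf φ =>
    let ψ : Finset SatClause := (φ.filter (fun c => (0, b) ∉ c)).image
      (fun c => (c.filter (fun l => l.1 ≠ 0)).image (fun l => (l.1 - 1, l.2)))
    if ψ = ∅ then .const true else if ∅ ∈ ψ then .const false else .cnf ψ

/-- The literal with number `k`; the numbers `0, …, 2 n - 1` give all literals in the variables
`0, …, n - 1`. -/
def litOfNat (k : ℕ) : SatLiteral := (k / 2, k % 2 == 1)

/-- The normalized binary encoding, a string of `8 n ^ 4` bits (for `n ≥ 1`). A set of clauses is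
encoded by its characteristic vector: the position of a clause has the base-`2 n` digits `i ≤ j ≤ k`,
the numbers of its literals in increasing order, the largest one being repeated if there are fewer
than three. The positions `1` and `2`, which are not the position of any clause of a normalized
instance, mark the constants `false` and `true`. -/
def SatInstance.encode (n : ℕ) : SatInstance → Fin (8 * n ^ 4) → Bool
  | .const b, p => (p : ℕ) == if b then 2 else 1
  | .cnf φ, p =>
    let i := (p : ℕ) / (2 * n) ^ 2
    let j := (p : ℕ) / (2 * n) % (2 * n)
    let k := (p : ℕ) % (2 * n)
    decide (i ≤ j ∧ j ≤ k ∧ (i = j → j = k) ∧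
      ({litOfNat i, litOfNat j, litOfNat k} : SatClause) ∈ φ)

/-- `C` decides 3SAT on all (normalized) instances with at most `n` variables. -/
def Decides3SAT (n : ℕ) (C : BoolCircuit (8 * n ^ 4)) : Prop :=
  ∀ f : SatInstance, f.IsNormalized n → (C.eval (f.encode n) = true ↔ f.Satisfiable)

/-- `V` accepts exactly the normalized encodings of instances with at most `n` variables. -/
def DecidesEncodings (n : ℕ) (V : BoolCircuit (8 * n ^ 4)) : Prop :=
  ∀ s : Fin (8 * n ^ 4) → Bool,
    V.eval s = true ↔ ∃ f : SatInstance, f.IsNormalized n ∧ f.encode n = s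

/-- The circuits `S 0, S 1, …` output the bits of the encoding of `g(b, x₂, x₃, …)` when the input is
the encoding of an instance `g(x₁, x₂, …)` with at most `n` variables. -/
def ComputesRestriction (n : ℕ) (b : Bool) (S : Fin (8 * n ^ 4) → BoolCircuit (8 * n ^ 4)) : Prop :=
  ∀ f : SatInstance, f.IsNormalized n →
    (fun i => (S i).eval (f.encode n)) = (f.restrict b).encode n

/-! ### The two factors of the arithmetic circuit -/

/-- `R(x) = 1 - (x (x - 1)) ^ (q - 1)`. -/
def bitTest {R : Type} [CommRing R] (q : ℕ) (x : R) : R := 1 - (x * (x - 1)) ^ (q - 1)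

/-- `G(x) = R(x₁) ⋯ R(x_m) · A_V(x)`. -/
def guardFactor {R : Type} [CommRing R] {m : ℕ} (q : ℕ) (V : BoolCircuit m) (x : Fin m → R) : R :=
  (∏ i, bitTest q (x i)) * V.arith x

/-- The 0-1 vector over `R` given by a bit string. -/
def bitVec {R : Type} [CommRing R] {m : ℕ} (s : Fin m → Bool) (i : Fin m) : R :=
  if s i then 1 else 0

/-- `H(f, y₀, y₁, y₂) = y₀ (A_C(one) - 1) + y₁ A_C(zero)
  + y₂ (A_C(f) - (1 - (1 - A_C(S₀(f))) (1 - A_C(S₁(f)))))`. -/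
def recursionFactor {R : Type} [CommRing R] (n : ℕ) (C : BoolCircuit (8 * n ^ 4))
    (S₀ S₁ : Fin (8 * n ^ 4) → BoolCircuit (8 * n ^ 4))
    (f : Fin (8 * n ^ 4) → R) (y₀ y₁ y₂ : R) : R :=
  y₀ * (C.arith (bitVec ((SatInstance.const true).encode n)) - 1)
    + y₁ * C.arith (bitVec ((SatInstance.const false).encode n))
    + y₂ * (C.arith f - (1 - (1 - C.arith (fun i => (S₀ i).arith f))
        * (1 - C.arith (fun i => (S₁ i).arith f))))

/-! Satisfiability is self-reducible: `f` is satisfiable iff `f(0, x₂, …)` or `f(1, x₂, …)` is, and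
a substitution removes one variable. So a predicate that is right on the two constants and obeys
this recursion on all normalized instances is satisfiability, by induction on the number of
variables (`satisfiable_iff_restrict`, `satisfiable_of_recursion`). The factor `H` arithmetizes
these three requirements, and the free variables `y₀, y₁, y₂` make them separately testable. The
factor `G` confines the test to encodings: over a field with `q` elements `R(x)` is `1` for `x = 0,
1` and vanishes elsewhere because nonzero elements satisfy `z ^ (q - 1) = 1`, and on bit vectors an
arithmetized circuit takes the value of the circuit (`BoolCircuit.arith_bitVec`). Hence `H * G`
vanishes everywhere iff `C` decides 3SAT (`decides3SAT_iff`).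

The circuits `V`, `S₀`, `S₁` come from an explicit description of encodings. Clause positions
correspond bijectively to normal clauses, and a nonconstant instance is a nonempty set of such
positions (`exists_encode_iff`). A clause that survives a substitution has at most two possible
preimages, the clause shifted by one variable and that clause with the falsified literal added, so a
bit of the restricted encoding is a simple function of a few bits and two global searches
(`encode_restrict`). One straight-line program, `encodingGate`, computes all of this, and `V` and
the bits of `S₀`, `S₁` are its wires.

The arithmetic circuit places that program, five copies of `C`, the bit tests and the final formula
in one list of blocks, each of exactly three gates. Block `w` is given by a formula in `w`, `n` and
the gates of `C`. Its value is computed in an arbitrary commutative `F`-algebra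
(`reductionCircuit_eval`), which yields both the polynomial identity and the values on `F`.

For the running time, a small command language on unary counters is compiled to stack machines with
one machine step per counted step (`Runs.stepsTo`). Numbers computable by commands in polynomial
time (`Evals`) are closed under arithmetic and case distinctions and include the fields of the
input. Strings writable in polynomial time (`Emits`) are closed under concatenation, case
distinctions and bounded loops. The formula for block `w` is built from these operations, so its
shape is the proof that the circuit can be written in polynomial time. -/

section

/-! ### A command language on unary counters, compiled to stack machines -/

/-- A memory state: counters, an input tape (the part ahead of the head and the reversed part behind
it) and the output written so far. -/
structure CounterState (I O : Type) where
  reg : ℕ → ℕ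
  inp : List I
  rev : List I
  out : List O

/-- Commands. `loop r c` decrements the counter `r` and executes `c` as long as `r` is not zero;
`scan f` moves the input head over each symbol `i` and then executes `f i`; `emit` writes in front of
the output; `rewind` resets the input head and `drain` deletes the rest of the input. -/
inductive Cmd (I O : Type) : Type
  | skip
  | inc (r : ℕ)
  | dec (r : ℕ)
  | emit (o : O)
  | seq (c d : Cmd I O)
  | ifz (r : ℕ) (c d : Cmd I O)
  | loop (r : ℕ) (c : Cmd I O)
  | scan (f : I → Cmd I O)
  | rewind
  | drain

variable {I O : Type}

def CounterState.set (s : CounterState I O) (r n : ℕ) : CounterState I O :=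
  { s with reg := Function.update s.reg r n }

/-- `Runs c s s' t`: started in `s`, the command `c` ends in `s'` after `t` steps. -/
inductive Runs : Cmd I O → CounterState I O → CounterState I O → ℕ → Prop
  | skip (s) : Runs .skip s s 1
  | inc (s r) : Runs (.inc r) s (s.set r (s.reg r + 1)) 1
  | dec (s r) : Runs (.dec r) s (s.set r (s.reg r - 1)) 1
  | emit (s o) : Runs (.emit o) s { s with out := o :: s.out } 1
  | seq {c d s s' s'' t u} : Runs c s s' t → Runs d s' s'' u → Runs (.seq c d) s s'' (t + u)
  | ifz_zero {r c d s s' t} : s.reg r = 0 → Runs c s s' t → Runs (.ifz r c d) s s' (t + 1)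
  | ifz_pos {r c d s s' t} : s.reg r ≠ 0 → Runs d s s' t → Runs (.ifz r c d) s s' (t + 1)
  | loop_zero {r c s} : s.reg r = 0 → Runs (.loop r c) s s 1
  | loop_succ {r c s s' s'' n t u} : s.reg r = n + 1 → Runs c (s.set r n) s' t →
      Runs (.loop r c) s' s'' u → Runs (.loop r c) s s'' (t + u + 1)
  | scan_nil {f s} : s.inp = [] → Runs (.scan f) s s 1
  | scan_cons {f s s' s'' i l t u} : s.inp = i :: l →
      Runs (f i) { s with inp := l, rev := i :: s.rev } s' t →
      Runs (.scan f) s' s'' u → Runs (.scan f) s s'' (t + u + 1)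
  | rewind_nil {s} : s.rev = [] → Runs .rewind s s 1
  | rewind_cons {s s' i l t} : s.rev = i :: l →
      Runs .rewind { s with rev := l, inp := i :: s.inp } s' t → Runs .rewind s s' (t + 1)
  | drain_nil {s} : s.inp = [] → Runs .drain s s 1
  | drain_cons {s s' i l t} : s.inp = i :: l →
      Runs .drain { s with inp := l } s' t → Runs .drain s s' (t + 1)

/-! ### Program points and counter bounds of commands -/

namespace Cmd

/-- The program points of a command. -/
def Label : Cmd I O → Type
  | seq c d => c.Label ⊕ d.Label
  | ifz _ c d => Option (c.Label ⊕ d.Label)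
  | loop _ c => Option c.Label
  | scan f => Option (Σ i, (f i).Label)
  | _ => Unit

theorem finite_label [Finite I] (c : Cmd I O) : Finite c.Label := by
  induction c with
  | seq c d hc hd => exact inferInstanceAs (Finite (c.Label ⊕ d.Label))
  | ifz r c d hc hd => exact inferInstanceAs (Finite (Option (c.Label ⊕ d.Label)))
  | loop r c hc => exact inferInstanceAs (Finite (Option c.Label))
  | scan f hf => exact inferInstanceAs (Finite (Option (Σ i, (f i).Label)))
  | _ => exact inferInstanceAs (Finite Unit)

def entry : (c : Cmd I O) → c.Label
  | skip => ()
  | inc _ => ()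
  | dec _ => ()
  | emit _ => ()
  | seq c _ => Sum.inl c.entry
  | ifz _ _ _ => (none : Option _)
  | loop _ _ => (none : Option _)
  | scan _ => (none : Option _)
  | rewind => ()
  | drain => ()

/-- All counters of the command have numbers at most `R`. -/
def RegsLE (R : ℕ) : Cmd I O → Prop
  | inc r => r ≤ R
  | dec r => r ≤ R
  | seq c d => c.RegsLE R ∧ d.RegsLE R
  | ifz r c d => r ≤ R ∧ c.RegsLE R ∧ d.RegsLE R
  | loop r c => r ≤ R ∧ c.RegsLE R
  | scan f => ∀ i, (f i).RegsLE R
  | _ => True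

theorem RegsLE.mono {R R' : ℕ} (h : R ≤ R') {c : Cmd I O} (hc : c.RegsLE R) : c.RegsLE R' := by
  induction c with
  | seq c d ihc ihd => exact ⟨ihc hc.1, ihd hc.2⟩
  | ifz r c d ihc ihd => exact ⟨hc.1.trans h, ihc hc.2.1, ihd hc.2.2⟩
  | loop r c ihc => exact ⟨hc.1.trans h, ihc hc.2⟩
  | scan f ih => exact fun i => ih i (hc i)
  | inc r => exact le_trans (b := R) hc h
  | dec r => exact le_trans (b := R) hc h
  | _ => trivial

theorem exists_regsLE [Finite I] (c : Cmd I O) : ∃ R, c.RegsLE R := by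
  induction c with
  | seq c d ihc ihd =>
    obtain ⟨R, hR⟩ := ihc
    obtain ⟨R', hR'⟩ := ihd
    exact ⟨max R R', hR.mono (le_max_left _ _), hR'.mono (le_max_right _ _)⟩
  | ifz r c d ihc ihd =>
    obtain ⟨R, hR⟩ := ihc
    obtain ⟨R', hR'⟩ := ihd
    exact ⟨max r (max R R'), le_max_left _ _, hR.mono (by simp), hR'.mono (by simp)⟩
  | loop r c ihc =>
    obtain ⟨R, hR⟩ := ihc
    exact ⟨max r R, le_max_left _ _, hR.mono (le_max_right _ _)⟩
  | scan f ih =>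
    choose R hR using ih
    obtain ⟨B, hB⟩ := (Set.finite_range R).bddAbove
    exact ⟨B, fun i => (hR i).mono (hB ⟨i, rfl⟩)⟩
  | inc r => exact ⟨r, le_refl r⟩
  | dec r => exact ⟨r, le_refl r⟩
  | _ => exact ⟨0, trivial⟩

end Cmd

/-! ### Compilation of commands to stack machines -/

/-- The stacks of the machine that executes commands with counters `0, …, R`. -/
inductive StackId (R : ℕ) : Type
  | inp | rev | out
  | reg (i : Fin (R + 1))
  deriving DecidableEq, Fintype

/-- The number of the stack of the counter `r`. -/
def StackId.idx (R r : ℕ) : Fin (R + 1) := Fin.ofNat _ r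

abbrev StackId.Sym (I O : Type) {R : ℕ} : StackId R → Type
  | inp => I
  | rev => I
  | out => O
  | reg _ => Unit

def CounterState.stk (R : ℕ) (s : CounterState I O) : ∀ k : StackId R, List (k.Sym I O)
  | .inp => s.inp
  | .rev => s.rev
  | .out => s.out
  | .reg i => List.replicate (s.reg i) ()

namespace Cmd

open TM2.Stmt in
/-- The statements of the machine for a command, where control passes to `e` at the end. -/
def stmt [Inhabited I] (R : ℕ) : (c : Cmd I O) → {L : Type} → (c.Label → L) → L → c.Label →
    TM2.Stmt (StackId.Sym I O (R := R)) L (Bool × I)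
  | skip, _, _, e, _ => goto fun _ => e
  | inc r, _, _, e, _ => push (.reg (StackId.idx R r)) (fun _ => ()) (goto fun _ => e)
  | dec r, _, _, e, _ => pop (.reg (StackId.idx R r)) (fun v _ => v) (goto fun _ => e)
  | emit o, _, _, e, _ => push .out (fun _ => o) (goto fun _ => e)
  | seq _ d, _, m, _, .inl l => stmt R _ (fun l => m (.inl l)) (m (.inr d.entry)) l
  | seq _ _, _, m, e, .inr l => stmt R _ (fun l => m (.inr l)) e l
  | ifz r c d, _, m, _, none => peek (.reg (StackId.idx R r)) (fun v o => (o.isSome, v.2))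
      (goto fun v => m (some (if v.1 then .inr d.entry else .inl c.entry)))
  | ifz _ _ _, _, m, e, some (.inl l) => stmt R _ (fun l => m (some (.inl l))) e l
  | ifz _ _ _, _, m, e, some (.inr l) => stmt R _ (fun l => m (some (.inr l))) e l
  | loop r c, _, m, e, none => pop (.reg (StackId.idx R r)) (fun v o => (o.isSome, v.2))
      (goto fun v => if v.1 then m (some c.entry) else e)
  | loop _ _, _, m, _, some l => stmt R _ (fun l => m (some l)) (m none) l
  | scan f, _, m, e, none => pop .inp (fun _ o => (o.isSome, o.getD default))
      (branch (fun v => v.1)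
        (push .rev (fun v => v.2) (goto fun v => m (some ⟨v.2, (f v.2).entry⟩)))
        (goto fun _ => e))
  | scan _, _, m, _, some ⟨i, l⟩ => stmt R _ (fun l => m (some ⟨i, l⟩)) (m none) l
  | rewind, _, m, e, _ => pop .rev (fun _ o => (o.isSome, o.getD default))
      (branch (fun v => v.1) (push .inp (fun v => v.2) (goto fun _ => m ())) (goto fun _ => e))
  | drain, _, m, e, _ => pop .inp (fun v o => (o.isSome, v.2))
      (branch (fun v => v.1) (goto fun _ => m ()) (goto fun _ => e))

end Cmd

/-! ### Simulation of commands, step for step -/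

/-- The machine goes from `c` to `c'` in exactly `t` steps. -/
def StepsTo {K : Type} [DecidableEq K] {Γ : K → Type} {L σ : Type} (M : L → TM2.Stmt Γ L σ) (t : ℕ)
    (c c' : TM2.Cfg Γ L σ) : Prop :=
  (flip bind (TM2.step M))^[t] (some c) = some c'

theorem StepsTo.trans {K : Type} [DecidableEq K] {Γ : K → Type} {L σ : Type}
    {M : L → TM2.Stmt Γ L σ} {t u : ℕ} {c c' c'' : TM2.Cfg Γ L σ} (h : StepsTo M t c c')
    (h' : StepsTo M u c' c'') : StepsTo M (t + u) c c'' := by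
  unfold StepsTo at *
  rw [Nat.add_comm, Function.iterate_add_apply, h, h']

theorem StepsTo.single {K : Type} [DecidableEq K] {Γ : K → Type} {L σ : Type}
    {M : L → TM2.Stmt Γ L σ} {l : L} {v : σ} {S : ∀ k, List (Γ k)} {c' : TM2.Cfg Γ L σ}
    (h : TM2.stepAux (M l) v S = c') : StepsTo M 1 ⟨some l, v, S⟩ c' := by
  subst h; rfl

section
variable (R : ℕ)

theorem CounterState.stk_update_reg (s : CounterState I O) {r : ℕ} (hr : r ≤ R) (n : ℕ) :
    Function.update (s.stk R) (.reg (StackId.idx R r)) (List.replicate n () ) = (s.set r n).stk R := by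
  funext k
  rcases eq_or_ne k (.reg (StackId.idx R r)) with rfl | hk
  · simp [StackId.idx, CounterState.stk, CounterState.set, Nat.mod_eq_of_lt (Nat.lt_succ_of_le hr)]
  · rw [Function.update_of_ne hk]
    cases k with
    | reg i =>
      have : (i : ℕ) ≠ r := by
        rintro rfl
        exact hk (by simp [StackId.idx])
      simp [CounterState.stk, CounterState.set, Function.update_of_ne this]
    | _ => rfl

theorem CounterState.stk_reg (s : CounterState I O) {r : ℕ} (hr : r ≤ R) :
    s.stk R (.reg (StackId.idx R r)) = List.replicate (s.reg r) () := by
  simp [StackId.idx, CounterState.stk, Nat.mod_eq_of_lt (Nat.lt_succ_of_le hr)]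

theorem CounterState.stk_update_inp (s : CounterState I O) (l : List I) :
    Function.update (s.stk R) .inp l = { s with inp := l }.stk R := by
  funext k; cases k <;> simp [CounterState.stk]

theorem CounterState.stk_update_rev (s : CounterState I O) (l : List I) :
    Function.update (s.stk R) .rev l = { s with rev := l }.stk R := by
  funext k; cases k <;> simp [CounterState.stk]

theorem CounterState.stk_update_out (s : CounterState I O) (l : List O) :
    Function.update (s.stk R) .out l = { s with out := l }.stk R := by
  funext k; cases k <;> simp [CounterState.stk]

end

/-- Induction on the run: apart from `seq`, which costs nothing, each rule of `Runs` corresponds to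
one machine step, so the counts agree exactly. The placement `m` of the labels and the exit `e` are
arbitrary because a subcommand runs inside the program of a larger command, with a different exit.
-/
theorem Runs.stepsTo [Inhabited I] {R : ℕ} {c : Cmd I O} {s s' : CounterState I O} {t : ℕ}
    (h : Runs c s s' t) (hR : c.RegsLE R) {L : Type} (m : c.Label → L) (e : L)
    (M : L → TM2.Stmt (StackId.Sym I O (R := R)) L (Bool × I))
    (hM : ∀ l, M (m l) = c.stmt R m e l) (v : Bool × I) :
    ∃ v', StepsTo M t ⟨some (m c.entry), v, s.stk R⟩ ⟨some e, v', s'.stk R⟩ := by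
  induction h generalizing L e v with
  | skip s => exact ⟨v, StepsTo.single (by rw [hM]; rfl)⟩
  | inc s r =>
    refine ⟨v, StepsTo.single ?_⟩
    rw [hM, ← s.stk_update_reg R hR]
    simp only [Cmd.stmt, TM2.stepAux, s.stk_reg R hR, List.replicate_succ]
  | dec s r =>
    refine ⟨v, StepsTo.single ?_⟩
    rw [hM, ← s.stk_update_reg R hR]
    simp only [Cmd.stmt, TM2.stepAux, s.stk_reg R hR, List.tail_replicate]
  | emit s o =>
    refine ⟨v, StepsTo.single ?_⟩
    rw [hM]
    simp only [Cmd.stmt, TM2.stepAux]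
    rw [s.stk_update_out R]
    rfl
  | seq _ _ ihc ihd =>
    obtain ⟨v₁, h₁⟩ := ihc hR.1 (fun l => m (.inl l)) _ M (fun l => hM _) v
    obtain ⟨v₂, h₂⟩ := ihd hR.2 (fun l => m (.inr l)) e M (fun l => hM _) v₁
    exact ⟨v₂, h₁.trans h₂⟩
  | @ifz_zero r c d s s' t h0 _ ih =>
    obtain ⟨v', h'⟩ := ih hR.2.1 (fun l => m (some (.inl l))) e M (fun l => hM _) (false, v.2)
    refine ⟨v', Nat.add_comm 1 t ▸ StepsTo.trans (StepsTo.single ?_) h'⟩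
    have := hM none
    rw [show (Cmd.ifz r c d).entry = none from rfl, this]
    simp [Cmd.stmt, TM2.stepAux, s.stk_reg R hR.1, h0]
  | @ifz_pos r c d s s' t h0 _ ih =>
    obtain ⟨v', h'⟩ := ih hR.2.2 (fun l => m (some (.inr l))) e M (fun l => hM _) (true, v.2)
    refine ⟨v', Nat.add_comm 1 t ▸ StepsTo.trans (StepsTo.single ?_) h'⟩
    obtain ⟨n, hn⟩ := Nat.exists_eq_succ_of_ne_zero h0
    have := hM none
    rw [show (Cmd.ifz r c d).entry = none from rfl, this]
    simp [Cmd.stmt, TM2.stepAux, s.stk_reg R hR.1, hn, List.replicate_succ]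
  | @loop_zero r c s h0 =>
    refine ⟨(false, v.2), StepsTo.single ?_⟩
    have := hM none
    rw [show (Cmd.loop r c).entry = none from rfl, this]
    -- The machine tests a counter by popping it; popping an empty stack changes nothing.
    have h1 : s.set r 0 = s := by
      unfold CounterState.set
      rw [← h0, Function.update_eq_self]
    conv_rhs => rw [← h1]
    rw [← s.stk_update_reg R hR.1]
    simp [Cmd.stmt, TM2.stepAux, s.stk_reg R hR.1, h0]
  | @loop_succ r c s s' s'' n t u h0 _ _ ih₁ ih₂ =>
    obtain ⟨v₁, h₁⟩ := ih₁ hR.2 (fun l => m (some l)) (m none) M (fun l => hM _) (true, v.2)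
    obtain ⟨v₂, h₂⟩ := ih₂ hR m e M hM v₁
    refine ⟨v₂, Nat.add_comm 1 (t + u) ▸ StepsTo.trans (StepsTo.single ?_) (h₁.trans h₂)⟩
    have := hM none
    rw [show (Cmd.loop r c).entry = none from rfl, this, ← s.stk_update_reg R hR.1]
    simp [Cmd.stmt, TM2.stepAux, s.stk_reg R hR.1, h0, List.replicate_succ]
  | @scan_nil f s h0 =>
    refine ⟨(false, default), StepsTo.single ?_⟩
    have := hM none
    rw [show (Cmd.scan f).entry = none from rfl, this]
    have h2 : s.stk R .inp = [] := h0
    have h1 : Function.update (s.stk R) .inp [] = s.stk R := by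
      rw [← h2, Function.update_eq_self]
    simp [Cmd.stmt, TM2.stepAux, h2, h1]
  | @scan_cons f s s' s'' i l t u h0 _ _ ih₁ ih₂ =>
    obtain ⟨v₁, h₁⟩ := ih₁ (hR i) (fun l => m (some ⟨i, l⟩)) (m none) M (fun l => hM _) (true, i)
    obtain ⟨v₂, h₂⟩ := ih₂ hR m e M hM v₁
    refine ⟨v₂, Nat.add_comm 1 (t + u) ▸ StepsTo.trans (StepsTo.single ?_) (h₁.trans h₂)⟩
    have := hM none
    rw [show (Cmd.scan f).entry = none from rfl, this]
    cases s
    subst h0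
    simp only [Cmd.stmt, TM2.stepAux]
    rw [CounterState.stk_update_inp, CounterState.stk_update_rev]
    rfl
  | @rewind_nil s h0 =>
    refine ⟨(false, default), StepsTo.single ?_⟩
    rw [hM]
    have h2 : s.stk R .rev = [] := h0
    have h1 : Function.update (s.stk R) .rev [] = s.stk R := by
      rw [← h2, Function.update_eq_self]
    simp [Cmd.stmt, TM2.stepAux, h2, h1]
  | @rewind_cons s s' i l t h0 _ ih =>
    obtain ⟨v', h'⟩ := ih hR m e M hM (true, i)
    refine ⟨v', Nat.add_comm 1 t ▸ StepsTo.trans (StepsTo.single ?_) h'⟩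
    rw [hM]
    cases s
    subst h0
    simp only [Cmd.stmt, TM2.stepAux]
    rw [CounterState.stk_update_rev, CounterState.stk_update_inp]
    rfl
  | @drain_nil s h0 =>
    refine ⟨(false, v.2), StepsTo.single ?_⟩
    rw [hM]
    have h2 : s.stk R .inp = [] := h0
    have h1 : Function.update (s.stk R) .inp [] = s.stk R := by
      rw [← h2, Function.update_eq_self]
    simp [Cmd.stmt, TM2.stepAux, h2, h1]
  | @drain_cons s s' i l t h0 _ ih =>
    obtain ⟨v', h'⟩ := ih hR m e M hM (true, v.2)
    refine ⟨v', Nat.add_comm 1 t ▸ StepsTo.trans (StepsTo.single ?_) h'⟩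
    rw [hM]
    cases s
    subst h0
    simp only [Cmd.stmt, TM2.stepAux]
    rw [CounterState.stk_update_inp]
    rfl

/-- The machine that executes the command `c` and halts. -/
noncomputable def Cmd.machine [Inhabited I] [Fintype I] (R : ℕ) (c : Cmd I O) : FinTM2 :=
  haveI := c.finite_label
  { K := StackId R
    k₀ := .inp
    k₁ := .out
    Γ := StackId.Sym I O
    Λ := Option c.Label
    main := some c.entry
    ΛFin := Fintype.ofFinite _
    σ := Bool × I
    initialState := default
    Γk₀Fin := inferInstanceAs (Fintype I)
    m := fun l => match l with
      -- A halting configuration must carry the initial internal state, so the exit label resets it.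
      -- This is the one step added to the time bound.
      | none => .load (fun _ => default) .halt
      | some l => c.stmt R some none l }

/-- A function is computable in polynomial time if some command computes it within a polynomial
number of steps, leaving all its memory clean. -/
theorem Cmd.computableInPolyTime [Inhabited I] [Fintype I] {α β : Type} {ea : α → List I}
    {eb : β → List O} {f : α → β} (c : Cmd I O) (P : Polynomial ℕ)
    (h : ∀ a, ∃ t ≤ P.eval (ea a).length,
      Runs c ⟨fun _ => 0, ea a, [], []⟩ ⟨fun _ => 0, [], [], eb (f a)⟩ t) :
    Nonempty (TM2ComputableInPolyTime ea eb f) := by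
  obtain ⟨R, hR⟩ := c.exists_regsLE
  have key : ∀ a, ∃ t ≤ (P + 1).eval (ea a).length,
      (flip bind (c.machine R).step)^[t] (some (initList (c.machine R) (ea a))) =
        some (haltList (c.machine R) (eb (f a))) := by
    intro a
    obtain ⟨t, ht, hr⟩ := h a
    refine ⟨t + 1, by simpa using ht, ?_⟩
    obtain ⟨v', h'⟩ := hr.stepsTo hR some none (c.machine R).m (fun l => rfl) default
    have h₂ : StepsTo (c.machine R).m 1
        ⟨some none, v', CounterState.stk R ⟨fun _ => 0, [], [], eb (f a)⟩⟩
        ⟨none, default, CounterState.stk R ⟨fun _ => 0, [], [], eb (f a)⟩⟩ := StepsTo.single rfl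
    have h₃ := h'.trans h₂
    have e₁ : initList (c.machine R) (ea a) =
        ⟨some (some c.entry), default, CounterState.stk R ⟨fun _ => 0, ea a, [], []⟩⟩ := by
      unfold initList
      congr 1
      funext k
      cases k <;> rfl
    have e₂ : haltList (c.machine R) (eb (f a)) =
        ⟨none, default, CounterState.stk R ⟨fun _ => 0, [], [], eb (f a)⟩⟩ := by
      unfold haltList
      congr 1
      funext k
      cases k <;> rfl
    rw [e₁, e₂]
    exact h₃
  choose t ht hs using key
  exact ⟨{ tm := c.machine R
           inputAlphabet := Equiv.refl I
           outputAlphabet := Equiv.refl O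
           time := P + 1
           outputsFun := fun a =>
             { steps := t a
               evals_in_steps := by
                 have e₁ : List.map (Equiv.refl I).invFun (ea a) = ea a := List.map_id _
                 have e₂ : List.map (Equiv.refl O).invFun (eb (f a)) = eb (f a) := List.map_id _
                 exact (congrArg₂ (fun x y => (flip bind (c.machine R).step)^[t a]
                   (some (initList (c.machine R) x)) = some (haltList (c.machine R) y))
                   e₁ e₂).mpr (hs a)
               steps_le_m := ht a } }⟩

end

section
variable {I O : Type}

/-! ### Time-bounded executions -/

/-- The command `c` leads from `s` to `s'` within `T` steps. -/
def RunsIn (c : Cmd I O) (s s' : CounterState I O) (T : ℕ) : Prop :=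
  ∃ t ≤ T, Runs c s s' t

namespace RunsIn

theorem mono {c : Cmd I O} {s s' : CounterState I O} {T T' : ℕ} (h : RunsIn c s s' T)
    (hT : T ≤ T') : RunsIn c s s' T' :=
  let ⟨t, ht, hr⟩ := h
  ⟨t, ht.trans hT, hr⟩

theorem skip (s : CounterState I O) : RunsIn .skip s s 1 := ⟨1, le_rfl, .skip s⟩

theorem inc (s : CounterState I O) (r : ℕ) : RunsIn (.inc r) s (s.set r (s.reg r + 1)) 1 :=
  ⟨1, le_rfl, .inc s r⟩

theorem dec (s : CounterState I O) (r : ℕ) : RunsIn (.dec r) s (s.set r (s.reg r - 1)) 1 :=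
  ⟨1, le_rfl, .dec s r⟩

theorem emit (s : CounterState I O) (o : O) : RunsIn (.emit o) s { s with out := o :: s.out } 1 :=
  ⟨1, le_rfl, .emit s o⟩

theorem seq {c d : Cmd I O} {s s' s'' : CounterState I O} {T U : ℕ} (h : RunsIn c s s' T)
    (h' : RunsIn d s' s'' U) : RunsIn (.seq c d) s s'' (T + U) :=
  let ⟨_, ht, hr⟩ := h
  let ⟨_, ht', hr'⟩ := h'
  ⟨_, Nat.add_le_add ht ht', hr.seq hr'⟩

theorem ifz_zero {r : ℕ} {c d : Cmd I O} {s s' : CounterState I O} {T : ℕ} (h0 : s.reg r = 0)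
    (h : RunsIn c s s' T) : RunsIn (.ifz r c d) s s' (T + 1) :=
  let ⟨_, ht, hr⟩ := h
  ⟨_, Nat.add_le_add_right ht 1, hr.ifz_zero h0⟩

theorem ifz_pos {r : ℕ} {c d : Cmd I O} {s s' : CounterState I O} {T : ℕ} (h0 : s.reg r ≠ 0)
    (h : RunsIn d s s' T) : RunsIn (.ifz r c d) s s' (T + 1) :=
  let ⟨_, ht, hr⟩ := h
  ⟨_, Nat.add_le_add_right ht 1, hr.ifz_pos h0⟩

/-- `S i` is the state when the counter shows `i`, so the states are indexed by the iterations that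
are left and the run descends from `S N` to `S 0`. The body starts with the counter already
decremented. -/
theorem loop {r B : ℕ} {c : Cmd I O} {S : ℕ → CounterState I O} {N : ℕ}
    (hS : ∀ i ≤ N, (S i).reg r = i) (h : ∀ i < N, RunsIn c ((S (i + 1)).set r i) (S i) B) :
    RunsIn (.loop r c) (S N) (S 0) (N * (B + 1) + 1) := by
  induction N with
  | zero => exact ⟨1, by simp, .loop_zero (hS 0 le_rfl)⟩
  | succ N ih =>
    obtain ⟨t, ht, hr⟩ := h N N.lt_succ_self
    obtain ⟨u, hu, hr'⟩ := ih (fun i hi => hS i (by omega)) (fun i hi => h i (by omega))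
    exact ⟨_, by rw [Nat.add_mul]; omega, .loop_succ (hS _ le_rfl) hr hr'⟩

theorem rewind (s : CounterState I O) :
    RunsIn .rewind s { s with rev := [], inp := s.rev.reverse ++ s.inp } (s.rev.length + 1) := by
  generalize hl : s.rev = l
  induction l generalizing s with
  | nil =>
    cases s
    subst hl
    exact ⟨1, le_rfl, .rewind_nil rfl⟩
  | cons i l ih =>
    obtain ⟨t, ht, hr⟩ := ih { s with rev := l, inp := i :: s.inp } rfl
    refine ⟨t + 1, by simpa using ht, .rewind_cons hl ?_⟩
    simpa using hr

theorem drain (s : CounterState I O) :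
    RunsIn .drain s { s with inp := [] } (s.inp.length + 1) := by
  generalize hl : s.inp = l
  induction l generalizing s with
  | nil =>
    cases s
    subst hl
    exact ⟨1, le_rfl, .drain_nil rfl⟩
  | cons i l ih =>
    obtain ⟨t, ht, hr⟩ := ih { s with inp := l } rfl
    exact ⟨t + 1, by simpa using ht, .drain_cons hl hr⟩

end RunsIn

namespace CounterState

theorem ext_reg {s s' : CounterState I O} (h : ∀ j, s.reg j = s'.reg j) (hi : s.inp = s'.inp)
    (hr : s.rev = s'.rev) (ho : s.out = s'.out) : s = s' := by
  cases s; cases s'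
  simp_all [funext_iff]

theorem set_reg (s : CounterState I O) (r n j : ℕ) :
    (s.set r n).reg j = if j = r then n else s.reg j := by
  simp [set, Function.update_apply]

@[simp] theorem set_inp (s : CounterState I O) (r n : ℕ) : (s.set r n).inp = s.inp := rfl
@[simp] theorem set_rev (s : CounterState I O) (r n : ℕ) : (s.set r n).rev = s.rev := rfl
@[simp] theorem set_out (s : CounterState I O) (r n : ℕ) : (s.set r n).out = s.out := rfl

end CounterState

open CounterState

/-- Executions with prescribed initial and final states. -/
theorem RunsIn.cast {c : Cmd I O} {s s' u u' : CounterState I O} {T T' : ℕ} (h : RunsIn c s s' T)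
    (hs : s = u) (hs' : s' = u') (hT : T ≤ T') : RunsIn c u u' T' := by
  subst hs hs'
  exact h.mono hT

/-- Loop invariant: when counter `j` shows `n`, exactly `s.reg j - n` units have been moved to
counter `i`. The next two lemmas use the same pattern. -/
theorem RunsIn.add_reg (s : CounterState I O) {i j : ℕ} (h : i ≠ j) :
    RunsIn (.loop j (.inc i)) s ((s.set i (s.reg i + s.reg j)).set j 0) (2 * s.reg j + 1) := by
  refine (RunsIn.loop (r := j) (c := .inc i) (B := 1) (N := s.reg j)
    (S := fun n => (s.set i (s.reg i + (s.reg j - n))).set j n)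
    (fun n _ => by simp [set_reg]) (fun n hn =>
      (RunsIn.inc _ _).cast rfl (ext_reg (fun l => ?_) rfl rfl rfl) le_rfl)).cast
    (ext_reg (fun l => ?_) rfl rfl rfl) (ext_reg (fun l => ?_) rfl rfl rfl) (by omega)
  all_goals simp only [set_reg]; grind

theorem RunsIn.sub_reg (s : CounterState I O) {i j : ℕ} (h : i ≠ j) :
    RunsIn (.loop j (.dec i)) s ((s.set i (s.reg i - s.reg j)).set j 0) (2 * s.reg j + 1) := by
  refine (RunsIn.loop (r := j) (c := .dec i) (B := 1) (N := s.reg j)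
    (S := fun n => (s.set i (s.reg i - (s.reg j - n))).set j n)
    (fun n _ => by simp [set_reg]) (fun n hn =>
      (RunsIn.dec _ _).cast rfl (ext_reg (fun l => ?_) rfl rfl rfl) le_rfl)).cast
    (ext_reg (fun l => ?_) rfl rfl rfl) (ext_reg (fun l => ?_) rfl rfl rfl) (by omega)
  all_goals simp only [set_reg]; grind

theorem RunsIn.clear_reg (s : CounterState I O) (j : ℕ) :
    RunsIn (.loop j .skip) s (s.set j 0) (2 * s.reg j + 1) := by
  refine (RunsIn.loop (r := j) (c := (.skip : Cmd I O)) (B := 1) (N := s.reg j)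
    (S := fun n => s.set j n)
    (fun n _ => by simp [set_reg]) (fun n hn =>
      (RunsIn.skip _).cast rfl (ext_reg (fun l => ?_) rfl rfl rfl) le_rfl)).cast
    (ext_reg (fun l => ?_) rfl rfl rfl) rfl (by omega)
  all_goals simp only [set_reg]; grind

/-- The command that adds counter `j` to counter `i`, using the counter `t`. -/
def Cmd.copy (i j t : ℕ) : Cmd I O :=
  .seq (.loop j (.seq (.inc i) (.inc t))) (.loop t (.inc j))

theorem RunsIn.copy (s : CounterState I O) {i j t : ℕ} (hij : i ≠ j) (hit : i ≠ t) (hjt : j ≠ t)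
    (ht : s.reg t = 0) :
    RunsIn (.copy i j t) s (s.set i (s.reg i + s.reg j)) (5 * s.reg j + 2) := by
  refine ((RunsIn.loop (r := j) (B := 2) (N := s.reg j)
    (S := fun n => ((s.set i (s.reg i + (s.reg j - n))).set t (s.reg j - n)).set j n)
    (fun n _ => by simp [set_reg]) (fun n hn =>
      ((RunsIn.inc _ _).seq (RunsIn.inc _ _)).cast rfl (ext_reg (fun l => ?_) rfl rfl rfl)
        le_rfl)).seq (RunsIn.add_reg _ hjt)).cast
    (ext_reg (fun l => ?_) rfl rfl rfl) (ext_reg (fun l => ?_) rfl rfl rfl) ?_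
  all_goals simp only [set_reg]; grind

/-- The step of a division of a number counted in `q * b + r`, where `b = d + r`. -/
def Cmd.divStep (d r q : ℕ) : Cmd I O :=
  .seq (.dec d) (.seq (.inc r) (.ifz d (.seq (.loop r (.inc d)) (.inc q)) .skip))

theorem RunsIn.divStep (s : CounterState I O) {d r q b n : ℕ} (hdr : d ≠ r) (hdq : d ≠ q)
    (hrq : r ≠ q) (hb : 0 < b) (hd : s.reg d = b - n % b) (hr : s.reg r = n % b)
    (hq : s.reg q = n / b) :
    RunsIn (.divStep d r q) s
      (((s.set d (b - (n + 1) % b)).set r ((n + 1) % b)).set q ((n + 1) / b)) (2 * b + 5) := by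
  have hn : n % b < b := Nat.mod_lt _ hb
  have h₁ := RunsIn.dec s d
  have h₂ := RunsIn.inc (s.set d (s.reg d - 1)) r
  -- Exactly in this case counter `d` drops to zero. Counter `r` then holds all of `b` and is poured
  -- back into `d`.
  by_cases hz : n % b + 1 = b
  · have hd' : n + 1 = b * (n / b + 1) := by
      have := Nat.div_add_mod n b
      rw [Nat.mul_add]
      omega
    have e₁ : (n + 1) % b = 0 := by rw [hd', Nat.mul_mod_right]
    have e₂ : (n + 1) / b = n / b + 1 := by
      rw [hd', Nat.mul_div_cancel_left _ hb]
    have h₃ := RunsIn.add_reg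
      ((s.set d (s.reg d - 1)).set r ((s.set d (s.reg d - 1)).reg r + 1)) hdr
    rw [e₁, e₂]
    refine (h₁.seq (h₂.seq (.ifz_zero (d := .skip) (r := d) ?_ (h₃.seq (.inc _ q))))).cast rfl
      (ext_reg (fun l => ?_) rfl rfl rfl) ?_
    all_goals simp only [set_reg]; grind
  · have e₁ : (n + 1) % b = n % b + 1 := by
      rw [← Nat.mod_eq_of_lt (show n % b + 1 < b by omega), Nat.mod_add_mod]
    have e₂ : (n + 1) / b = n / b := by
      rw [Nat.succ_div, if_neg, Nat.add_zero]
      intro h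
      have := Nat.mod_eq_zero_of_dvd h
      omega
    rw [e₁, e₂]
    refine (h₁.seq (h₂.seq (.ifz_pos (c := .seq (.loop r (.inc d)) (.inc q)) (r := d) ?_
      (.skip _)))).cast rfl (ext_reg (fun l => ?_) rfl rfl rfl) (by omega)
    all_goals simp only [set_reg]; grind

end

section
open CounterState
variable {I O : Type}

/-! ### Functions evaluated and strings emitted by commands in polynomial time -/

/-- Parameters of a computation: the parameter `a` determines the input `x a` and the values
`ρ a 0, …, ρ a (k - 1)` of the first `k` counters. Running times are measured in terms of `sz a`. -/
structure Ctx (I O : Type) where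
  α : Type
  k : ℕ
  ρ : α → ℕ → ℕ
  x : α → List I
  sz : α → ℕ
  ρ_le : ∀ a j, j < k → ρ a j ≤ sz a
  length_le : ∀ a, (x a).length ≤ sz a

namespace Ctx

/-- The context with one more counter. -/
def ext (X : Ctx I O) : Ctx I O where
  α := X.α × ℕ
  k := X.k + 1
  ρ a j := if j = X.k then a.2 else X.ρ a.1 j
  x a := X.x a.1
  sz a := X.sz a.1 + a.2
  ρ_le a j hj := by
    split_ifs with h
    · omega
    · have := X.ρ_le a.1 j (by omega)
      omega
  length_le a := (X.length_le a.1).trans (Nat.le_add_right _ _)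

/-- The counters of `s` below `X.k` are those given by `a`, and those from `r` on are zero. -/
structure Matches (X : Ctx I O) (r : ℕ) (a : X.α) (s : CounterState I O) : Prop where
  reg_eq : ∀ j < X.k, s.reg j = X.ρ a j
  reg_zero : ∀ j, r ≤ j → s.reg j = 0
  inp_eq : s.inp = X.x a
  rev_eq : s.rev = []

theorem Matches.set {X : Ctx I O} {r : ℕ} {a : X.α} {s : CounterState I O} (h : X.Matches r a s)
    (hr : X.k ≤ r) (n : ℕ) : X.Matches (r + 1) a (s.set r n) where
  reg_eq j hj := by rw [set_reg, if_neg (by omega), h.reg_eq j hj]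
  reg_zero j hj := by rw [set_reg, if_neg (by omega), h.reg_zero j (by omega)]
  inp_eq := h.inp_eq
  rev_eq := h.rev_eq

end Ctx

/-- Natural coefficients make evaluation monotone, so time bounds may be transferred to larger
sizes. -/
theorem Polynomial.eval_nat_mono (P : Polynomial ℕ) {m n : ℕ} (h : m ≤ n) :
    P.eval m ≤ P.eval n := by
  induction P using Polynomial.induction_on' with
  | add P Q hP hQ => simpa using Nat.add_le_add hP hQ
  | monomial k a => simpa using Nat.mul_le_mul_left a (Nat.pow_le_pow_left h k)

/-- The numbers `e a` can be computed in polynomial time, in any counter `r ≥ X.k`, with counters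
from `r` on as scratch memory. -/
def Evals (X : Ctx I O) (e : X.α → ℕ) : Prop :=
  ∀ r, X.k ≤ r → ∃ (c : Cmd I O) (P : Polynomial ℕ), ∀ a, e a ≤ P.eval (X.sz a) ∧
    ∀ s, X.Matches r a s → RunsIn c s (s.set r (e a)) (P.eval (X.sz a))

/-- The strings `f a` can be written in front of the output in polynomial time. -/
def Emits (X : Ctx I O) (f : X.α → List O) : Prop :=
  ∃ (c : Cmd I O) (P : Polynomial ℕ), ∀ a s, X.Matches X.k a s →
    RunsIn c s { s with out := f a ++ s.out } (P.eval (X.sz a))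

/-- Fits operations of linear cost into the quadratic bound that `Evals.binop` expects. -/
theorem Nat.linear_le_sq {a m n : ℕ} (B : ℕ) (h : a ≤ B * (m + n + 1)) :
    a ≤ B * (m + n + 1) ^ 2 :=
  h.trans (Nat.mul_le_mul_left _ (Nat.le_self_pow two_ne_zero _))

namespace Evals

variable {X : Ctx I O}

/-- A state that matches the extended context matches the old one as well: counter `X.k` now lies
below `r`, where the old context constrains nothing. -/
theorem weaken {e : X.α → ℕ} (h : Evals X e) : Evals X.ext (fun a => e a.1) := by
  intro r hr
  have hr' : X.k + 1 ≤ r := hr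
  obtain ⟨c, P, hc⟩ := h r (by omega)
  refine ⟨c, P, fun a => ⟨(hc a.1).1.trans (P.eval_nat_mono (Nat.le_add_right _ _)), fun s hs => ?_⟩⟩
  refine ((hc a.1).2 s ⟨fun j hj => ?_, hs.reg_zero, hs.inp_eq, hs.rev_eq⟩).mono
    (P.eval_nat_mono (Nat.le_add_right _ _))
  rw [hs.reg_eq j (Nat.lt_succ_of_lt hj)]
  exact if_neg hj.ne

theorem const (n : ℕ) : Evals X (fun _ => n) := by
  intro r _
  induction n with
  | zero =>
    refine ⟨.skip, 1, fun a => ⟨by simp, fun s hs => (RunsIn.skip s).cast rfl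
      (ext_reg (fun l => ?_) rfl rfl rfl) (by simp)⟩⟩
    have := hs.reg_zero r le_rfl
    rw [set_reg]
    grind
  | succ n ih =>
    obtain ⟨c, P, hc⟩ := ih
    refine ⟨.seq c (.inc r), P + 1, fun a => ⟨by simpa using (hc a).1, fun s hs =>
      (((hc a).2 s hs).seq (.inc _ r)).cast rfl (ext_reg (fun l => ?_) rfl rfl rfl) (by simp)⟩⟩
    simp only [set_reg]
    grind

theorem var {j : ℕ} (hj : j < X.k) : Evals X (fun a => X.ρ a j) := by
  intro r hr
  refine ⟨.copy r j (r + 1), 5 * Polynomial.X + 2, fun a => ⟨?_, fun s hs =>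
    (RunsIn.copy s (by omega) (by omega) (by omega) (hs.reg_zero _ (by omega))).cast rfl
      (ext_reg (fun l => ?_) rfl rfl rfl) ?_⟩⟩
  · have := X.ρ_le a j hj
    simp
    omega
  · rw [hs.reg_zero r le_rfl, Nat.zero_add, hs.reg_eq j hj]
  · have := X.ρ_le a j hj
    rw [hs.reg_eq j hj]
    simpa using this

theorem last : Evals X.ext (fun a => a.2) := by
  convert var (X := X.ext) (j := X.k) (Nat.lt_succ_self _) using 2
  exact (if_pos rfl).symm

/-- Evaluation of a binary operation that a command computes in quadratic time, on the domain `D`. -/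
theorem binop {op : ℕ → ℕ → ℕ} {D : ℕ → ℕ → Prop} (B : ℕ)
    (h : ∀ r, ∃ c : Cmd I O, ∀ s : CounterState I O, D (s.reg r) (s.reg (r + 1)) →
      (∀ j, r + 2 ≤ j → s.reg j = 0) →
      RunsIn c s ((s.set r (op (s.reg r) (s.reg (r + 1)))).set (r + 1) 0)
        (B * (s.reg r + s.reg (r + 1) + 1) ^ 2))
    (hop : ∀ m n, op m n ≤ B * (m + n + 1) ^ 2) {e₁ e₂ : X.α → ℕ} (h₁ : Evals X e₁)
    (h₂ : Evals X e₂) (hD : ∀ a, D (e₁ a) (e₂ a)) : Evals X (fun a => op (e₁ a) (e₂ a)) := by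
  intro r hr
  obtain ⟨c, hc⟩ := h r
  obtain ⟨c₁, P₁, hc₁⟩ := h₁ r hr
  obtain ⟨c₂, P₂, hc₂⟩ := h₂ (r + 1) (by omega)
  refine ⟨.seq c₁ (.seq c₂ c), P₁ + P₂ + .C B * (P₁ + P₂ + 1) ^ 2, fun a => ⟨?_, fun s hs => ?_⟩⟩
  · have hv : e₁ a + e₂ a + 1 ≤ (P₁ + P₂ + 1).eval (X.sz a) := by
      simpa using Nat.add_le_add (hc₁ a).1 (hc₂ a).1
    calc op (e₁ a) (e₂ a) ≤ B * (e₁ a + e₂ a + 1) ^ 2 := hop _ _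
      _ ≤ B * ((P₁ + P₂ + 1).eval (X.sz a)) ^ 2 :=
        Nat.mul_le_mul_left _ (Nat.pow_le_pow_left hv 2)
      _ ≤ _ := by simp
  · have hv : e₁ a + e₂ a + 1 ≤ (P₁ + P₂ + 1).eval (X.sz a) := by
      simpa using Nat.add_le_add (hc₁ a).1 (hc₂ a).1
    have r₁ := (hc₁ a).2 s hs
    have r₂ := (hc₂ a).2 _ (hs.set hr (e₁ a))
    have v₁ : ((s.set r (e₁ a)).set (r + 1) (e₂ a)).reg r = e₁ a := by simp [set_reg]
    have v₂ : ((s.set r (e₁ a)).set (r + 1) (e₂ a)).reg (r + 1) = e₂ a := by simp [set_reg]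
    have r₃ := hc ((s.set r (e₁ a)).set (r + 1) (e₂ a)) (by rw [v₁, v₂]; exact hD a)
      (((hs.set hr _).set (by omega) _).reg_zero)
    rw [v₁, v₂] at r₃
    refine (r₁.seq (r₂.seq r₃)).cast rfl (ext_reg (fun l => ?_) rfl rfl rfl) ?_
    · have := hs.reg_zero (r + 1) (by omega)
      simp only [set_reg]
      grind
    · have := Nat.mul_le_mul_left B (Nat.pow_le_pow_left hv 2)
      simp only [Polynomial.eval_add, Polynomial.eval_mul, Polynomial.eval_C, Polynomial.eval_pow]
        at this ⊢
      omega

theorem add {e₁ e₂ : X.α → ℕ} (h₁ : Evals X e₁) (h₂ : Evals X e₂) :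
    Evals X (fun a => e₁ a + e₂ a) :=
  binop (D := fun _ _ => True) 2 (fun r => ⟨.loop (r + 1) (.inc r), fun s _ _ =>
    (RunsIn.add_reg s (by omega)).mono (Nat.linear_le_sq _ (by omega))⟩)
    (fun m n => Nat.linear_le_sq _ (by omega)) h₁ h₂
    fun _ => trivial

theorem sub {e₁ e₂ : X.α → ℕ} (h₁ : Evals X e₁) (h₂ : Evals X e₂) :
    Evals X (fun a => e₁ a - e₂ a) :=
  binop (D := fun _ _ => True) 2 (fun r => ⟨.loop (r + 1) (.dec r), fun s _ _ =>
    (RunsIn.sub_reg s (by omega)).mono (Nat.linear_le_sq _ (by omega))⟩)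
    (fun m n => Nat.linear_le_sq _ (by omega)) h₁ h₂ fun _ => trivial

theorem mul {e₁ e₂ : X.α → ℕ} (h₁ : Evals X e₁) (h₂ : Evals X e₂) :
    Evals X (fun a => e₁ a * e₂ a) := by
  refine binop (D := fun _ _ => True) 5 (fun r => ⟨.seq (.loop r (.inc (r + 2)))
    (.seq (.loop (r + 2) (.copy r (r + 1) (r + 3))) (.loop (r + 1) .skip)), fun s _ h0 => ?_⟩)
    (fun m n => by nlinarith) h₁ h₂ fun _ => trivial
  have z₂ := h0 (r + 2) le_rfl
  have z₃ := h0 (r + 3) (by omega)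
  generalize hm : s.reg r = m
  generalize hn : s.reg (r + 1) = n
  -- The result is phrased as the invariant of the following loop at its start `i = m`, hence the
  -- product with `m - m`.
  have r₁ := (RunsIn.add_reg s (i := r + 2) (j := r) (by omega)).cast
    (u' := (s.set r ((m - m) * n)).set (r + 2) m) (T' := 2 * m + 1) rfl
    (ext_reg (fun l => by simp only [set_reg]; grind) rfl rfl rfl) (by rw [hm])
  have r₂ := RunsIn.loop (r := r + 2) (c := (.copy r (r + 1) (r + 3) : Cmd I O)) (B := 5 * n + 2)
    (N := m) (S := fun i => (s.set r ((m - i) * n)).set (r + 2) i) (fun i _ => by simp [set_reg])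
    (fun i hi => by
      refine (RunsIn.copy _ (i := r) (j := r + 1) (t := r + 3) (by omega) (by omega) (by omega)
        ?_).cast rfl (ext_reg (fun l => ?_) rfl rfl rfl) ?_
      · simp [set_reg, z₃]
      · have : (m - i) * n = (m - (i + 1)) * n + n := by
          rw [show m - i = (m - (i + 1)) + 1 by omega, Nat.succ_mul]
        simp only [set_reg]
        grind
      · simp [set_reg, hn])
  have r₃ := (RunsIn.clear_reg (((s.set r ((m - 0) * n)).set (r + 2) 0)) (r + 1)).mono
    (T' := 2 * n + 1) (by simp [set_reg, hn])
  refine (r₁.seq (r₂.seq r₃)).cast rfl (ext_reg (fun l => ?_) rfl rfl rfl) (by nlinarith)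
  simp only [set_reg]
  grind

/-- The result of the division loop: quotient and remainder in the counters `r + 3` and `r + 2`. -/
theorem divLoop (s : CounterState I O) (r : ℕ) (hb : 0 < s.reg (r + 1)) (h0 : s.reg (r + 2) = 0)
    (h0' : s.reg (r + 3) = 0) :
    RunsIn (.seq (.loop r (.divStep (r + 1) (r + 2) (r + 3))) (.loop (r + 1) .skip)) s
      ((((s.set r 0).set (r + 1) 0).set (r + 2) (s.reg r % s.reg (r + 1))).set (r + 3)
        (s.reg r / s.reg (r + 1)))
      (s.reg r * (2 * s.reg (r + 1) + 6) + 2 * s.reg (r + 1) + 2) := by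
  generalize hm : s.reg r = m
  generalize hn : s.reg (r + 1) = n at hb ⊢
  have r₁ := RunsIn.loop (r := r) (c := (.divStep (r + 1) (r + 2) (r + 3) : Cmd I O))
    (B := 2 * n + 5) (N := m) (S := fun i => (((s.set r i).set (r + 1) (n - (m - i) % n)).set (r + 2)
      ((m - i) % n)).set (r + 3) ((m - i) / n)) (fun i _ => by simp [set_reg])
    (fun i hi => by
      have hi' : m - i = (m - (i + 1)) + 1 := by omega
      refine (RunsIn.divStep _ (d := r + 1) (r := r + 2) (q := r + 3) (n := m - (i + 1))
        (by omega) (by omega) (by omega) hb ?_ ?_ ?_).cast rfl (ext_reg (fun l => ?_) rfl rfl rfl)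
        le_rfl
      · simp [set_reg]
      · simp [set_reg]
      · simp [set_reg]
      · rw [hi']
        simp only [set_reg]
        grind)
  refine ((r₁.cast (u := s) (ext_reg (fun l => ?_) rfl rfl rfl) rfl le_rfl).seq
    ((RunsIn.clear_reg _ (r + 1)).mono (T' := 2 * n + 1) ?_)).cast rfl
    (ext_reg (fun l => ?_) rfl rfl rfl) ?_
  · simp only [set_reg, Nat.sub_self, Nat.zero_mod, Nat.zero_div]
    grind
  · simp only [set_reg]
    grind
  · simp only [set_reg]
    grind
  · ring_nf
    omega

theorem div {e₁ e₂ : X.α → ℕ} (h₁ : Evals X e₁) (h₂ : Evals X e₂) (hpos : ∀ a, 0 < e₂ a) :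
    Evals X (fun a => e₁ a / e₂ a) := by
  refine binop (D := fun _ n => 0 < n) 10 (fun r => ⟨.seq (.seq (.loop r (.divStep (r + 1) (r + 2)
    (r + 3))) (.loop (r + 1) .skip)) (.seq (.loop (r + 2) .skip) (.loop (r + 3) (.inc r))),
    fun s hb h0 => ?_⟩) (fun m n => Nat.linear_le_sq _ (by have := Nat.div_le_self m n; omega))
    h₁ h₂ hpos
  have z₂ := h0 (r + 2) le_rfl
  have z₃ := h0 (r + 3) (by omega)
  have r₁ := divLoop s r hb z₂ z₃
  generalize hm : s.reg r = m at *
  generalize hn : s.reg (r + 1) = n at *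
  have hq := Nat.div_le_self m n
  have hr := (Nat.mod_lt m hb).le
  refine (r₁.seq (((RunsIn.clear_reg _ (r + 2)).mono (T' := 2 * n + 1) ?_).seq
    ((RunsIn.add_reg _ (i := r) (j := r + 3) (by omega)).mono (T' := 2 * m + 1) ?_))).cast rfl
    (ext_reg (fun l => ?_) rfl rfl rfl) (by nlinarith)
  all_goals simp only [set_reg]; grind

theorem mod {e₁ e₂ : X.α → ℕ} (h₁ : Evals X e₁) (h₂ : Evals X e₂) (hpos : ∀ a, 0 < e₂ a) :
    Evals X (fun a => e₁ a % e₂ a) := by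
  refine binop (D := fun _ n => 0 < n) 10 (fun r => ⟨.seq (.seq (.loop r (.divStep (r + 1) (r + 2)
    (r + 3))) (.loop (r + 1) .skip)) (.seq (.loop (r + 3) .skip) (.loop (r + 2) (.inc r))),
    fun s hb h0 => ?_⟩) (fun m n => Nat.linear_le_sq _ (by have := Nat.mod_le m n; omega))
    h₁ h₂ hpos
  have z₂ := h0 (r + 2) le_rfl
  have z₃ := h0 (r + 3) (by omega)
  have r₁ := divLoop s r hb z₂ z₃
  generalize hm : s.reg r = m at *
  generalize hn : s.reg (r + 1) = n at *
  have hq := Nat.div_le_self m n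
  have hr := (Nat.mod_lt m hb).le
  refine (r₁.seq (((RunsIn.clear_reg _ (r + 3)).mono (T' := 2 * m + 1) ?_).seq
    ((RunsIn.add_reg _ (i := r) (j := r + 2) (by omega)).mono (T' := 2 * n + 1) ?_))).cast rfl
    (ext_reg (fun l => ?_) rfl rfl rfl) (by nlinarith)
  all_goals simp only [set_reg]; grind

theorem ite_zero {e₀ e₁ e₂ : X.α → ℕ} (h₀ : Evals X e₀) (h₁ : Evals X e₁) (h₂ : Evals X e₂) :
    Evals X (fun a => if e₀ a = 0 then e₁ a else e₂ a) := by
  intro r hr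
  obtain ⟨c₀, P₀, hc₀⟩ := h₀ r hr
  obtain ⟨c₁, P₁, hc₁⟩ := h₁ r hr
  obtain ⟨c₂, P₂, hc₂⟩ := h₂ r hr
  -- Counter `r` must be zero again before a branch runs. In the first branch it already is; in the
  -- second it is cleared, which costs up to `2 * P₀ + 1` more steps.
  refine ⟨.seq c₀ (.ifz r c₁ (.seq (.loop r .skip) c₂)), 3 * P₀ + P₁ + P₂ + 2, fun a => ⟨?_,
    fun s hs => ?_⟩⟩
  · have b₁ := (hc₁ a).1
    have b₂ := (hc₂ a).1
    simp only [Polynomial.eval_add]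
    split_ifs <;> omega
  · have b₀ := (hc₀ a).1
    have hz : (s.set r (e₀ a)).set r 0 = s := by
      have := hs.reg_zero r le_rfl
      refine ext_reg (fun l => ?_) rfl rfl rfl
      simp only [set_reg]
      grind
    have hv : (s.set r (e₀ a)).reg r = e₀ a := by simp [set_reg]
    have r₀ := (hc₀ a).2 s hs
    by_cases h : e₀ a = 0
    · simp only [h, if_true]
      have hz' : s.set r (e₀ a) = s := by rw [← hz, h]; simp [CounterState.set]
      rw [hz'] at r₀
      refine (r₀.seq (.ifz_zero (hs.reg_zero r le_rfl) ((hc₁ a).2 s hs))).mono ?_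
      simp
      omega
    · simp only [h, if_false]
      have r₂ := RunsIn.clear_reg (s.set r (e₀ a)) r
      rw [hz, hv] at r₂
      refine (r₀.seq (.ifz_pos (by rwa [hv]) (r₂.seq ((hc₂ a).2 s hs)))).mono ?_
      simp
      omega

end Evals

/-- The predicate `p` can be decided in polynomial time. -/
def EvalsP (X : Ctx I O) (p : X.α → Prop) : Prop :=
  ∃ e, Evals X e ∧ ∀ a, e a = 0 ↔ p a

/-! ### Decidable predicates and writing of strings -/

section
variable {X : Ctx I O}

namespace EvalsP

/-- Truth is coded by the value zero. Truncated subtraction therefore decides `≤`, sums act as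
conjunctions, products as disjunctions, and `1 - e` as negation. -/
theorem le {e₁ e₂ : X.α → ℕ} (h₁ : Evals X e₁) (h₂ : Evals X e₂) :
    EvalsP X (fun a => e₁ a ≤ e₂ a) :=
  ⟨_, h₁.sub h₂, fun _ => Nat.sub_eq_zero_iff_le⟩

theorem lt {e₁ e₂ : X.α → ℕ} (h₁ : Evals X e₁) (h₂ : Evals X e₂) :
    EvalsP X (fun a => e₁ a < e₂ a) :=
  ⟨_, (h₁.add (.const 1)).sub h₂, fun _ => Nat.sub_eq_zero_iff_le⟩

theorem eq {e₁ e₂ : X.α → ℕ} (h₁ : Evals X e₁) (h₂ : Evals X e₂) :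
    EvalsP X (fun a => e₁ a = e₂ a) :=
  ⟨_, (h₁.sub h₂).add (h₂.sub h₁), fun _ => by omega⟩

theorem and {p q : X.α → Prop} (hp : EvalsP X p) (hq : EvalsP X q) :
    EvalsP X (fun a => p a ∧ q a) :=
  let ⟨_, h, hp⟩ := hp
  let ⟨_, h', hq⟩ := hq
  ⟨_, h.add h', fun a => by rw [Nat.add_eq_zero_iff, hp, hq]⟩

theorem or {p q : X.α → Prop} (hp : EvalsP X p) (hq : EvalsP X q) :
    EvalsP X (fun a => p a ∨ q a) :=
  let ⟨_, h, hp⟩ := hp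
  let ⟨_, h', hq⟩ := hq
  ⟨_, h.mul h', fun a => by rw [Nat.mul_eq_zero, hp, hq]⟩

theorem not {p : X.α → Prop} (hp : EvalsP X p) : EvalsP X (fun a => ¬ p a) :=
  let ⟨_, h, hp⟩ := hp
  ⟨_, (Evals.const 1).sub h, fun a => by have := hp a; grind⟩

theorem imp {p q : X.α → Prop} (hp : EvalsP X p) (hq : EvalsP X q) :
    EvalsP X (fun a => p a → q a) := by
  convert hp.not.or hq using 2
  exact imp_iff_not_or

end EvalsP

theorem Evals.ite {p : X.α → Prop} [DecidablePred p] {e₁ e₂ : X.α → ℕ} (hp : EvalsP X p)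
    (h₁ : Evals X e₁) (h₂ : Evals X e₂) : Evals X (fun a => if p a then e₁ a else e₂ a) := by
  obtain ⟨e, h, hp⟩ := hp
  convert h.ite_zero h₁ h₂ using 2
  simp only [hp]

namespace Emits

theorem nil : Emits X (fun _ => []) :=
  ⟨.skip, 1, fun _ s _ => (RunsIn.skip s).cast rfl rfl (by simp)⟩

/-- The output grows at its front, so the command for the second string has to run first. -/
theorem append {f g : X.α → List O} (hf : Emits X f) (hg : Emits X g) :
    Emits X (fun a => f a ++ g a) := by
  obtain ⟨c, P, hc⟩ := hf
  obtain ⟨d, Q, hd⟩ := hg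
  refine ⟨.seq d c, P + Q, fun a s hs => ((hd a s hs).seq (hc a _
    ⟨hs.reg_eq, hs.reg_zero, hs.inp_eq, hs.rev_eq⟩)).cast rfl ?_ ?_⟩
  · simp
  · simp [Nat.add_comm]

theorem cons (o : O) {f : X.α → List O} (hf : Emits X f) : Emits X (fun a => o :: f a) := by
  obtain ⟨c, P, hc⟩ := hf
  exact ⟨.seq c (.emit o), P + 1, fun a s hs =>
    ((hc a s hs).seq (.emit _ o)).cast rfl rfl (by simp)⟩

theorem ite {p : X.α → Prop} [DecidablePred p] {f g : X.α → List O} (hp : EvalsP X p)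
    (hf : Emits X f) (hg : Emits X g) : Emits X (fun a => if p a then f a else g a) := by
  obtain ⟨e, he, hp⟩ := hp
  obtain ⟨c₀, P₀, hc₀⟩ := he X.k le_rfl
  obtain ⟨c, P, hc⟩ := hf
  obtain ⟨d, Q, hd⟩ := hg
  refine ⟨.seq c₀ (.ifz X.k c (.seq (.loop X.k .skip) d)), 3 * P₀ + P + Q + 2, fun a s hs => ?_⟩
  have b₀ := (hc₀ a).1
  have hz : (s.set X.k (e a)).set X.k 0 = s := by
    have := hs.reg_zero X.k le_rfl
    refine ext_reg (fun l => ?_) rfl rfl rfl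
    simp only [set_reg]
    grind
  have hv : (s.set X.k (e a)).reg X.k = e a := by simp [set_reg]
  have r₀ := (hc₀ a).2 s hs
  by_cases h : p a
  · simp only [h, if_true]
    rw [← hp] at h
    have hz' : s.set X.k (e a) = s := by rw [← hz, h]; simp [CounterState.set]
    rw [hz'] at r₀
    refine (r₀.seq (.ifz_zero (hs.reg_zero X.k le_rfl) (hc a s hs))).mono ?_
    simp
    omega
  · simp only [h, if_false]
    rw [← hp] at h
    have r₂ := RunsIn.clear_reg (s.set X.k (e a)) X.k
    rw [hz, hv] at r₂
    refine (r₀.seq (.ifz_pos (by rwa [hv]) (r₂.seq (hd a s hs)))).mono ?_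
    simp
    omega

/-- The loop counter descends to zero while every pass writes in front of the output, so the pieces
end up in increasing order. The body sees the loop counter as the additional counter of `X.ext`. -/
theorem flatMap {e : X.α → ℕ} {f : X.α → ℕ → List O} (he : Evals X e)
    (hf : Emits X.ext (fun a => f a.1 a.2)) :
    Emits X (fun a => (List.range (e a)).flatMap (fun i => f a i)) := by
  obtain ⟨c₀, P₀, hc₀⟩ := he X.k le_rfl
  obtain ⟨c, P, hc⟩ := hf
  -- Within the body the size is `sz a + i` with `i` below the bound `P₀`, which explains the
  -- composition with `X + P₀`.
  refine ⟨.seq c₀ (.loop X.k c), P₀ + P₀ * (P.comp (.X + P₀) + 1) + 1, fun a s hs => ?_⟩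
  have b₀ := (hc₀ a).1
  have r₁ := RunsIn.loop (r := X.k) (c := c) (B := P.eval (X.sz a + e a)) (N := e a)
    (S := fun i => { s.set X.k i with
      out := ((List.range (e a)).drop i).flatMap (fun i => f a i) ++ s.out })
    (fun i _ => by simp [set_reg]) (fun i hi => by
      refine (hc (a, i) ({ s.set X.k (i + 1) with
        out := ((List.range (e a)).drop (i + 1)).flatMap (fun i => f a i) ++ s.out }.set X.k i)
        ⟨fun j hj => ?_, fun j hj => ?_, hs.inp_eq, hs.rev_eq⟩).cast rfl ?_
        (P.eval_nat_mono (Nat.add_le_add_left hi.le _))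
      · have hj' : j < X.k + 1 := hj
        have := hs.reg_eq j
        simp only [CounterState.set, Function.update_apply, Ctx.ext]
        grind
      · have hj' : X.k + 1 ≤ j := hj
        have := hs.reg_zero j (by omega)
        simp only [CounterState.set, Function.update_apply]
        grind
      · rw [List.drop_eq_getElem_cons (l := List.range (e a)) (i := i) (by simpa using hi)]
        simp [CounterState.set])
  refine (((hc₀ a).2 s hs).seq (r₁.cast ?_ rfl le_rfl)).cast rfl ?_ ?_
  · rw [List.drop_of_length_le (by simp)]
    rfl
  · have := hs.reg_zero X.k le_rfl
    simp only [CounterState.set, List.drop_zero]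
    congr
    rw [← this, Function.update_eq_self]
  · simp only [Polynomial.eval_add, Polynomial.eval_mul, Polynomial.eval_comp, Polynomial.eval_X,
      Polynomial.eval_one]
    have := P.eval_nat_mono (Nat.add_le_add_left b₀ (X.sz a))
    have := Nat.mul_le_mul b₀ (Nat.add_le_add_right this 1)
    omega

theorem replicate {e : X.α → ℕ} (he : Evals X e) (o : O) :
    Emits X (fun a => List.replicate (e a) o) := by
  convert flatMap he (f := fun _ _ => [o]) (.cons o .nil) using 2 with a
  generalize e a = n
  induction n with
  | zero => rfl
  | succ n ih => rw [List.range_succ, List.flatMap_append, ← ih, List.replicate_succ']; rfl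

end Emits

/-! ### Reading a segment of the input -/

/-- The sum of the weights `w` of the symbols in the segment number `c - 1` of a string (if `c > 0`),
where the segments end at the symbols marked by `d`. -/
def segSum (w : I → ℕ) (d : I → Bool) : ℕ → List I → ℕ
  | 0, _ => 0
  | _ + 1, [] => 0
  | c + 1, i :: l => (if c = 0 then w i else 0) + segSum w d (if d i then c else c + 1) l

theorem segSum_zero (w : I → ℕ) (d : I → Bool) (l : List I) : segSum w d 0 l = 0 := by
  cases l <;> rfl

theorem segSum_le (w : I → ℕ) (d : I → Bool) {B : ℕ} (hB : ∀ i, w i ≤ B) (c : ℕ) (l : List I) :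
    segSum w d c l ≤ l.length * B := by
  induction l generalizing c with
  | nil => cases c <;> simp [segSum]
  | cons i l ih =>
    cases c with
    | zero => simp [segSum]
    | succ c =>
      have := ih (if d i then c else c + 1)
      have := hB i
      rw [segSum, List.length_cons, Nat.succ_mul]
      split_ifs at * <;> omega

/-- The command that adds `n` to the counter `r`. -/
def Cmd.addConst (r : ℕ) : ℕ → Cmd I O
  | 0 => .skip
  | n + 1 => .seq (.inc r) (addConst r n)

theorem RunsIn.addConst (s : CounterState I O) (r n : ℕ) :
    RunsIn (.addConst r n) s (s.set r (s.reg r + n)) (n + 1) := by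
  induction n generalizing s with
  | zero =>
    refine (RunsIn.skip s).cast rfl (ext_reg (fun l => ?_) rfl rfl rfl) le_rfl
    simp only [set_reg]
    grind
  | succ n ih =>
    refine ((RunsIn.inc s r).seq (ih _)).cast rfl (ext_reg (fun l => ?_) rfl rfl rfl) (by omega)
    simp only [set_reg]
    grind

/-- The command for one symbol of `segSum`, with the counter `r` for the sum and `r + 1` for the
segments. -/
def Cmd.segStep (w : I → ℕ) (d : I → Bool) (r : ℕ) (i : I) : Cmd I O :=
  .ifz (r + 1) .skip (.seq (.dec (r + 1)) (.seq
    (.ifz (r + 1) (.addConst r (w i)) .skip)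
    (if d i then .skip else .inc (r + 1))))

/-- The number of segments left after the symbol `i`. -/
def segNext (d : I → Bool) (c : ℕ) (i : I) : ℕ := if d i then c - 1 else c

theorem segSum_cons (w : I → ℕ) (d : I → Bool) (c : ℕ) (i : I) (l : List I) :
    segSum w d c (i :: l) = (if c = 1 then w i else 0) + segSum w d (segNext d c i) l := by
  cases c with
  | zero => cases h : d i <;> simp [segSum, segNext, segSum_zero, h]
  | succ c => simp [segSum, segNext]

theorem RunsIn.segStep (s : CounterState I O) (w : I → ℕ) (d : I → Bool) (r : ℕ) (i : I) :
    RunsIn (.segStep w d r i) s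
      ((s.set r (s.reg r + if s.reg (r + 1) = 1 then w i else 0)).set (r + 1)
        (segNext d (s.reg (r + 1)) i)) (w i + 5) := by
  generalize hc : s.reg (r + 1) = c
  rcases Nat.eq_zero_or_pos c with rfl | hpos
  · refine (RunsIn.ifz_zero hc (.skip _)).cast rfl (ext_reg (fun l => ?_) rfl rfl rfl) (by omega)
    simp only [set_reg, segNext]
    grind
  refine RunsIn.mono (T := 1 + (w i + 2 + 1) + 1) (.ifz_pos (by omega) ((RunsIn.dec _ _).seq
    (.seq (s' := (s.set (r + 1) (c - 1)).set r (s.reg r + if c = 1 then w i else 0)) ?_ ?_)))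
    (by omega)
  · rw [hc]
    by_cases h1 : c = 1
    · refine (RunsIn.ifz_zero ?_ (.addConst _ r (w i))).cast rfl
        (ext_reg (fun l => ?_) rfl rfl rfl) le_rfl
      all_goals simp only [set_reg]; grind
    · refine (RunsIn.ifz_pos ?_ (.skip _)).cast rfl (ext_reg (fun l => ?_) rfl rfl rfl) (by omega)
      all_goals simp only [set_reg]; grind
  · by_cases hd : d i = true
    · rw [if_pos hd]
      refine (RunsIn.skip _).cast rfl (ext_reg (fun l => ?_) rfl rfl rfl) le_rfl
      simp only [set_reg, segNext]
      grind
    · rw [if_neg hd]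
      refine (RunsIn.inc _ _).cast rfl (ext_reg (fun l => ?_) rfl rfl rfl) le_rfl
      simp only [set_reg, segNext]
      grind

theorem RunsIn.scan_segStep (s : CounterState I O) (w : I → ℕ) (d : I → Bool) (r : ℕ) {B : ℕ}
    (hB : ∀ i, w i ≤ B) {l m : List I} (hl : s.inp = l) (hm : s.rev = m) :
    RunsIn (.scan (.segStep w d r)) s
      { s with
        reg := Function.update (Function.update s.reg r
          (s.reg r + segSum w d (s.reg (r + 1)) l)) (r + 1) (l.foldl (segNext d) (s.reg (r + 1)))
        inp := []
        rev := l.reverse ++ m } (l.length * (B + 6) + 1) := by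
  induction l generalizing s m with
  | nil =>
    refine RunsIn.cast ⟨1, le_rfl, .scan_nil hl⟩ rfl (ext_reg (fun l => ?_) hl hm rfl) (by simp)
    have : segSum w d (s.reg (r + 1)) [] = 0 := by cases s.reg (r + 1) <;> rfl
    simp only [Function.update_apply, List.foldl_nil, this]
    grind
  | cons i l ih =>
    obtain ⟨t, ht, hr⟩ := RunsIn.segStep { s with inp := l, rev := i :: m } w d r i
    obtain ⟨u, hu, hr'⟩ := ih (({ s with inp := l, rev := i :: m }.set r
      (s.reg r + if s.reg (r + 1) = 1 then w i else 0)).set (r + 1)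
        (segNext d (s.reg (r + 1)) i)) (m := i :: m) rfl rfl
    have := hB i
    refine RunsIn.cast ⟨t + u + 1, le_rfl, .scan_cons hl (by rw [hm]; exact hr) hr'⟩ rfl
      (ext_reg (fun j => ?_) rfl (by simp) rfl) ?_
    · simp only [Function.update_apply, set_reg, segSum_cons, List.foldl_cons]
      grind
    · rw [List.length_cons, Nat.succ_mul]
      omega

theorem foldl_segNext_le (d : I → Bool) (c : ℕ) (l : List I) : l.foldl (segNext d) c ≤ c := by
  induction l generalizing c with
  | nil => exact le_rfl
  | cons i l ih =>
    refine (ih _).trans ?_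
    unfold segNext
    split_ifs <;> omega

/-- This is how the computations access the input. The segment number is placed in counter `r + 1`,
one scan accumulates the sum in counter `r`, and rewinding restores the input for later reads. -/
theorem Evals.segSum [Finite I] (w : I → ℕ) (d : I → Bool) {e : X.α → ℕ} (he : Evals X e) :
    Evals X (fun a => segSum w d (e a) (X.x a)) := by
  intro r hr
  obtain ⟨c, P, hc⟩ := he (r + 1) (by omega)
  obtain ⟨B, hB⟩ := (Set.finite_range w).bddAbove
  replace hB : ∀ i, w i ≤ B := fun i => hB ⟨i, rfl⟩
  refine ⟨.seq (.seq .skip c) (.seq (.scan (.segStep w d r)) (.seq .rewind (.loop (r + 1) .skip))),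
    3 * P + .X * (.C B + 7) + 4, fun a => ?_⟩
  have hl := X.length_le a
  have hx : (X.x a).length * B ≤ X.sz a * B := Nat.mul_le_mul_right _ hl
  refine ⟨(segSum_le w d hB _ _).trans ?_, fun s hs => ?_⟩
  · simp only [Polynomial.eval_add, Polynomial.eval_mul, Polynomial.eval_X, Polynomial.eval_C]
    nlinarith
  have hr₀ := hs.reg_zero r le_rfl
  have hr₁ := hs.reg_zero (r + 1) (by omega)
  have h₁ := (hc a).2 s ⟨hs.reg_eq, fun j hj => hs.reg_zero j (by omega), hs.inp_eq, hs.rev_eq⟩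
  have h₂ := RunsIn.scan_segStep (s.set (r + 1) (e a)) w d r hB hs.inp_eq hs.rev_eq
  have h₃ := RunsIn.rewind (O := O) { (s.set (r + 1) (e a)) with
        reg := Function.update (Function.update (s.set (r + 1) (e a)).reg r
          ((s.set (r + 1) (e a)).reg r + _root_.segSum w d ((s.set (r + 1) (e a)).reg (r + 1)) (X.x a)))
          (r + 1) ((X.x a).foldl (segNext d) ((s.set (r + 1) (e a)).reg (r + 1)))
        inp := []
        rev := (X.x a).reverse ++ [] }
  have hf := foldl_segNext_le d (e a) (X.x a)
  have hP := (hc a).1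
  refine (((RunsIn.skip s).seq h₁).seq (h₂.seq (h₃.seq ((RunsIn.clear_reg _ (r + 1)).mono
    (T' := 2 * P.eval (X.sz a) + 1) ?_)))).cast rfl (ext_reg (fun j => ?_) ?_ ?_ rfl) ?_
  · simp [set_reg]
    omega
  · simp only [Function.update_apply, set_reg]
    grind
  · simp [hs.inp_eq]
  · simp [hs.rev_eq]
  · simp
    nlinarith

end

/-- A function whose values are emitted in polynomial time as strings is computable in polynomial
time. -/
theorem Emits.computableInPolyTime [Inhabited I] [Fintype I] {α β : Type} {ea : α → List I}
    {eb : β → List O} {f : α → β}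
    (h : Emits (I := I) (O := O) ⟨α, 0, fun _ _ => 0, ea, fun a => (ea a).length,
      fun _ _ h => absurd h (Nat.not_lt_zero _), fun _ => le_rfl⟩ (fun a => eb (f a))) :
    Nonempty (TM2ComputableInPolyTime ea eb f) := by
  obtain ⟨c, P, hc⟩ := h
  -- The final configuration must have an empty input tape, hence the draining and the linear term
  -- in the bound.
  refine Cmd.computableInPolyTime (.seq c .drain) (P + .X + 1) fun a => ?_
  have h₁ := hc a ⟨fun _ => 0, ea a, [], []⟩ ⟨fun _ _ => rfl, fun _ _ => rfl, rfl, rfl⟩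
  have h₂ := h₁.seq (RunsIn.drain _)
  exact h₂.cast rfl (by simp) (by simp; omega)

end

/-! ### Values of the wires of circuits -/

section
variable {G R : Type} {ev : G → (ℕ → R) → R} {d : R} {B : ℕ → G → Prop}

theorem runGates_append_singleton (gates : List G) (g : G) (x : List R) :
    runGates ev d (gates ++ [g]) x =
      runGates ev d gates x ++ [ev g (fun i => (runGates ev d gates x).getD i d)] := by
  simp [runGates, List.foldl_append]

/-- The wires of a straight-line program have the values that are determined by the equations of its
gates. -/
theorem runGates_eq_map (hB : ∀ w g v v', B w g → (∀ i < w, v i = v' i) → ev g v = ev g v')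
    (gates : List G) (x : List R) (hg : ∀ t g, gates[t]? = some g → B (x.length + t) g) (v : ℕ → R)
    (hx : ∀ i < x.length, v i = x.getD i d)
    (hv : ∀ t g, gates[t]? = some g → v (x.length + t) = ev g v) :
    runGates ev d gates x = (List.range (x.length + gates.length)).map v := by
  induction gates using List.reverseRecOn with
  | nil =>
    refine List.ext_getElem (by simp [runGates]) fun i h₁ h₂ => ?_
    have h₁' : i < x.length := by simpa [runGates] using h₁
    simp [runGates, hx i h₁', h₁']
  | append_singleton gates g ih =>
    have ih' := ih (fun t g h => hg t g (by
        rw [List.getElem?_append_left (List.getElem?_eq_some_iff.1 h).1, h]))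
      (fun t g h => hv t g (by
        rw [List.getElem?_append_left (List.getElem?_eq_some_iff.1 h).1, h]))
    have hlast : (gates ++ [g])[gates.length]? = some g := by simp
    rw [runGates_append_singleton, ih', List.length_append, List.length_singleton, ← Nat.add_assoc,
      List.range_succ, List.map_append, List.map_singleton, hv _ g hlast]
    congr 2
    refine hB _ g _ _ (hg _ g hlast) fun i hi => ?_
    simp [hi]

/-- Append the gates one at a time and update the assignment at the new wire. Bounded gates never
look at that wire, so the earlier equations survive. With `runGates_eq_map`, evaluation is replaced
by reasoning about any solution of the gate equations. -/
theorem exists_wireValues (hB : ∀ w g v v', B w g → (∀ i < w, v i = v' i) → ev g v = ev g v')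
    (gates : List G) (x : List R) (hg : ∀ t g, gates[t]? = some g → B (x.length + t) g) :
    ∃ v : ℕ → R, (∀ i < x.length, v i = x.getD i d) ∧
      ∀ t g, gates[t]? = some g → v (x.length + t) = ev g v := by
  induction gates using List.reverseRecOn with
  | nil => exact ⟨fun i => x.getD i d, fun _ _ => rfl, fun t g h => by simp at h⟩
  | append_singleton gates g ih =>
    obtain ⟨v, hx, hv⟩ := ih (fun t g h => hg t g (by
        rw [List.getElem?_append_left (List.getElem?_eq_some_iff.1 h).1, h]))
    refine ⟨Function.update v (x.length + gates.length) (ev g v), fun i hi => ?_, fun t g' h => ?_⟩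
    · rw [Function.update_of_ne (by omega), hx i hi]
    · have hb := hg t g' h
      have ht : t ≤ gates.length := by
        have := (List.getElem?_eq_some_iff.1 h).1
        simp at this
        omega
      have he : ev g' (Function.update v (x.length + gates.length) (ev g v)) = ev g' v :=
        hB _ g' _ _ hb fun i hi => Function.update_of_ne (by omega) _ _
      rw [he]
      rcases ht.lt_or_eq with h' | rfl
      · rw [Function.update_of_ne (by omega)]
        exact hv t g' (by rwa [List.getElem?_append_left h'] at h)
      · have : g = g' := by simpa using h
        rw [Function.update_self, this]

end

theorem BoolGate.eval_congr (w : ℕ) (g : BoolGate) (v v' : ℕ → Bool) (hg : g.Bounded w)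
    (h : ∀ i < w, v i = v' i) : g.eval v = g.eval v' := by
  cases g with
  | and i j => simp only [eval, h i hg.1, h j hg.2]
  | or i j => simp only [eval, h i hg.1, h j hg.2]
  | not i => simp only [eval, h i hg]

theorem BoolGate.arith_congr {R : Type} [CommRing R] (w : ℕ) (g : BoolGate) (v v' : ℕ → R)
    (hg : g.Bounded w) (h : ∀ i < w, v i = v' i) : g.arith v = g.arith v' := by
  cases g with
  | and i j => simp only [arith, h i hg.1, h j hg.2]
  | or i j => simp only [arith, h i hg.1, h j hg.2]
  | not i => simp only [arith, h i hg]

theorem ArithGate.eval_congr {F R : Type} [Field F] [CommRing R] [Algebra F R] (w : ℕ)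
    (g : ArithGate F) (v v' : ℕ → R) (hg : g.Bounded w) (h : ∀ i < w, v i = v' i) :
    g.eval v = g.eval v' := by
  cases g with
  | const a => rfl
  | add i j => simp only [eval, h i hg.1, h j hg.2]
  | sub i j => simp only [eval, h i hg.1, h j hg.2]
  | mul i j => simp only [eval, h i hg.1, h j hg.2]

namespace BoolCircuit

variable {m : ℕ} (C : BoolCircuit m)

/-- The working form of evaluation: any assignment that solves the gate equations and extends the
input gives the output. It may be defined on far more wires than the circuit has. -/
theorem eval_eq {x : Fin m → Bool} {v : ℕ → Bool} (hx : ∀ i : Fin m, v i = x i)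
    (hv : ∀ t g, C.gates[t]? = some g → v (m + t) = g.eval v) : C.eval x = v C.out := by
  rw [BoolCircuit.eval, runGates_eq_map BoolGate.eval_congr C.gates (List.ofFn x)
    (by simpa using C.gates_bounded) v (fun i hi => ?_) (by simpa using hv)]
  · simp [C.out_lt]
  · have hi' : i < m := by simpa using hi
    simp [hi', ← hx]

theorem arith_eq {R : Type} [CommRing R] {x : Fin m → R} {v : ℕ → R} (hx : ∀ i : Fin m, v i = x i)
    (hv : ∀ t g, C.gates[t]? = some g → v (m + t) = g.arith v) : C.arith x = v C.out := by
  rw [BoolCircuit.arith, runGates_eq_map BoolGate.arith_congr C.gates (List.ofFn x)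
    (by simpa using C.gates_bounded) v (fun i hi => ?_) (by simpa using hv)]
  · simp [C.out_lt]
  · have hi' : i < m := by simpa using hi
    simp [hi', ← hx]

theorem exists_boolValues (x : Fin m → Bool) : ∃ v : ℕ → Bool, (∀ i : Fin m, v i = x i) ∧
    ∀ t g, C.gates[t]? = some g → v (m + t) = g.eval v := by
  obtain ⟨v, hx, hv⟩ := exists_wireValues (d := false) BoolGate.eval_congr C.gates (List.ofFn x)
    (by simpa using C.gates_bounded)
  exact ⟨v, fun i => by simpa using hx i (by simp), by simpa using hv⟩

/-- On bit strings the arithmetization agrees with the circuit. -/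
theorem arith_bitVec {R : Type} [CommRing R] (x : Fin m → Bool) :
    C.arith (bitVec x : Fin m → R) = if C.eval x then 1 else 0 := by
  obtain ⟨v, hx, hv⟩ := C.exists_boolValues x
  rw [C.eval_eq hx hv, C.arith_eq (v := fun i => if v i then (1 : R) else 0)]
  · intro i
    simp [bitVec, hx]
  · intro t g hg
    simp only [hv t g hg]
    cases g with
    | and i j => cases hi : v i <;> cases hj : v j <;> simp [BoolGate.eval, BoolGate.arith, hi, hj]
    | or i j => cases hi : v i <;> cases hj : v j <;> simp [BoolGate.eval, BoolGate.arith, hi, hj]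
    | not i => cases hi : v i <;> simp [BoolGate.eval, BoolGate.arith, hi]

end BoolCircuit

/-! ### Arithmetic circuits with gates in blocks of three -/

/-- Gates of a richer kind, realized by blocks of three arithmetic gates. -/
inductive BlockGate : Type
  | zero
  | one
  | inp (i : ℕ)
  | copy (i : ℕ)
  | add (i j : ℕ)
  | sub (i j : ℕ)
  | mul (i j : ℕ)
  | or (i j : ℕ)
  | not (i : ℕ)

namespace BlockGate

def eval {R : Type} [CommRing R] (x v : ℕ → R) : BlockGate → R
  | zero => 0
  | one => 1
  | inp i => x i
  | copy i => v i
  | add i j => v i + v j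
  | sub i j => v i - v j
  | mul i j => v i * v j
  | or i j => 1 - (1 - v i) * (1 - v j)
  | not i => 1 - v i

/-- The arguments of the gate are among `N` inputs and the first `w` blocks. -/
def Bounded (N w : ℕ) : BlockGate → Prop
  | zero => True
  | one => True
  | inp i => i < N
  | copy i => i < w
  | add i j => i < w ∧ j < w
  | sub i j => i < w ∧ j < w
  | mul i j => i < w ∧ j < w
  | or i j => i < w ∧ j < w
  | not i => i < w

/-- The wire with the result of the block number `i` in a circuit with `N` inputs. -/
def wire (N i : ℕ) : ℕ := N + (3 * i + 2)

/-- The block number `w` of a circuit with `N` inputs. -/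
def block (F : Type) [Field F] (N w : ℕ) : BlockGate → List (ArithGate F)
  | zero => [.const 0, .const 0, .const 0]
  | one => [.const 0, .const 0, .const 1]
  -- There is no copying gate; the value is added to the zero on the first wire of the block.
  | inp i => [.const 0, .const 0, .add i (N + 3 * w)]
  | copy i => [.const 0, .const 0, .add (wire N i) (N + 3 * w)]
  | add i j => [.const 0, .const 0, .add (wire N i) (wire N j)]
  | sub i j => [.const 0, .const 0, .sub (wire N i) (wire N j)]
  | mul i j => [.const 0, .const 0, .mul (wire N i) (wire N j)]
  -- Uses `1 - (1 - a) * (1 - b) = (a + b) - a * b`, the only kind of block that needs three genuine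
  -- gates.
  | or i j => [.add (wire N i) (wire N j), .mul (wire N i) (wire N j),
      .sub (N + 3 * w) (N + (3 * w + 1))]
  | not i => [.const 0, .const 1, .sub (N + (3 * w + 1)) (wire N i)]

theorem length_block (F : Type) [Field F] (N w : ℕ) (g : BlockGate) :
    (g.block F N w).length = 3 := by
  cases g <;> rfl

end BlockGate

theorem getElem?_flatMap_range {α : Type} (f : ℕ → List α) (hf : ∀ i, (f i).length = 3) {W v r : ℕ}
    (hv : v < W) (hr : r < 3) : ((List.range W).flatMap f)[3 * v + r]? = (f v)[r]? := by
  have hlen : ∀ W, ((List.range W).flatMap f).length = 3 * W := fun W => by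
    simp [List.length_flatMap, hf, Nat.mul_comm]
  induction W with
  | zero => omega
  | succ W ih =>
    rw [List.range_succ, List.flatMap_append]
    rcases Nat.lt_succ_iff_lt_or_eq.1 hv with h | rfl
    · rw [List.getElem?_append_left (by rw [hlen]; omega), ih h]
    · rw [List.getElem?_append_right (by rw [hlen]; omega), hlen]
      simp

/-- The arithmetic circuit with the blocks `g 0, …, g (W - 1)`, whose output is the last one. -/
def blockCircuit (F : Type) [Field F] (N W : ℕ) (g : ℕ → BlockGate) (hW : 0 < W)
    (hg : ∀ w < W, (g w).Bounded N w) : ArithCircuit F N where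
  gates := (List.range W).flatMap fun w => (g w).block F N w
  out := BlockGate.wire N (W - 1)
  gates_bounded t a ha := by
    have hlen : t < W * 3 := by
      have := (List.getElem?_eq_some_iff.1 ha).1
      simpa [List.length_flatMap, BlockGate.length_block] using this
    have hw : t / 3 < W := by omega
    have h3 : t % 3 < 3 := Nat.mod_lt _ (by omega)
    rw [← Nat.div_add_mod t 3] at ha ⊢
    rw [getElem?_flatMap_range _ (fun i => BlockGate.length_block F N i _) hw h3] at ha
    have hb := hg _ hw
    revert ha hb h3
    generalize t / 3 = w
    generalize t % 3 = r
    generalize g w = b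
    intro ha h3 hb
    interval_cases r <;> cases b <;>
      simp only [BlockGate.block, List.getElem?_cons_zero, List.getElem?_cons_succ,
        Option.some.injEq, BlockGate.Bounded] at ha hb <;> subst ha <;>
      simp only [ArithGate.Bounded, BlockGate.wire] <;> omega
  out_lt := by
    simp [List.length_flatMap, BlockGate.length_block, BlockGate.wire]
    omega

/-- Blocks refer to one another only through their third wires. Eliminating the first two wires from
the three gate equations leaves one equation per block. -/
theorem exists_blockValues {F : Type} [Field F] {N W : ℕ} {g : ℕ → BlockGate} (hW : 0 < W)
    (hg : ∀ w < W, (g w).Bounded N w) {R : Type} [CommRing R] [Algebra F R] (x : Fin N → R) :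
    ∃ v : ℕ → R, (∀ w < W, v w = (g w).eval (fun i => (List.ofFn x).getD i 0) v) ∧
      (blockCircuit F N W g hW hg).eval x = v (W - 1) := by
  obtain ⟨v, hx, hv⟩ := exists_wireValues (d := (0 : R)) ArithGate.eval_congr
    (blockCircuit F N W g hW hg).gates (List.ofFn x)
    (by simpa using (blockCircuit F N W g hW hg).gates_bounded)
  have hl : (List.ofFn x).length = N := List.length_ofFn
  refine ⟨fun w => v (BlockGate.wire N w), fun w hw => ?_, ?_⟩
  · have hb := hg w hw
    have h : ∀ r < 3, ∀ a, ((g w).block F N w)[r]? = some a → v (N + (3 * w + r)) = a.eval v := by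
      intro r hr a ha
      have h' := hv (3 * w + r) a
      rw [hl] at h'
      refine h' ?_
      rw [← ha]
      exact getElem?_flatMap_range _ (fun i => BlockGate.length_block F N i _) hw hr
    have h₀ := h 0 (by omega)
    have h₁ := h 1 (by omega)
    have h₂ := h 2 (by omega)
    clear h hv
    revert h₀ h₁ h₂ hb
    generalize g w = b
    intro hb h₀ h₁ h₂
    cases b with
    | inp i =>
      have hi : v i = (List.ofFn x).getD i 0 := hx i (by rw [hl]; exact hb)
      simp_all [BlockGate.block, BlockGate.eval, ArithGate.eval, BlockGate.wire]
    | or i j =>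
      simp [BlockGate.block, ArithGate.eval, BlockGate.wire] at h₀ h₁ h₂
      simp only [BlockGate.eval, BlockGate.wire, h₂, h₀, h₁]
      ring
    | _ => simp_all [BlockGate.block, BlockGate.eval, ArithGate.eval, BlockGate.wire]
  · have := runGates_eq_map (d := (0 : R)) ArithGate.eval_congr
      (blockCircuit F N W g hW hg).gates (List.ofFn x)
      (by simpa using (blockCircuit F N W g hW hg).gates_bounded) v hx hv
    rw [ArithCircuit.eval, this]
    have ho := (blockCircuit F N W g hW hg).out_lt
    simp [ho]
    rfl

/-- The arithmetization of a boolean gate whose wires are numbered from `B` on. -/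
def BoolGate.toBlock (B : ℕ) : BoolGate → BlockGate
  | .and i j => .mul (B + i) (B + j)
  | .or i j => .or (B + i) (B + j)
  | .not i => .not (B + i)

theorem BoolGate.eval_toBlock {R : Type} [CommRing R] (B : ℕ) (g : BoolGate) (x v : ℕ → R) :
    (g.toBlock B).eval x v = g.arith (fun i => v (B + i)) := by
  cases g <;> rfl

theorem BoolGate.bounded_toBlock {N B w : ℕ} {g : BoolGate} (h : g.Bounded w) :
    (g.toBlock B).Bounded N (B + w) := by
  cases g <;> simp_all [BoolGate.Bounded, BoolGate.toBlock, BlockGate.Bounded]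

/-! ### Positions of clauses -/

theorem litOfNat_injective : Function.Injective litOfNat := by
  intro k l h
  simp only [litOfNat, Prod.mk.injEq] at h
  have h2 : (k % 2 = 1 ↔ l % 2 = 1) := by
    have := h.2
    by_cases hk : k % 2 = 1 <;> by_cases hl : l % 2 = 1 <;> simp_all
  omega

theorem litOfNat_toNat (v : ℕ) (b : Bool) : litOfNat (2 * v + b.toNat) = (v, b) := by
  cases b
  · simp [litOfNat]
  · simp [litOfNat]
    omega

theorem exists_litOfNat (l : SatLiteral) : ∃ k, litOfNat k = l :=
  ⟨_, litOfNat_toNat l.1 l.2⟩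

theorem litOfNat_fst (k : ℕ) : (litOfNat k).1 = k / 2 := rfl

/-- The numbers of the literals of a clause in the order used for its position. -/
def ClauseTriple (i j k : ℕ) : Prop :=
  i ≤ j ∧ j ≤ k ∧ (i = j → j = k) ∧ (i / 2 = j / 2 → i = j) ∧ (j / 2 = k / 2 → j = k)

instance (i j k : ℕ) : Decidable (ClauseTriple i j k) := by unfold ClauseTriple; infer_instance

/-- `i` is the minimum and `k` the maximum of the set. The middle number is the remaining element if
there is one, and otherwise equals `k`, since `i = j` is allowed only if all three agree. -/
theorem ClauseTriple.unique {i j k i' j' k' : ℕ} (h : ClauseTriple i j k)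
    (h' : ClauseTriple i' j' k')
    (he : ∀ l, (l = i ∨ l = j ∨ l = k) ↔ (l = i' ∨ l = j' ∨ l = k')) :
    i = i' ∧ j = j' ∧ k = k' := by
  unfold ClauseTriple at h h'
  have e₁ : i = i' := by
    have h₁ := (he i).1 (Or.inl rfl)
    have h₂ := (he i').2 (Or.inl rfl)
    omega
  have e₃ : k = k' := by
    have h₁ := (he k).1 (Or.inr (Or.inr rfl))
    have h₂ := (he k').2 (Or.inr (Or.inr rfl))
    omega
  have h₁ := (he j).1 (Or.inr (Or.inl rfl))
  have h₂ := (he j').2 (Or.inr (Or.inl rfl))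
  omega

/-- A clause as allowed in a normalized instance with at most `n` variables. -/
def SatClause.IsNormal (n : ℕ) (c : SatClause) : Prop :=
  c.Nonempty ∧ c.card ≤ 3 ∧ (∀ l ∈ c, l.1 < n) ∧ ∀ l ∈ c, ∀ l' ∈ c, l.1 = l'.1 → l = l'

/-- List the one, two or three literals with repetition and sort them. Since the variables are
distinct, different literal numbers have different halves. -/
theorem SatClause.IsNormal.exists_triple {n : ℕ} {c : SatClause} (h : c.IsNormal n) :
    ∃ i j k, ClauseTriple i j k ∧ k < 2 * n ∧ ∀ l, litOfNat l ∈ c ↔ (l = i ∨ l = j ∨ l = k) := by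
  obtain ⟨hne, hcard, hvar, hdist⟩ := h
  have hdist' : ∀ k l, litOfNat k ∈ c → litOfNat l ∈ c → k / 2 = l / 2 → k = l :=
    fun k l hk hl h => litOfNat_injective (hdist _ hk _ hl h)
  have hvar' : ∀ k, litOfNat k ∈ c → k < 2 * n := fun k hk => by
    have := hvar _ hk
    rw [litOfNat_fst] at this
    omega
  have hpos := Finset.card_pos.2 hne
  have key : ∃ x y z, ∀ l, litOfNat l ∈ c ↔ (l = x ∨ l = y ∨ l = z) := by
    have hinj : ∀ k l, litOfNat k = litOfNat l ↔ k = l := fun k l => litOfNat_injective.eq_iff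
    interval_cases hc : c.card
    · obtain ⟨a, rfl⟩ := Finset.card_eq_one.1 hc
      obtain ⟨x, rfl⟩ := exists_litOfNat a
      exact ⟨x, x, x, fun l => by simp [hinj]⟩
    · obtain ⟨a, a', _, rfl⟩ := Finset.card_eq_two.1 hc
      obtain ⟨x, rfl⟩ := exists_litOfNat a
      obtain ⟨y, rfl⟩ := exists_litOfNat a'
      exact ⟨x, y, y, fun l => by simp [hinj]⟩
    · obtain ⟨a, a', a'', _, _, _, rfl⟩ := Finset.card_eq_three.1 hc
      obtain ⟨x, rfl⟩ := exists_litOfNat a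
      obtain ⟨y, rfl⟩ := exists_litOfNat a'
      obtain ⟨z, rfl⟩ := exists_litOfNat a''
      exact ⟨x, y, z, fun l => by simp [hinj]⟩
  obtain ⟨x, y, z, hxyz⟩ := key
  have hx := (hxyz x).2 (by simp)
  have hy := (hxyz y).2 (by simp)
  have hz := (hxyz z).2 (by simp)
  have dxy := hdist' x y hx hy
  have dxz := hdist' x z hx hz
  have dyz := hdist' y z hy hz
  have bx := hvar' x hx
  have bz := hvar' z hz
  have by' := hvar' y hy
  clear hdist' hvar' hx hy hz hdist hvar
  have hmax : ∃ i j k, ClauseTriple i j k ∧ k < 2 * n ∧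
      ∀ l, (l = x ∨ l = y ∨ l = z) ↔ (l = i ∨ l = j ∨ l = k) := by
    unfold ClauseTriple
    by_cases e₁ : x = y
    · rcases le_total y z with h | h
      · exact ⟨y, z, z, by omega, bz, fun l => by omega⟩
      · exact ⟨z, y, y, by omega, by', fun l => by omega⟩
    by_cases e₂ : x = z
    · rcases le_total y z with h | h
      · exact ⟨y, z, z, by omega, bz, fun l => by omega⟩
      · exact ⟨z, y, y, by omega, by', fun l => by omega⟩
    by_cases e₃ : y = z
    · rcases le_total x y with h | h
      · exact ⟨x, y, y, by omega, by', fun l => by omega⟩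
      · exact ⟨y, x, x, by omega, bx, fun l => by omega⟩
    rcases le_total x y with h₁ | h₁ <;> rcases le_total y z with h₂ | h₂ <;>
      rcases le_total x z with h₃ | h₃
    · exact ⟨x, y, z, by omega, bz, fun l => by omega⟩
    · omega
    · exact ⟨x, z, y, by omega, by', fun l => by omega⟩
    · exact ⟨z, x, y, by omega, by', fun l => by omega⟩
    · exact ⟨y, x, z, by omega, bz, fun l => by omega⟩
    · exact ⟨y, z, x, by omega, bx, fun l => by omega⟩
    · omega
    · exact ⟨z, y, x, by omega, bx, fun l => by omega⟩
  obtain ⟨i, j, k, ht, hk, h⟩ := hmax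
  exact ⟨i, j, k, ht, hk, fun l => (hxyz l).trans (h l)⟩

/-- The position with the base-`b` digits `i`, `j`, `k`. -/
def clausePos (b i j k : ℕ) : ℕ := (i * b + j) * b + k

theorem clausePos_mod {b i j k : ℕ} (hk : k < b) : clausePos b i j k % b = k := by
  rw [clausePos, Nat.mul_add_mod', Nat.mod_eq_of_lt hk]

theorem clausePos_div_mod {b i j k : ℕ} (hj : j < b) (hk : k < b) :
    clausePos b i j k / b % b = j := by
  have hb : 0 < b := by omega
  rw [clausePos, Nat.mul_comm, Nat.mul_add_div hb, Nat.div_eq_of_lt hk, Nat.add_zero,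
    Nat.mul_add_mod', Nat.mod_eq_of_lt hj]

theorem clausePos_div {b i j k : ℕ} (hj : j < b) (hk : k < b) : clausePos b i j k / b ^ 2 = i := by
  have hb : 0 < b := by omega
  rw [clausePos, Nat.pow_two, ← Nat.div_div_eq_div_mul, Nat.mul_comm, Nat.mul_add_div hb,
    Nat.div_eq_of_lt hk, Nat.add_zero, Nat.mul_comm, Nat.mul_add_div hb, Nat.div_eq_of_lt hj,
    Nat.add_zero]

theorem clausePos_eq (b p : ℕ) : clausePos b (p / b ^ 2) (p / b % b) (p % b) = p := by
  have h₁ := Nat.div_add_mod p b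
  have h₂ := Nat.div_add_mod (p / b) b
  rw [Nat.div_div_eq_div_mul, ← Nat.pow_two] at h₂
  rw [clausePos, Nat.mul_comm (p / b ^ 2) b, h₂, Nat.mul_comm, h₁]

/-- Three digits in base `2 n` give a number below `8 n ^ 3`, which is at most `8 n ^ 4`. -/
theorem clausePos_lt {n i j k : ℕ} (hi : i < 2 * n) (hj : j < 2 * n) (hk : k < 2 * n) :
    clausePos (2 * n) i j k < 8 * n ^ 4 := by
  have hn : 1 ≤ n := by omega
  have h₁ : i * (2 * n) + j + 1 ≤ 2 * n * (2 * n) := by nlinarith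
  have h₂ : clausePos (2 * n) i j k + 1 ≤ 2 * n * (2 * n) * (2 * n) := by
    unfold clausePos
    nlinarith
  have h₃ : n ^ 3 * 1 ≤ n ^ 3 * n := Nat.mul_le_mul_left _ hn
  have h₄ : 8 * n ^ 4 = 8 * (n ^ 3 * n) := by ring
  have h₅ : 2 * n * (2 * n) * (2 * n) = 8 * (n ^ 3 * 1) := by ring
  omega

/-- The digits of `p` in base `b` are the numbers of the literals of a clause. -/
def IsClausePos (b p : ℕ) : Prop := ClauseTriple (p / b ^ 2) (p / b % b) (p % b)

instance (b p : ℕ) : Decidable (IsClausePos b p) := by unfold IsClausePos; infer_instance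

theorem isClausePos_clausePos {b i j k : ℕ} (hj : j < b) (hk : k < b) :
    IsClausePos b (clausePos b i j k) ↔ ClauseTriple i j k := by
  rw [IsClausePos, clausePos_div hj hk, clausePos_div_mod hj hk, clausePos_mod hk]

/-- The digits are `0, 0, 1`, and only the largest digit may be repeated. -/
theorem not_isClausePos_one {n : ℕ} (hn : 0 < n) : ¬ IsClausePos (2 * n) 1 := by
  have h : clausePos (2 * n) 0 0 1 = 1 := by simp [clausePos]
  rw [← h, isClausePos_clausePos (by omega) (by omega)]
  unfold ClauseTriple
  omega

/-- For `n ≥ 2` the digits are `0, 0, 2`, again with a repetition of the smallest. For `n = 1` the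
base is two and the digits `0, 1, 0` are not increasing. -/
theorem not_isClausePos_two {n : ℕ} (hn : 0 < n) : ¬ IsClausePos (2 * n) 2 := by
  rcases Nat.lt_or_ge 1 n with h1 | h1
  · have h : clausePos (2 * n) 0 0 2 = 2 := by simp [clausePos]
    have h' := isClausePos_clausePos (b := 2 * n) (i := 0) (j := 0) (k := 2) (by omega) (by omega)
    rw [h] at h'
    rw [h']
    unfold ClauseTriple
    omega
  · obtain rfl : n = 1 := by omega
    decide

theorem ClauseTriple.clausePos_ne {n i j k : ℕ} (hn : 0 < n) (h : ClauseTriple i j k)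
    (hk : k < 2 * n) : clausePos (2 * n) i j k ≠ 1 ∧ clausePos (2 * n) i j k ≠ 2 := by
  have h' := (isClausePos_clausePos (b := 2 * n) (by have := h.2.1; omega) hk).2 h
  constructor
  · intro e
    rw [e] at h'
    exact not_isClausePos_one hn h'
  · intro e
    rw [e] at h'
    exact not_isClausePos_two hn h'

/-- The clause at the position `p`. -/
def clauseAt (b p : ℕ) : SatClause :=
  {litOfNat (p / b ^ 2), litOfNat (p / b % b), litOfNat (p % b)}

theorem litOfNat_mem_clauseAt (b p l : ℕ) :
    litOfNat l ∈ clauseAt b p ↔ (l = p / b ^ 2 ∨ l = p / b % b ∨ l = p % b) := by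
  simp [clauseAt, litOfNat_injective.eq_iff]

theorem clause_ext {c d : SatClause} (h : ∀ l, litOfNat l ∈ c ↔ litOfNat l ∈ d) : c = d := by
  ext l
  obtain ⟨k, rfl⟩ := exists_litOfNat l
  exact h k

theorem clauseAt_clausePos {b i j k : ℕ} (hj : j < b) (hk : k < b) {c : SatClause}
    (h : ∀ l, litOfNat l ∈ c ↔ (l = i ∨ l = j ∨ l = k)) : clauseAt b (clausePos b i j k) = c :=
  clause_ext fun l => by
    rw [litOfNat_mem_clauseAt, clausePos_div hj hk, clausePos_div_mod hj hk, clausePos_mod hk, h]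

theorem IsClausePos.isNormal {n p : ℕ} (hn : 0 < n) (h : IsClausePos (2 * n) p) :
    (clauseAt (2 * n) p).IsNormal n := by
  have hk : p % (2 * n) < 2 * n := Nat.mod_lt _ (by omega)
  have hmem := litOfNat_mem_clauseAt (2 * n) p
  unfold IsClausePos ClauseTriple at h
  refine ⟨⟨_, (hmem _).2 (Or.inl rfl)⟩, Finset.card_le_three, fun l hl => ?_, fun l hl l' hl' e => ?_⟩
  · obtain ⟨l, rfl⟩ := exists_litOfNat l
    rw [hmem] at hl
    rw [litOfNat_fst]
    omega
  · obtain ⟨l, rfl⟩ := exists_litOfNat l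
    obtain ⟨l', rfl⟩ := exists_litOfNat l'
    rw [hmem] at hl hl'
    rw [litOfNat_fst, litOfNat_fst] at e
    congr 1
    omega

theorem IsClausePos.clauseAt_inj {b p p' : ℕ} (h : IsClausePos b p) (h' : IsClausePos b p')
    (e : clauseAt b p = clauseAt b p') : p = p' := by
  obtain ⟨e₁, e₂, e₃⟩ := h.unique h' fun l => by
    rw [← litOfNat_mem_clauseAt, ← litOfNat_mem_clauseAt, e]
  rw [← clausePos_eq b p, ← clausePos_eq b p', e₁, e₂, e₃]

/-- The surjectivity half; with `IsClausePos.isNormal` and `IsClausePos.clauseAt_inj` it makes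
`clauseAt` a bijection from clause positions to normal clauses. -/
theorem SatClause.IsNormal.exists_pos {n : ℕ} {c : SatClause} (h : c.IsNormal n) :
    ∃ p < 8 * n ^ 4, IsClausePos (2 * n) p ∧ clauseAt (2 * n) p = c := by
  obtain ⟨i, j, k, ht, hk, hl⟩ := h.exists_triple
  have hj : j < 2 * n := by have := ht.2.1; omega
  have hi : i < 2 * n := by have := ht.1; omega
  exact ⟨clausePos (2 * n) i j k, clausePos_lt hi hj hk, (isClausePos_clausePos hj hk).2 ht,
    clauseAt_clausePos hj hk hl⟩

theorem isNormalized_cnf {n : ℕ} {φ : Finset SatClause} :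
    (SatInstance.cnf φ).IsNormalized n ↔ φ.Nonempty ∧ ∀ c ∈ φ, SatClause.IsNormal n c :=
  Iff.rfl

/-- The encoding itself does not test that the variables of a clause are distinct. Membership in
`φ`, whose clauses are normal, supplies this. -/
theorem encode_cnf {n : ℕ} {φ : Finset SatClause} (h : ∀ c ∈ φ, SatClause.IsNormal n c)
    (p : Fin (8 * n ^ 4)) : (SatInstance.cnf φ).encode n p = true ↔
      IsClausePos (2 * n) p ∧ clauseAt (2 * n) p ∈ φ := by
  simp only [SatInstance.encode, decide_eq_true_eq]
  constructor
  · rintro ⟨h₁, h₂, h₃, h₄⟩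
    have hd := (h _ h₄).2.2.2
    refine ⟨⟨h₁, h₂, h₃, fun e => ?_, fun e => ?_⟩, h₄⟩
    · exact litOfNat_injective (hd _ (by simp) _ (by simp) e)
    · exact litOfNat_injective (hd _ (by simp) _ (by simp) e)
  · rintro ⟨⟨h₁, h₂, h₃, -, -⟩, h₄⟩
    exact ⟨h₁, h₂, h₃, h₄⟩

theorem encode_const (n : ℕ) (b : Bool) (p : Fin (8 * n ^ 4)) :
    (SatInstance.const b).encode n p = true ↔ (p : ℕ) = if b then 2 else 1 := by
  simp [SatInstance.encode]

theorem four_lt_eight_mul_pow {n : ℕ} (hn : 0 < n) : 4 < 8 * n ^ 4 := by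
  have : 1 ≤ n ^ 4 := Nat.one_le_pow _ _ hn
  omega

/-- The encodings of the normalized instances. -/
theorem exists_encode_iff {n : ℕ} (hn : 0 < n) (s : Fin (8 * n ^ 4) → Bool) {v : ℕ → Bool}
    (hv : ∀ p : Fin (8 * n ^ 4), v p = s p) :
    (∃ f : SatInstance, f.IsNormalized n ∧ f.encode n = s) ↔
      (∀ p < 8 * n ^ 4, v p = true → IsClausePos (2 * n) p ∨ p = 1 ∨ p = 2) ∧
      ((v 1 = true ∧ v 2 = false ∧ ∀ p < 8 * n ^ 4, IsClausePos (2 * n) p → v p = false) ∨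
        (v 1 = false ∧ v 2 = true ∧ ∀ p < 8 * n ^ 4, IsClausePos (2 * n) p → v p = false) ∨
        (v 1 = false ∧ v 2 = false ∧ ∃ p < 8 * n ^ 4, IsClausePos (2 * n) p ∧ v p = true)) := by
  have h4 := four_lt_eight_mul_pow hn
  have n1 := not_isClausePos_one hn
  have n2 := not_isClausePos_two hn
  constructor
  · rintro ⟨f, hf, rfl⟩
    cases f with
    | const b =>
      have key : ∀ p < 8 * n ^ 4, (v p = true ↔ p = if b then 2 else 1) := fun p hp => by
        rw [hv ⟨p, hp⟩, encode_const]
      have key' : ∀ p < 8 * n ^ 4, IsClausePos (2 * n) p → v p = false := fun p hp hc => by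
        rw [← Bool.not_eq_true, key p hp]
        rintro rfl
        split_ifs at hc <;> contradiction
      have k1 := key 1 (by omega)
      have k2 := key 2 (by omega)
      refine ⟨fun p hp h => ?_, ?_⟩
      · rw [key p hp] at h
        grind
      · cases b <;> simp_all
    | cnf φ =>
      obtain ⟨⟨c, hc⟩, hφ⟩ := hf
      have key : ∀ p < 8 * n ^ 4, (v p = true ↔ IsClausePos (2 * n) p ∧ clauseAt (2 * n) p ∈ φ) :=
        fun p hp => by rw [hv ⟨p, hp⟩, encode_cnf hφ]
      have k1 := key 1 (by omega)
      have k2 := key 2 (by omega)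
      obtain ⟨p, hp, hpc, rfl⟩ := SatClause.IsNormal.exists_pos (hφ c hc)
      refine ⟨fun p hp h => Or.inl ((key p hp).1 h).1, Or.inr (Or.inr ⟨?_, ?_, p, hp, hpc,
        (key p hp).2 ⟨hpc, hc⟩⟩)⟩
      · simpa [n1] using k1
      · simpa [n2] using k2
  · rintro ⟨h, ⟨h₁, h₂, h₃⟩ | ⟨h₁, h₂, h₃⟩ | ⟨h₁, h₂, q, hq, hqc, hqv⟩⟩
    · refine ⟨.const false, trivial, funext fun p => ?_⟩
      rw [Bool.eq_iff_iff, encode_const, ← hv]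
      have := h p p.2
      have := h₃ p p.2
      constructor
      · intro e
        rw [e]
        exact h₁
      · intro e
        grind
    · refine ⟨.const true, trivial, funext fun p => ?_⟩
      rw [Bool.eq_iff_iff, encode_const, ← hv]
      have := h p p.2
      have := h₃ p p.2
      constructor
      · intro e
        rw [e]
        exact h₂
      · intro e
        grind
    -- Decoding: the instance consists of the clauses at all clause positions that carry a bit, and
    -- `q` shows that it is nonempty.
    · have hφ : ∀ c ∈ ((Finset.range (8 * n ^ 4)).filter
          (fun p => IsClausePos (2 * n) p ∧ v p = true)).image (clauseAt (2 * n)),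
          SatClause.IsNormal n c := by
        intro c hc
        obtain ⟨p, hp, rfl⟩ := Finset.mem_image.1 hc
        exact (Finset.mem_filter.1 hp).2.1.isNormal hn
      refine ⟨.cnf (((Finset.range (8 * n ^ 4)).filter
        (fun p => IsClausePos (2 * n) p ∧ v p = true)).image (clauseAt (2 * n))),
        isNormalized_cnf.2 ⟨⟨clauseAt (2 * n) q, Finset.mem_image_of_mem _ (by simp [*])⟩, hφ⟩,
        funext fun p => ?_⟩
      rw [Bool.eq_iff_iff, encode_cnf hφ, ← hv, Finset.mem_image]
      constructor
      · rintro ⟨hp, p', hp', e⟩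
        rw [Finset.mem_filter] at hp'
        rw [← hp'.2.1.clauseAt_inj hp e]
        exact hp'.2.2
      · intro hp
        have := h p p.2 hp
        have hc : IsClausePos (2 * n) p := by grind
        exact ⟨hc, p, by simp [hc, hp], rfl⟩

/-! ### Substituting a constant for the first variable -/

/-- What is left of a clause if its literals of the first variable become false. -/
def SatClause.shift (c : SatClause) : SatClause :=
  (c.filter (fun l => l.1 ≠ 0)).image (fun l => (l.1 - 1, l.2))

theorem SatClause.mem_shift {c : SatClause} {l : SatLiteral} :
    l ∈ c.shift ↔ (l.1 + 1, l.2) ∈ c := by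
  simp only [shift, Finset.mem_image, Finset.mem_filter]
  constructor
  · rintro ⟨l', ⟨h, h0⟩, rfl⟩
    rwa [Nat.sub_add_cancel (Nat.one_le_iff_ne_zero.2 h0)]
  · intro h
    exact ⟨_, ⟨h, by simp⟩, by simp⟩

/-- Each variable owns two consecutive literal numbers, so renumbering the variables by one moves
literal numbers by two. -/
theorem SatClause.litOfNat_mem_shift {c : SatClause} {l : ℕ} :
    litOfNat l ∈ c.shift ↔ litOfNat (l + 2) ∈ c := by
  rw [mem_shift]
  simp [litOfNat]

/-- The clauses that are left after the substitution of `b` for the first variable. -/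
def residualClauses (b : Bool) (φ : Finset SatClause) : Finset SatClause :=
  (φ.filter (fun c => (0, b) ∉ c)).image SatClause.shift

theorem mem_residualClauses {b : Bool} {φ : Finset SatClause} {d : SatClause} :
    d ∈ residualClauses b φ ↔ ∃ c ∈ φ, (0, b) ∉ c ∧ c.shift = d := by
  simp [residualClauses, and_assoc]

theorem restrict_cnf (b : Bool) (φ : Finset SatClause) :
    (SatInstance.cnf φ).restrict b = if residualClauses b φ = ∅ then .const true
      else if ∅ ∈ residualClauses b φ then .const false else .cnf (residualClauses b φ) := rfl

theorem SatClause.IsNormal.shift {n : ℕ} {c : SatClause} (h : c.IsNormal (n + 1))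
    (hne : c.shift ≠ ∅) : c.shift.IsNormal n := by
  obtain ⟨-, hcard, hvar, hdist⟩ := h
  refine ⟨Finset.nonempty_iff_ne_empty.2 hne, (Finset.card_image_le.trans
    (Finset.card_filter_le _ _)).trans hcard, fun l hl => ?_, fun l hl l' hl' e => ?_⟩
  · have := hvar _ (SatClause.mem_shift.1 hl)
    simpa using this
  · have := hdist _ (SatClause.mem_shift.1 hl) _ (SatClause.mem_shift.1 hl') (by simp [e])
    simp only [Prod.mk.injEq] at this
    exact Prod.ext e this.2

theorem isNormal_residualClauses {n : ℕ} {b : Bool} {φ : Finset SatClause}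
    (h : ∀ c ∈ φ, SatClause.IsNormal (n + 1) c) (h0 : ∅ ∉ residualClauses b φ) :
    ∀ c ∈ residualClauses b φ, SatClause.IsNormal n c := by
  intro d hd
  have hne : d ≠ ∅ := fun e => h0 (e ▸ hd)
  obtain ⟨c, hc, -, rfl⟩ := mem_residualClauses.1 hd
  exact (h c hc).shift hne

theorem SatInstance.IsNormalized.restrict {n : ℕ} {f : SatInstance} (h : f.IsNormalized (n + 1))
    (b : Bool) : (f.restrict b).IsNormalized n := by
  cases f with
  | const b' => trivial
  | cnf φ =>
    rw [restrict_cnf]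
    split_ifs with h₁ h₂
    · trivial
    · trivial
    · exact ⟨Finset.nonempty_iff_ne_empty.2 h₁, isNormal_residualClauses h.2 h₂⟩

theorem SatInstance.IsNormalized.mono {m n : ℕ} (hmn : m ≤ n) {f : SatInstance}
    (h : f.IsNormalized m) : f.IsNormalized n := by
  cases f with
  | const b => trivial
  | cnf φ => exact ⟨h.1, fun c hc => ⟨(h.2 c hc).1, (h.2 c hc).2.1,
      fun l hl => ((h.2 c hc).2.2.1 l hl).trans_le hmn, (h.2 c hc).2.2.2⟩⟩

/-- Assignments of the restricted instance are the tails of assignments starting with `b`. The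
clauses dropped by the restriction are satisfied by the value `b`, and the literals dropped are
false under it. -/
theorem satisfiable_restrict (b : Bool) (φ : Finset SatClause) :
    ((SatInstance.cnf φ).restrict b).Satisfiable ↔
      ∃ a : ℕ → Bool, a 0 = b ∧ ∀ c ∈ φ, ∃ l ∈ c, a l.1 = l.2 := by
  -- The constants need no separate treatment: an empty set of clauses is always satisfied, and an
  -- empty clause never is.
  have h : ((SatInstance.cnf φ).restrict b).Satisfiable ↔
      ∃ a : ℕ → Bool, ∀ d ∈ residualClauses b φ, ∃ l ∈ d, a l.1 = l.2 := by
    rw [restrict_cnf]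
    split_ifs with h₁ h₂
    · simp [SatInstance.Satisfiable, h₁]
    · simp only [SatInstance.Satisfiable, Bool.false_eq_true, false_iff, not_exists]
      intro a ha
      obtain ⟨l, hl, -⟩ := ha _ h₂
      simp at hl
    · rfl
  rw [h]
  constructor
  · rintro ⟨a, ha⟩
    refine ⟨fun i => Nat.casesOn i b a, rfl, fun c hc => ?_⟩
    by_cases hb : (0, b) ∈ c
    · exact ⟨_, hb, rfl⟩
    · obtain ⟨l, hl, e⟩ := ha _ (mem_residualClauses.2 ⟨c, hc, hb, rfl⟩)
      exact ⟨_, SatClause.mem_shift.1 hl, e⟩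
  · rintro ⟨a, ha0, ha⟩
    refine ⟨fun i => a (i + 1), fun d hd => ?_⟩
    obtain ⟨c, hc, hb, rfl⟩ := mem_residualClauses.1 hd
    obtain ⟨⟨i, b'⟩, hl, e⟩ := ha c hc
    cases i with
    | zero =>
      simp only at e
      rw [← e, ha0] at hl
      contradiction
    | succ i => exact ⟨(i, b'), SatClause.mem_shift.2 hl, e⟩

/-- Self-reducibility of satisfiability. -/
theorem satisfiable_iff_restrict (f : SatInstance) :
    f.Satisfiable ↔ (f.restrict false).Satisfiable ∨ (f.restrict true).Satisfiable := by
  cases f with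
  | const b => simp [SatInstance.restrict]
  | cnf φ =>
    rw [satisfiable_restrict, satisfiable_restrict]
    constructor
    · rintro ⟨a, ha⟩
      cases h : a 0
      · exact Or.inl ⟨a, h, ha⟩
      · exact Or.inr ⟨a, h, ha⟩
    · rintro (⟨a, -, ha⟩ | ⟨a, -, ha⟩) <;> exact ⟨a, ha⟩

/-- A predicate that satisfies the recursion of satisfiability is satisfiability. -/
theorem satisfiable_of_recursion {n : ℕ} {P : SatInstance → Prop} (ht : P (.const true))
    (hf : ¬ P (.const false))
    (h : ∀ f : SatInstance, f.IsNormalized n → (P f ↔ P (f.restrict false) ∨ P (f.restrict true))) :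
    ∀ f : SatInstance, f.IsNormalized n → (P f ↔ f.Satisfiable) := by
  have hc : ∀ b, P (.const b) ↔ (SatInstance.const b).Satisfiable := by
    intro b
    cases b <;> simp [SatInstance.Satisfiable, ht, hf]
  -- Induction on the number `k` of variables that may occur. For `k = 0` only constants are
  -- normalized, since clauses are nonempty.
  suffices hs : ∀ k ≤ n, ∀ f : SatInstance, f.IsNormalized k → (P f ↔ f.Satisfiable) from
    hs n le_rfl
  intro k
  induction k with
  | zero =>
    intro _ f hf'
    cases f with
    | const b => exact hc b
    | cnf φ =>
      obtain ⟨⟨c, hcφ⟩, hφ⟩ := hf'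
      obtain ⟨⟨l, hl⟩, -, hv, -⟩ := hφ c hcφ
      exact absurd (hv l hl) (Nat.not_lt_zero _)
  | succ k ih =>
    intro hk f hf'
    rw [h f (hf'.mono hk), satisfiable_iff_restrict f, ih (by omega) _ (hf'.restrict false),
      ih (by omega) _ (hf'.restrict true)]

/-- The triples of the clauses that are not true and become a given nonempty clause. -/
theorem ClauseTriple.shift_iff {i j k i' j' k' t u : ℕ} (h : ClauseTriple i j k)
    (h' : ClauseTriple i' j' k') (htu : t + u = 1) (ht : ¬ (t = i ∨ t = j ∨ t = k)) :
    (∀ l, (l + 2 = i ∨ l + 2 = j ∨ l + 2 = k) ↔ (l = i' ∨ l = j' ∨ l = k')) ↔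
      ((i = i' + 2 ∧ j = j' + 2 ∧ k = k' + 2) ∨
        (j' = k' ∧ i = u ∧ j = i' + 2 ∧ k = k' + 2)) := by
  constructor
  · intro he
    unfold ClauseTriple at h
    -- Numbers below two belong to the first variable. If there are none, all digits drop by two.
    -- Otherwise `i = u`, and the other literals form a clause with at most two literals, whose
    -- largest digit is repeated.
    by_cases hi : 2 ≤ i
    · have h'' : ClauseTriple (i - 2) (j - 2) (k - 2) := by unfold ClauseTriple; omega
      have := h''.unique h' fun l => by rw [← he l]; omega
      omega
    · have hj : 2 ≤ j := by
        have := (he i').2 (Or.inl rfl)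
        omega
      have h'' : ClauseTriple (j - 2) (k - 2) (k - 2) := by unfold ClauseTriple; omega
      have := h''.unique h' fun l => by rw [← he l]; omega
      omega
  · unfold ClauseTriple at h h'
    rintro (⟨rfl, rfl, rfl⟩ | ⟨rfl, rfl, rfl, rfl⟩) l <;> omega

theorem ClauseTriple.add_two {i j k : ℕ} (h : ClauseTriple i j k) :
    ClauseTriple (i + 2) (j + 2) (k + 2) := by
  unfold ClauseTriple at *
  omega

theorem ClauseTriple.add_two_of_eq {i j k u : ℕ} (h : ClauseTriple i j k) (e : j = k) (hu : u ≤ 1) :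
    ClauseTriple u (i + 2) (k + 2) := by
  unfold ClauseTriple at *
  omega

/-- The residual clause has two possible origins: itself with the variables moved up, or that clause
together with the literal falsified by `b`. The second exists only if there is room for a further
literal, that is, if `j = k`. -/
theorem clauseAt_mem_residualClauses {n : ℕ} {b : Bool} {φ : Finset SatClause}
    (hφ : ∀ c ∈ φ, SatClause.IsNormal n c) {i j k : ℕ} (h : ClauseTriple i j k) (hk : k < 2 * n) :
    clauseAt (2 * n) (clausePos (2 * n) i j k) ∈ residualClauses b φ ↔
      k + 2 < 2 * n ∧ (clauseAt (2 * n) (clausePos (2 * n) (i + 2) (j + 2) (k + 2)) ∈ φ ∨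
        (j = k ∧ clauseAt (2 * n) (clausePos (2 * n) (1 - b.toNat) (i + 2) (k + 2)) ∈ φ)) := by
  have hb : (0, b) = litOfNat b.toNat := by rw [← litOfNat_toNat 0 b, Nat.mul_zero, Nat.zero_add]
  have hb1 : b.toNat ≤ 1 := Bool.toNat_le b
  have hj : j < 2 * n := by have := h.2.1; omega
  have hmem : ∀ l, litOfNat l ∈ clauseAt (2 * n) (clausePos (2 * n) i j k) ↔
      (l = i ∨ l = j ∨ l = k) := fun l => by
    rw [litOfNat_mem_clauseAt, clausePos_div hj hk, clausePos_div_mod hj hk, clausePos_mod hk]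
  rw [mem_residualClauses]
  constructor
  · rintro ⟨c, hc, hbc, e⟩
    obtain ⟨i₁, j₁, k₁, ht, hk₁, hl⟩ := (hφ c hc).exists_triple
    rw [hb, hl] at hbc
    have hj₁ : j₁ < 2 * n := by have := ht.2.1; omega
    have hc' := clauseAt_clausePos hj₁ hk₁ hl
    rcases (ht.shift_iff h (u := 1 - b.toNat) (by omega) hbc).1 fun l => by
      rw [← hl, ← hmem, ← e, SatClause.litOfNat_mem_shift] with ⟨rfl, rfl, rfl⟩ | ⟨e₁, rfl, rfl, rfl⟩
    · exact ⟨hk₁, Or.inl (hc' ▸ hc)⟩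
    · exact ⟨hk₁, Or.inr ⟨e₁, hc' ▸ hc⟩⟩
  · rintro ⟨hk₁, hc | ⟨rfl, hc⟩⟩
    · have hjk := h.2.1
      refine ⟨_, hc, ?_, clause_ext fun l => ?_⟩
      · rw [hb, litOfNat_mem_clauseAt, clausePos_div (by omega) hk₁,
          clausePos_div_mod (by omega) hk₁, clausePos_mod hk₁]
        omega
      · rw [hmem, SatClause.litOfNat_mem_shift, litOfNat_mem_clauseAt, clausePos_div (by omega) hk₁,
          clausePos_div_mod (by omega) hk₁, clausePos_mod hk₁]
        omega
    · have hi := h.1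
      refine ⟨_, hc, ?_, clause_ext fun l => ?_⟩
      · rw [hb, litOfNat_mem_clauseAt, clausePos_div (by omega) hk₁,
          clausePos_div_mod (by omega) hk₁, clausePos_mod hk₁]
        omega
      · rw [hmem, SatClause.litOfNat_mem_shift, litOfNat_mem_clauseAt, clausePos_div (by omega) hk₁,
          clausePos_div_mod (by omega) hk₁, clausePos_mod hk₁]
        omega

/-- The clause at the position `p` contains the literal number `t`. -/
def HasDigit (b t p : ℕ) : Prop := t = p / b ^ 2 ∨ t = p / b % b ∨ t = p % b

instance (b t p : ℕ) : Decidable (HasDigit b t p) := by unfold HasDigit; infer_instance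

/-- The bits of the encoding of `f(b, x₂, …)` in terms of the bits `v` of the encoding of `f`. -/
def restrictBit (n : ℕ) (b : Bool) (v : ℕ → Bool) (p : ℕ) : Prop :=
  let F := v 1 = true ∨
    v (clausePos (2 * n) (1 - b.toNat) (1 - b.toNat) (1 - b.toNat)) = true
  if p = 1 then F
  else if p = 2 then ∀ q < 8 * n ^ 4, (q = 1 ∨ (IsClausePos (2 * n) q ∧
    ¬ HasDigit (2 * n) b.toNat q)) → v q = false
  else ¬ F ∧ (IsClausePos (2 * n) p ∧ p % (2 * n) + 2 < 2 * n) ∧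
    (v (clausePos (2 * n) (p / (2 * n) ^ 2 + 2) (p / (2 * n) % (2 * n) + 2) (p % (2 * n) + 2)) = true ∨
      (p / (2 * n) % (2 * n) = p % (2 * n) ∧
        v (clausePos (2 * n) (1 - b.toNat) (p / (2 * n) ^ 2 + 2) (p % (2 * n) + 2)) = true))

/-- The result is `false` iff `f` was `false` or contains the unit clause falsified by `b`. It is
`true` iff `f` is not `false` and every clause contains the literal satisfied by `b`; this also
covers the constant `true`, whose mark is not at a clause position. Any other bit is set according
to the two possible origins of its clause. -/
theorem encode_restrict {n : ℕ} (hn : 0 < n) (b : Bool) {f : SatInstance} (hf : f.IsNormalized n)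
    {v : ℕ → Bool} (hv : ∀ p : Fin (8 * n ^ 4), v p = f.encode n p) (p : Fin (8 * n ^ 4)) :
    (f.restrict b).encode n p = true ↔ restrictBit n b v p := by
  have h4 := four_lt_eight_mul_pow hn
  have n1 := not_isClausePos_one hn
  have n2 := not_isClausePos_two hn
  have hb1 : b.toNat ≤ 1 := Bool.toNat_le b
  have hu : ClauseTriple (1 - b.toNat) (1 - b.toNat) (1 - b.toNat) := by unfold ClauseTriple; omega
  have hul : 1 - b.toNat < 2 * n := by omega
  have hk : (p : ℕ) % (2 * n) < 2 * n := Nat.mod_lt _ (by omega)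
  have hj : (p : ℕ) / (2 * n) % (2 * n) < 2 * n := Nat.mod_lt _ (by omega)
  cases f with
  | const b' =>
    have key : ∀ q < 8 * n ^ 4, (v q = true ↔ q = if b' then 2 else 1) := fun q hq => by
      rw [hv ⟨q, hq⟩, encode_const]
    have key' : ∀ i j k, ClauseTriple i j k → k < 2 * n →
        v (clausePos (2 * n) i j k) = false := fun i j k ht hk' => by
      have hne := ht.clausePos_ne hn hk'
      have := ht.1
      have := ht.2.1
      rw [← Bool.not_eq_true, key _ (clausePos_lt (by omega) (by omega) hk')]
      split_ifs
      · exact hne.2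
      · exact hne.1
    have ku := key' _ _ _ hu hul
    have k1 := key 1 (by omega)
    have kr : ¬ ((IsClausePos (2 * n) p ∧ (p : ℕ) % (2 * n) + 2 < 2 * n) ∧
      (v (clausePos (2 * n) (p / (2 * n) ^ 2 + 2) (p / (2 * n) % (2 * n) + 2) (p % (2 * n) + 2)) = true
      ∨ ((p : ℕ) / (2 * n) % (2 * n) = p % (2 * n) ∧
        v (clausePos (2 * n) (1 - b.toNat) (p / (2 * n) ^ 2 + 2) (p % (2 * n) + 2)) = true))) := by
      rintro ⟨⟨hp, hlt⟩, h | ⟨e, h⟩⟩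
      · rw [key' _ _ _ hp.add_two hlt] at h
        cases h
      · rw [key' _ _ _ (hp.add_two_of_eq e (by omega)) hlt] at h
        cases h
    have kt : (∀ q < 8 * n ^ 4, (q = 1 ∨ (IsClausePos (2 * n) q ∧
        ¬ HasDigit (2 * n) b.toNat q)) → v q = false) ↔ b' = true := by
      constructor
      · intro h
        have := h 1 (by omega) (Or.inl rfl)
        cases b' <;> simp_all
      · rintro rfl q hq h
        rw [← Bool.not_eq_true, key q hq]
        rintro rfl
        rcases h with h | h
        · simp at h
        · exact n2 h.1
    rw [SatInstance.restrict, encode_const, restrictBit]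
    simp only [kt, ku, k1]
    rw [and_congr_right_iff.2 (fun _ => iff_false_intro kr)]
    cases b'
    · simp
    · simp only [if_true]
      split_ifs <;> simp_all
  | cnf φ =>
    have hφ := (isNormalized_cnf.1 hf).2
    have key : ∀ q < 8 * n ^ 4, (v q = true ↔ IsClausePos (2 * n) q ∧ clauseAt (2 * n) q ∈ φ) :=
      fun q hq => by rw [hv ⟨q, hq⟩, encode_cnf hφ]
    have key' : ∀ i j k, ClauseTriple i j k → k < 2 * n →
        (v (clausePos (2 * n) i j k) = true ↔ clauseAt (2 * n) (clausePos (2 * n) i j k) ∈ φ) :=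
      fun i j k ht hk' => by
        have := ht.1
        have := ht.2.1
        rw [key _ (clausePos_lt (by omega) (by omega) hk'), isClausePos_clausePos (by omega) hk']
        simp [ht]
    have hb : (0, b) = litOfNat b.toNat := by
      rw [← litOfNat_toNat 0 b, Nat.mul_zero, Nat.zero_add]
    have k1 : v 1 = false := by
      rw [← Bool.not_eq_true, key 1 (by omega)]
      exact fun h => n1 h.1
    have kF : v (clausePos (2 * n) (1 - b.toNat) (1 - b.toNat) (1 - b.toNat)) = true ↔
        ∅ ∈ residualClauses b φ := by
      rw [key' _ _ _ hu hul, mem_residualClauses]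
      constructor
      · refine fun h => ⟨_, h, ?_, clause_ext fun l => ?_⟩
        · rw [hb, litOfNat_mem_clauseAt, clausePos_div hul hul, clausePos_div_mod hul hul,
            clausePos_mod hul]
          omega
        · rw [SatClause.litOfNat_mem_shift, litOfNat_mem_clauseAt, clausePos_div hul hul,
            clausePos_div_mod hul hul, clausePos_mod hul]
          simp
          omega
      · rintro ⟨c, hc, hbc, e⟩
        obtain ⟨i, j, k, ht, hk, hl⟩ := (hφ c hc).exists_triple
        rw [hb, hl] at hbc
        have h2 : ∀ l, ¬ litOfNat (l + 2) ∈ c := fun l h => by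
          rw [← SatClause.litOfNat_mem_shift, e] at h
          simp at h
        -- If `i ≥ 2`, then `i - 2 + 2 = i` lies in `c`, a contradiction. Hence all digits are below
        -- two, and only `1 - b.toNat` is left for them.
        have hi := h2 (i - 2)
        have hj := h2 (j - 2)
        have hk' := h2 (k - 2)
        rw [hl] at hi hj hk'
        have : i = 1 - b.toNat ∧ j = 1 - b.toNat ∧ k = 1 - b.toNat := by omega
        obtain ⟨rfl, rfl, rfl⟩ := this
        rw [clauseAt_clausePos hul hul hl]
        exact hc
    have kT : (∀ q < 8 * n ^ 4, (q = 1 ∨ (IsClausePos (2 * n) q ∧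
        ¬ HasDigit (2 * n) b.toNat q)) → v q = false) ↔ residualClauses b φ = ∅ := by
      rw [Finset.eq_empty_iff_forall_notMem]
      constructor
      · intro h d hd
        obtain ⟨c, hc, hbc, rfl⟩ := mem_residualClauses.1 hd
        obtain ⟨q, hq, hqc, rfl⟩ := (hφ c hc).exists_pos
        have := h q hq (Or.inr ⟨hqc, fun hd => hbc (by rw [hb, litOfNat_mem_clauseAt]; exact hd)⟩)
        rw [← Bool.not_eq_true, key q hq] at this
        exact this ⟨hqc, hc⟩
      · rintro h q hq (rfl | ⟨hqc, hd⟩)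
        · exact k1
        · rw [← Bool.not_eq_true, key q hq]
          rintro ⟨-, hc⟩
          exact h _ (mem_residualClauses.2 ⟨_, hc, by rw [hb, litOfNat_mem_clauseAt]; exact hd, rfl⟩)
    have kr : ((IsClausePos (2 * n) p ∧ (p : ℕ) % (2 * n) + 2 < 2 * n) ∧
      (v (clausePos (2 * n) (p / (2 * n) ^ 2 + 2) (p / (2 * n) % (2 * n) + 2) (p % (2 * n) + 2)) = true
      ∨ ((p : ℕ) / (2 * n) % (2 * n) = p % (2 * n) ∧
        v (clausePos (2 * n) (1 - b.toNat) (p / (2 * n) ^ 2 + 2) (p % (2 * n) + 2)) = true))) ↔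
        IsClausePos (2 * n) p ∧ clauseAt (2 * n) p ∈ residualClauses b φ := by
      rw [and_assoc, and_congr_right_iff]
      intro hp
      conv_rhs => rw [← clausePos_eq (2 * n) p]
      rw [clauseAt_mem_residualClauses hφ hp hk, and_congr_right_iff]
      intro hlt
      rw [key' _ _ _ hp.add_two hlt,
        or_congr_right (and_congr_right fun e => key' _ _ _ (hp.add_two_of_eq e (by omega)) hlt)]
    rw [restrict_cnf, restrictBit]
    simp only [k1, kF, kT, kr, Bool.false_eq_true, false_or]
    by_cases h₁ : residualClauses b φ = ∅
    · rw [if_pos h₁, encode_const]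
      simp only [h₁, Finset.notMem_empty, not_false_eq_true, and_false, if_true]
      split_ifs <;> simp_all
    · rw [if_neg h₁]
      by_cases h₂ : ∅ ∈ residualClauses b φ
      · rw [if_pos h₂, encode_const]
        simp only [h₂, h₁, not_true, false_and, Bool.false_eq_true, if_false]
        split_ifs <;> simp_all
      · have hψ : ∀ c ∈ residualClauses b φ, SatClause.IsNormal n c := by
          -- Residual clauses are normal in `n - 1` variables, and therefore in `n`.
          obtain ⟨k, rfl⟩ : ∃ k, n = k + 1 := ⟨n - 1, by omega⟩
          intro c hc
          have := isNormal_residualClauses hφ h₂ c hc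
          exact ⟨this.1, this.2.1, fun l hl => (this.2.2.1 l hl).trans (Nat.lt_succ_self _),
            this.2.2.2⟩
        rw [if_neg h₂, encode_cnf hψ]
        simp only [h₂, h₁, not_false_eq_true, true_and]
        split_ifs with e₁ e₂
        · simp [e₁, n1]
        · simp [e₂, n2]
        · rfl

/-! ### A circuit that contains the circuits for encodings and restrictions -/

/-- The gate for the wire `w ≥ 8 n ^ 4` of a circuit on encodings. With `m = 8 n ^ 4`, the wire
`m + 1` is constantly false, the wires `m + 2 + 2 t` tell whether substituting `t` for the first
variable gives the constant `false`, and the wires `m + 6 + c m + p` with `p < m` form eight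
families:
* `c = 0`: a bit is set up to `p` at a position of no encoding;
* `c = 1`: a bit is set up to `p` at the position of a clause;
* `c = 2 + t`: a bit is set up to `p` that prevents the substitution of `t` from giving `true`;
* `c = 4 + t`: the clause at `p` is obtained by substituting `t`;
* `c = 6 + t`: the bit `p` of the encoding after substituting `t`.

The wires from `m + 6 + 8 m` on compute whether the input is an encoding. -/
def encodingGate (n w : ℕ) : BoolGate :=
  let m := 8 * n ^ 4
  let b := 2 * n
  let c := (w - (m + 6)) / m
  let p := (w - (m + 6)) % m
  let t := c % 2
  let prev := if p = 0 then m + 1 else w - 1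
  if w = m then .not 0
  else if w = m + 1 then .and 0 m
  else if w = m + 2 then .or 1 (clausePos b 1 1 1)
  else if w = m + 3 then .not (m + 2)
  else if w = m + 4 then .or 1 (clausePos b 0 0 0)
  else if w = m + 5 then .not (m + 4)
  else if m + 6 + 8 * m ≤ w then
    let e := m + 6 + 8 * m
    if w = e then .or 1 2
    else if w = e + 1 then .and 1 2
    else if w = e + 2 then .and e (m + 6 + (1 * m + (m - 1)))
    else if w = e + 3 then .or e (m + 6 + (1 * m + (m - 1)))
    else if w = e + 4 then .not (e + 3)
    else if w = e + 5 then .or (e + 1) (e + 2)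
    else if w = e + 6 then .or (e + 5) (e + 4)
    else if w = e + 7 then .or (e + 6) (m + 6 + (0 * m + (m - 1)))
    else .not (e + 7)
  else if c = 0 then .or prev (if IsClausePos b p ∨ p = 1 ∨ p = 2 then m + 1 else p)
  else if c = 1 then .or prev (if IsClausePos b p then p else m + 1)
  else if c < 4 then
    .or prev (if p = 1 ∨ (IsClausePos b p ∧ ¬ HasDigit b t p) then p else m + 1)
  else if c < 6 then
    .or (if IsClausePos b p ∧ p % b + 2 < b then
        clausePos b (p / b ^ 2 + 2) (p / b % b + 2) (p % b + 2) else m + 1)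
      (if (IsClausePos b p ∧ p % b + 2 < b) ∧ p / b % b = p % b then
        clausePos b (1 - t) (p / b ^ 2 + 2) (p % b + 2) else m + 1)
  else if p = 1 then .or (m + 2 + 2 * t) (m + 2 + 2 * t)
  else if p = 2 then .not (m + 6 + ((2 + t) * m + (m - 1)))
  else .and (m + 6 + ((4 + t) * m + p)) (m + 3 + 2 * t)

/-- The number of gates of the circuit on encodings. -/
def encodingSize (n : ℕ) : ℕ := 8 * (8 * n ^ 4) + 15

/-- Division with remainder by `8 n ^ 4` recovers the family `c` and the position `p` from the wire
number. -/
theorem encodingGate_family {n c p : ℕ} (hc : c < 8) (hp : p < 8 * n ^ 4) :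
    encodingGate n (8 * n ^ 4 + 6 + (c * (8 * n ^ 4) + p)) =
      let m := 8 * n ^ 4
      let b := 2 * n
      let t := c % 2
      let prev := if p = 0 then m + 1 else m + 6 + (c * m + p) - 1
      if c = 0 then .or prev (if IsClausePos b p ∨ p = 1 ∨ p = 2 then m + 1 else p)
      else if c = 1 then .or prev (if IsClausePos b p then p else m + 1)
      else if c < 4 then
        .or prev (if p = 1 ∨ (IsClausePos b p ∧ ¬ HasDigit b t p) then p else m + 1)
      else if c < 6 then
        .or (if IsClausePos b p ∧ p % b + 2 < b then
            clausePos b (p / b ^ 2 + 2) (p / b % b + 2) (p % b + 2) else m + 1)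
          (if (IsClausePos b p ∧ p % b + 2 < b) ∧ p / b % b = p % b then
            clausePos b (1 - t) (p / b ^ 2 + 2) (p % b + 2) else m + 1)
      else if p = 1 then .or (m + 2 + 2 * t) (m + 2 + 2 * t)
      else if p = 2 then .not (m + 6 + ((2 + t) * m + (m - 1)))
      else .and (m + 6 + ((4 + t) * m + p)) (m + 3 + 2 * t) := by
  have hm : 0 < 8 * n ^ 4 := by omega
  have hcm : c * (8 * n ^ 4) + p < 8 * (8 * n ^ 4) := by
    have := Nat.mul_le_mul_right (8 * n ^ 4) (Nat.le_of_lt_succ hc)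
    omega
  unfold encodingGate
  generalize 8 * n ^ 4 = m at *
  have h₁ : (m + 6 + (c * m + p) - (m + 6)) / m = c := by
    rw [Nat.add_sub_cancel_left, Nat.mul_comm, Nat.mul_add_div hm, Nat.div_eq_of_lt hp, Nat.add_zero]
  have h₂ : (m + 6 + (c * m + p) - (m + 6)) % m = p := by
    rw [Nat.add_sub_cancel_left, Nat.mul_add_mod', Nat.mod_eq_of_lt hp]
  simp only [h₁, h₂]
  rw [if_neg (by omega), if_neg (by omega), if_neg (by omega), if_neg (by omega), if_neg (by omega),
    if_neg (by omega), if_neg (by omega)]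

theorem encodingGate_bounded {n w : ℕ} (hn : 0 < n) (h₁ : 8 * n ^ 4 ≤ w)
    (h₂ : w < 8 * n ^ 4 + encodingSize n) : (encodingGate n w).Bounded w := by
  have h4 := four_lt_eight_mul_pow hn
  unfold encodingSize at h₂
  by_cases hlow : w < 8 * n ^ 4 + 6
  · have p₀ := clausePos_lt (n := n) (i := 0) (j := 0) (k := 0) (by omega) (by omega) (by omega)
    have p₁ := clausePos_lt (n := n) (i := 1) (j := 1) (k := 1) (by omega) (by omega) (by omega)
    unfold encodingGate
    generalize 8 * n ^ 4 = m at *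
    obtain ⟨d, rfl⟩ := Nat.exists_eq_add_of_le h₁
    have hd : d < 6 := by omega
    interval_cases d <;> simp [BoolGate.Bounded] <;> omega
  by_cases hhigh : 8 * n ^ 4 + 6 + 8 * (8 * n ^ 4) ≤ w
  · unfold encodingGate
    generalize 8 * n ^ 4 = m at *
    obtain ⟨d, rfl⟩ := Nat.exists_eq_add_of_le hhigh
    have hd : d < 9 := by omega
    simp only []
    rw [if_neg (by omega), if_neg (by omega), if_neg (by omega), if_neg (by omega),
      if_neg (by omega), if_neg (by omega), if_pos (by omega)]
    interval_cases d <;> simp [BoolGate.Bounded] <;> omega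
  have hm : 0 < 8 * n ^ 4 := by omega
  obtain ⟨c, p, hc, hp, rfl⟩ : ∃ c p, c < 8 ∧ p < 8 * n ^ 4 ∧
      w = 8 * n ^ 4 + 6 + (c * (8 * n ^ 4) + p) := by
    refine ⟨(w - (8 * n ^ 4 + 6)) / (8 * n ^ 4), (w - (8 * n ^ 4 + 6)) % (8 * n ^ 4),
      ?_, Nat.mod_lt _ hm, ?_⟩
    · rw [Nat.div_lt_iff_lt_mul hm]
      omega
    · have := Nat.div_add_mod (w - (8 * n ^ 4 + 6)) (8 * n ^ 4)
      rw [Nat.mul_comm] at this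
      omega
  rw [encodingGate_family hc hp]
  have hsel : ∀ (q : Prop) [Decidable q] (x : ℕ), (q → x < 8 * n ^ 4) →
      (if q then x else 8 * n ^ 4 + 1) < 8 * n ^ 4 + 6 + (c * (8 * n ^ 4) + p) := by
    intro q _ x hx
    split_ifs with hq
    · have := hx hq
      omega
    · omega
  have hprev : (if p = 0 then 8 * n ^ 4 + 1 else 8 * n ^ 4 + 6 + (c * (8 * n ^ 4) + p) - 1) <
      8 * n ^ 4 + 6 + (c * (8 * n ^ 4) + p) := by
    split_ifs <;> omega
  by_cases c₀ : c = 0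
  · simp only [c₀, if_true]
    refine ⟨by simpa [c₀] using hprev, ?_⟩
    split_ifs <;> omega
  by_cases c₁ : c = 1
  · simp only [c₁, if_true, one_ne_zero, if_false]
    refine ⟨by simpa [c₁] using hprev, ?_⟩
    split_ifs <;> omega
  simp only [c₀, c₁, if_false]
  by_cases c₂ : c < 4
  · rw [if_pos c₂]
    exact ⟨hprev, hsel _ _ fun _ => hp⟩
  rw [if_neg c₂]
  by_cases c₃ : c < 6
  · rw [if_pos c₃]
    refine ⟨hsel _ _ fun h => ?_, hsel _ _ fun h => ?_⟩
    · have h' := h.1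
      unfold IsClausePos at h'
      exact clausePos_lt (by have := h'.1; have := h'.2.1; omega) (by have := h'.2.1; omega) h.2
    · have h' := h.1.1
      unfold IsClausePos at h'
      exact clausePos_lt (by omega) (by have := h'.1; have := h'.2.1; omega) h.1.2
  rw [if_neg c₃]
  have hc6 : c = 6 ∨ c = 7 := by omega
  rcases hc6 with rfl | rfl <;> split_ifs <;> simp only [BoolGate.Bounded] <;> omega

/-- The circuit on encodings with a given output wire. -/
def encodingCircuit {n : ℕ} (hn : 0 < n) (o : ℕ) (ho : o < 8 * n ^ 4 + encodingSize n) :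
    BoolCircuit (8 * n ^ 4) where
  gates := (List.range (encodingSize n)).map fun t => encodingGate n (8 * n ^ 4 + t)
  out := o
  gates_bounded t g hg := by
    simp only [List.getElem?_map, Option.map_eq_some_iff] at hg
    obtain ⟨i, hi, rfl⟩ := hg
    obtain ⟨ht, rfl⟩ := List.getElem?_eq_some_iff.1 hi
    simp only [List.length_range] at ht
    simp only [List.getElem_range]
    exact encodingGate_bounded hn (by omega) (by omega)
  out_lt := by simpa using ho

theorem encodingCircuit_getElem? {n : ℕ} (hn : 0 < n) (o : ℕ)
    (ho : o < 8 * n ^ 4 + encodingSize n) {t : ℕ} {g : BoolGate} :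
    (encodingCircuit hn o ho).gates[t]? = some g ↔
      t < encodingSize n ∧ encodingGate n (8 * n ^ 4 + t) = g := by
  simp only [encodingCircuit, List.getElem?_map, Option.map_eq_some_iff]
  constructor
  · rintro ⟨i, hi, rfl⟩
    obtain ⟨ht, rfl⟩ := List.getElem?_eq_some_iff.1 hi
    simp only [List.length_range] at ht
    exact ⟨ht, by simp⟩
  · rintro ⟨ht, rfl⟩
    exact ⟨t, by simp [ht], rfl⟩

/-! ### Values of the wires of the circuit on encodings -/

/-- The equations for the values of the wires of the circuit on encodings. -/
def EncodingValues (n : ℕ) (v : ℕ → Bool) : Prop :=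
  ∀ w, 8 * n ^ 4 ≤ w → w < 8 * n ^ 4 + encodingSize n → v w = (encodingGate n w).eval v

theorem family_lt {n c p : ℕ} (hc : c < 8) (hp : p < 8 * n ^ 4) :
    8 * n ^ 4 + 6 + (c * (8 * n ^ 4) + p) < 8 * n ^ 4 + 6 + 8 * (8 * n ^ 4) := by
  have := Nat.mul_le_mul_right (8 * n ^ 4) (Nat.le_of_lt_succ hc)
  omega

namespace EncodingValues

variable {n : ℕ} {v : ℕ → Bool}

theorem family (h : EncodingValues n v) {c p : ℕ} (hc : c < 8) (hp : p < 8 * n ^ 4) :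
    v (8 * n ^ 4 + 6 + (c * (8 * n ^ 4) + p)) =
      (encodingGate n (8 * n ^ 4 + 6 + (c * (8 * n ^ 4) + p))).eval v := by
  have := family_lt hc hp
  exact h _ (by omega) (by unfold encodingSize; omega)

/-- Boolean circuits have no constant gates, so `false` is produced as the conjunction of an input
and its negation. -/
theorem false_wire (h : EncodingValues n v) : v (8 * n ^ 4 + 1) = false := by
  have h₀ := h (8 * n ^ 4) le_rfl (by unfold encodingSize; omega)
  have h₁ := h (8 * n ^ 4 + 1) (by omega) (by unfold encodingSize; omega)
  simp only [encodingGate, if_true, BoolGate.eval] at h₀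
  rw [h₁]
  simp [encodingGate, BoolGate.eval, h₀]

theorem constFalse (h : EncodingValues n v) (b : Bool) :
    (v (8 * n ^ 4 + 2 + 2 * b.toNat) = true ↔ v 1 = true ∨
      v (clausePos (2 * n) (1 - b.toNat) (1 - b.toNat) (1 - b.toNat)) = true) ∧
    v (8 * n ^ 4 + 3 + 2 * b.toNat) = !v (8 * n ^ 4 + 2 + 2 * b.toNat) := by
  cases b
  · have h₂ := h (8 * n ^ 4 + 2) (by omega) (by unfold encodingSize; omega)
    have h₃ := h (8 * n ^ 4 + 3) (by omega) (by unfold encodingSize; omega)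
    constructor
    · simp [h₂, encodingGate, BoolGate.eval]
    · simp [h₃, encodingGate, BoolGate.eval]
  · have h₂ := h (8 * n ^ 4 + 4) (by omega) (by unfold encodingSize; omega)
    have h₃ := h (8 * n ^ 4 + 5) (by omega) (by unfold encodingSize; omega)
    constructor
    · simp [h₂, encodingGate, BoolGate.eval]
    · simp [h₃, encodingGate, BoolGate.eval]

/-- The families that search for a bit that is set at a position with the property `q`. -/
theorem search (h : EncodingValues n v) {c : ℕ} (hc : c < 8) {q : ℕ → Prop} [DecidablePred q]
    (hg : ∀ p < 8 * n ^ 4, encodingGate n (8 * n ^ 4 + 6 + (c * (8 * n ^ 4) + p)) =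
      .or (if p = 0 then 8 * n ^ 4 + 1 else 8 * n ^ 4 + 6 + (c * (8 * n ^ 4) + p) - 1)
        (if q p then p else 8 * n ^ 4 + 1)) (hm : 0 < 8 * n ^ 4) :
    v (8 * n ^ 4 + 6 + (c * (8 * n ^ 4) + (8 * n ^ 4 - 1))) = true ↔
      ∃ p < 8 * n ^ 4, q p ∧ v p = true := by
  have hf := h.false_wire
  have hsel : ∀ p, v (if q p then p else 8 * n ^ 4 + 1) = true ↔ q p ∧ v p = true := by
    intro p
    split_ifs with hq <;> simp [hq, hf]
  have key : ∀ p < 8 * n ^ 4, v (8 * n ^ 4 + 6 + (c * (8 * n ^ 4) + p)) = true ↔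
      ∃ p' ≤ p, q p' ∧ v p' = true := by
    intro p
    induction p with
    | zero =>
      intro hp
      rw [h.family hc hp, hg 0 hp]
      simp [BoolGate.eval, hsel, hf]
    | succ p ih =>
      intro hp
      rw [h.family hc hp, hg _ hp]
      simp only [BoolGate.eval, Bool.or_eq_true, hsel, Nat.succ_ne_zero, if_false]
      rw [show 8 * n ^ 4 + 6 + (c * (8 * n ^ 4) + (p + 1)) - 1 =
        8 * n ^ 4 + 6 + (c * (8 * n ^ 4) + p) by omega, ih (by omega)]
      constructor
      · rintro (⟨p', hp', hq⟩ | hq)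
        · exact ⟨p', by omega, hq⟩
        · exact ⟨_, le_rfl, hq⟩
      · rintro ⟨p', hp', hq⟩
        rcases Nat.lt_succ_iff_lt_or_eq.1 (Nat.lt_succ_of_le hp') with h' | rfl
        · exact Or.inl ⟨p', by omega, hq⟩
        · exact Or.inr hq
  rw [key _ (by omega)]
  constructor
  · rintro ⟨p, hp, hq⟩
    exact ⟨p, by omega, hq⟩
  · rintro ⟨p, hp, hq⟩
    exact ⟨p, by omega, hq⟩

theorem search_invalid (h : EncodingValues n v) (hn : 0 < n) :
    v (8 * n ^ 4 + 6 + (0 * (8 * n ^ 4) + (8 * n ^ 4 - 1))) = true ↔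
      ∃ p < 8 * n ^ 4, ¬ (IsClausePos (2 * n) p ∨ p = 1 ∨ p = 2) ∧ v p = true := by
  have h4 := four_lt_eight_mul_pow hn
  refine h.search (by omega) (fun p hp => ?_) (by omega)
  rw [encodingGate_family (by omega) hp]
  simp only [if_true, ite_not]

theorem search_clause (h : EncodingValues n v) (hn : 0 < n) :
    v (8 * n ^ 4 + 6 + (1 * (8 * n ^ 4) + (8 * n ^ 4 - 1))) = true ↔
      ∃ p < 8 * n ^ 4, IsClausePos (2 * n) p ∧ v p = true := by
  have h4 := four_lt_eight_mul_pow hn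
  refine h.search (by omega) (fun p hp => ?_) (by omega)
  rw [encodingGate_family (by omega) hp]
  simp only [if_true, one_ne_zero, if_false]

theorem search_residual (h : EncodingValues n v) (hn : 0 < n) (b : Bool) :
    v (8 * n ^ 4 + 6 + ((2 + b.toNat) * (8 * n ^ 4) + (8 * n ^ 4 - 1))) = true ↔
      ∃ p < 8 * n ^ 4, (p = 1 ∨ (IsClausePos (2 * n) p ∧ ¬ HasDigit (2 * n) b.toNat p)) ∧
        v p = true := by
  have h4 := four_lt_eight_mul_pow hn
  have hb := Bool.toNat_le b
  refine h.search (by omega) (fun p hp => ?_) (by omega)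
  have ht : (2 + b.toNat) % 2 = b.toNat := by omega
  rw [encodingGate_family (by omega) hp]
  simp only [ht]
  rw [if_neg (by omega), if_neg (by omega), if_pos (by omega)]

theorem restrict (h : EncodingValues n v) (hn : 0 < n) (b : Bool) {p : ℕ} (hp : p < 8 * n ^ 4) :
    v (8 * n ^ 4 + 6 + ((6 + b.toNat) * (8 * n ^ 4) + p)) = true ↔ restrictBit n b v p := by
  have hb := Bool.toNat_le b
  have hf := h.false_wire
  have ht₄ : (4 + b.toNat) % 2 = b.toNat := by omega
  have ht₆ : (6 + b.toNat) % 2 = b.toNat := by omega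
  obtain ⟨hF, hF'⟩ := h.constFalse b
  rw [h.family (by omega) hp, encodingGate_family (by omega) hp]
  simp only [ht₆]
  rw [if_neg (by omega), if_neg (by omega), if_neg (by omega), if_neg (by omega), restrictBit]
  by_cases h₁ : p = 1
  · simp only [h₁, if_true, BoolGate.eval, Bool.or_self, hF]
  by_cases h₂ : p = 2
  · subst h₂
    simp only [OfNat.ofNat_ne_one, if_true, if_false, BoolGate.eval]
    rw [Bool.not_eq_true', ← Bool.not_eq_true, h.search_residual hn b]
    simp
  simp only [h₁, h₂, if_false, BoolGate.eval, Bool.and_eq_true]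
  rw [hF', Bool.not_eq_true', ← Bool.not_eq_true, hF, and_comm]
  refine and_congr_right fun _ => ?_
  rw [h.family (by omega) hp, encodingGate_family (by omega) hp]
  simp only [ht₄]
  rw [if_neg (by omega), if_neg (by omega), if_neg (by omega), if_pos (by omega)]
  simp only [BoolGate.eval, Bool.or_eq_true]
  by_cases hv : IsClausePos (2 * n) p ∧ p % (2 * n) + 2 < 2 * n
  · by_cases he : p / (2 * n) % (2 * n) = p % (2 * n)
    · simp [hv, he]
    · simp [hv, he, hf]
  · simp [hv, hf]

/-- No bit may be set at an invalid position, and exactly one of three flags must be up: bit `1`,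
bit `2`, or some clause bit. The last nine gates test this by excluding two flags at once and no
flag at all. -/
theorem isEncoding (h : EncodingValues n v) (hn : 0 < n) :
    v (8 * n ^ 4 + 6 + 8 * (8 * n ^ 4) + 8) = true ↔
      (∀ p < 8 * n ^ 4, v p = true → IsClausePos (2 * n) p ∨ p = 1 ∨ p = 2) ∧
      ((v 1 = true ∧ v 2 = false ∧ ∀ p < 8 * n ^ 4, IsClausePos (2 * n) p → v p = false) ∨
        (v 1 = false ∧ v 2 = true ∧ ∀ p < 8 * n ^ 4, IsClausePos (2 * n) p → v p = false) ∨
        (v 1 = false ∧ v 2 = false ∧ ∃ p < 8 * n ^ 4, IsClausePos (2 * n) p ∧ v p = true)) := by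
  have h₀ := h.search_invalid hn
  have h₁ := h.search_clause hn
  have e₀ : (∀ p < 8 * n ^ 4, v p = true → IsClausePos (2 * n) p ∨ p = 1 ∨ p = 2) ↔
      ¬ v (8 * n ^ 4 + 6 + (0 * (8 * n ^ 4) + (8 * n ^ 4 - 1))) = true := by
    rw [h₀]
    push Not
    exact forall₂_congr fun p _ => by tauto
  have e₁ : (∀ p < 8 * n ^ 4, IsClausePos (2 * n) p → v p = false) ↔
      ¬ v (8 * n ^ 4 + 6 + (1 * (8 * n ^ 4) + (8 * n ^ 4 - 1))) = true := by
    rw [h₁]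
    push Not
    simp
  rw [e₀, e₁, ← h₁]
  have hw : ∀ d, d < 9 → v (8 * n ^ 4 + 6 + 8 * (8 * n ^ 4) + d) =
      (encodingGate n (8 * n ^ 4 + 6 + 8 * (8 * n ^ 4) + d)).eval v := fun d hd =>
    h _ (by omega) (by unfold encodingSize; omega)
  have hg : ∀ d, encodingGate n (8 * n ^ 4 + 6 + 8 * (8 * n ^ 4) + d) =
      let m := 8 * n ^ 4
      let e := m + 6 + 8 * m
      if d = 0 then .or 1 2
      else if d = 1 then .and 1 2
      else if d = 2 then .and e (m + 6 + (1 * m + (m - 1)))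
      else if d = 3 then .or e (m + 6 + (1 * m + (m - 1)))
      else if d = 4 then .not (e + 3)
      else if d = 5 then .or (e + 1) (e + 2)
      else if d = 6 then .or (e + 5) (e + 4)
      else if d = 7 then .or (e + 6) (m + 6 + (0 * m + (m - 1)))
      else .not (e + 7) := by
    intro d
    unfold encodingGate
    generalize 8 * n ^ 4 = m
    simp only []
    rw [if_neg (by omega), if_neg (by omega), if_neg (by omega), if_neg (by omega),
      if_neg (by omega), if_neg (by omega), if_pos (by omega)]
    simp
  have w₀ := hw 0 (by omega)
  have w₁ := hw 1 (by omega)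
  have w₂ := hw 2 (by omega)
  have w₃ := hw 3 (by omega)
  have w₄ := hw 4 (by omega)
  have w₅ := hw 5 (by omega)
  have w₆ := hw 6 (by omega)
  have w₇ := hw 7 (by omega)
  have w₈ := hw 8 (by omega)
  rw [hg] at w₀ w₁ w₂ w₃ w₄ w₅ w₆ w₇ w₈
  clear hg hw h₀ h₁ e₀ e₁ h
  simp only [if_true, BoolGate.eval, OfNat.ofNat_ne_zero, OfNat.ofNat_ne_one, if_false,
    one_ne_zero, Nat.add_zero, Nat.reduceEqDiff] at w₀ w₁ w₂ w₃ w₄ w₅ w₆ w₇ w₈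
  generalize v (8 * n ^ 4 + 6 + (0 * (8 * n ^ 4) + (8 * n ^ 4 - 1))) = z at *
  generalize v (8 * n ^ 4 + 6 + (1 * (8 * n ^ 4) + (8 * n ^ 4 - 1))) = y at *
  rw [w₈, w₇, w₆, w₅, w₄, w₃, w₂, w₁, w₀]
  clear w₀ w₁ w₂ w₃ w₄ w₅ w₆ w₇ w₈
  generalize v 1 = a
  generalize v 2 = b
  -- Four truth values remain: the outcomes of the two searches and the bits `1` and `2`.
  revert z y a b
  decide

end EncodingValues

/-- The circuit that recognizes the encodings of normalized instances. -/
def recognizer {n : ℕ} (hn : 0 < n) : BoolCircuit (8 * n ^ 4) :=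
  encodingCircuit hn (8 * n ^ 4 + 6 + 8 * (8 * n ^ 4) + 8) (by unfold encodingSize; omega)

/-- The circuits for the restriction of instances. -/
def restrictor {n : ℕ} (hn : 0 < n) (b : Bool) (i : Fin (8 * n ^ 4)) : BoolCircuit (8 * n ^ 4) :=
  encodingCircuit hn (8 * n ^ 4 + 6 + ((6 + b.toNat) * (8 * n ^ 4) + i)) (by
    have := family_lt (n := n) (c := 6 + b.toNat) (by have := Bool.toNat_le b; omega) i.2
    unfold encodingSize
    omega)

/-- The gate list does not depend on the output wire, so one assignment serves the recognizer and
all bits of both restrictions. -/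
theorem exists_encodingValues {n : ℕ} (hn : 0 < n) (x : Fin (8 * n ^ 4) → Bool) :
    ∃ v : ℕ → Bool, (∀ i : Fin (8 * n ^ 4), v i = x i) ∧ EncodingValues n v ∧
      ∀ o ho, (encodingCircuit hn o ho).eval x = v o := by
  obtain ⟨v, hx, hv⟩ := (recognizer hn).exists_boolValues x
  refine ⟨v, hx, fun w h₁ h₂ => ?_, fun o ho => (encodingCircuit hn o ho).eval_eq hx hv⟩
  obtain ⟨t, rfl⟩ := Nat.exists_eq_add_of_le h₁
  exact hv t _ ((encodingCircuit_getElem? hn _ _).2 ⟨by omega, rfl⟩)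

theorem decidesEncodings_recognizer {n : ℕ} (hn : 0 < n) : DecidesEncodings n (recognizer hn) := by
  intro s
  obtain ⟨v, hx, hv, ho⟩ := exists_encodingValues hn s
  rw [exists_encode_iff hn s hx, recognizer, ho, hv.isEncoding hn]

theorem computesRestriction_restrictor {n : ℕ} (hn : 0 < n) (b : Bool) :
    ComputesRestriction n b (restrictor hn b) := by
  intro f hf
  obtain ⟨v, hx, hv, ho⟩ := exists_encodingValues hn (f.encode n)
  funext i
  rw [Bool.eq_iff_iff, encode_restrict hn b hf hx, ← hv.restrict hn b i.2, restrictor, ho]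

/-! ### The arithmetic circuit of the reduction -/

/-- The first block of the copy number `c` of `C` in the circuit of the reduction. -/
def copyBlock (n : ℕ) (C : BoolCircuit (8 * n ^ 4)) (c : ℕ) : ℕ :=
  8 * n ^ 4 + encodingSize n + c * (8 * n ^ 4 + C.gates.length)

/-- The first block of the test whether input `i` is a bit. -/
def testBlock (q n : ℕ) (C : BoolCircuit (8 * n ^ 4)) (i : ℕ) : ℕ :=
  copyBlock n C 5 + 1 + i * (q + 4)

/-- The blocks of the circuit of the reduction: the first `8 n ^ 4` inputs, the circuit on encodings,
five copies of `C` (on the encodings of the constants, on the input and on the two restrictions of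
the input), the constant `1`, tests whether the inputs are bits, and the output. -/
def reductionGate (q n : ℕ) (C : BoolCircuit (8 * n ^ 4)) (w : ℕ) : BlockGate :=
  let m := 8 * n ^ 4
  let s := m + C.gates.length
  if w < m then .inp w
  else if w < copyBlock n C 0 then (encodingGate n w).toBlock 0
  else if w < copyBlock n C 5 then
    let c := (w - copyBlock n C 0) / s
    let j := (w - copyBlock n C 0) % s
    if j < m then
      if c = 0 then if j = 2 then .one else .zero
      else if c = 1 then if j = 1 then .one else .zero
      else if c = 2 then .copy j
      -- Copies `3` and `4` read the families `6` and `7`, the encodings after substituting `0` and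
      -- `1`.
      else .copy (m + 6 + ((c + 3) * m + j))
    else (C.gates.getD (j - m) (.not 0)).toBlock (copyBlock n C c)
  else if w = copyBlock n C 5 then .one
  else if w < testBlock q n C m then
    let i := (w - testBlock q n C 0) / (q + 4)
    let r := (w - testBlock q n C 0) % (q + 4)
    if r = 0 then .sub i (copyBlock n C 5)
    else if r = 1 then .mul i (w - 1)
    else if r = 2 then .one
    -- Block `r = k + 2` of a test holds `(x (x - 1)) ^ k`, so the power `q - 1` sits at `r = q +
    -- 1`.
    else if r < q + 2 then .mul (w - 1) (testBlock q n C i + 1)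
    else if r = q + 2 then .not (w - 1)
    -- The result is multiplied into the running product at the end of the previous test. Before the
    -- first test this is the constant `1` at `copyBlock n C 5`.
    else .mul (w - 1) (w - (q + 4))
  else
    let e := testBlock q n C m
    if w = e then .inp m
    else if w = e + 1 then .inp (m + 1)
    else if w = e + 2 then .inp (m + 2)
    else if w = e + 3 then .sub (copyBlock n C 0 + C.out) (copyBlock n C 5)
    else if w = e + 4 then .mul e (e + 3)
    else if w = e + 5 then .mul (e + 1) (copyBlock n C 1 + C.out)
    else if w = e + 6 then .or (copyBlock n C 3 + C.out) (copyBlock n C 4 + C.out)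
    else if w = e + 7 then .sub (copyBlock n C 2 + C.out) (e + 6)
    else if w = e + 8 then .mul (e + 2) (e + 7)
    else if w = e + 9 then .add (e + 4) (e + 5)
    else if w = e + 10 then .add (e + 9) (e + 8)
    else if w = e + 11 then .mul (e - 1) (m + 6 + 8 * m + 8)
    else .mul (e + 10) (e + 11)

/-- The number of blocks of the circuit of the reduction. -/
def reductionSize (q n : ℕ) (C : BoolCircuit (8 * n ^ 4)) : ℕ := testBlock q n C (8 * n ^ 4) + 13

/-! ### Layout of the circuit of the reduction -/

section
variable {q n : ℕ} {C : BoolCircuit (8 * n ^ 4)}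

theorem copyBlock_succ (c : ℕ) :
    copyBlock n C (c + 1) = copyBlock n C c + (8 * n ^ 4 + C.gates.length) := by
  unfold copyBlock
  ring

theorem testBlock_succ (i : ℕ) : testBlock q n C (i + 1) = testBlock q n C i + (q + 4) := by
  unfold testBlock
  ring

theorem copyBlock_mono {c d : ℕ} (h : c ≤ d) : copyBlock n C c ≤ copyBlock n C d := by
  unfold copyBlock
  gcongr

theorem testBlock_mono {i j : ℕ} (h : i ≤ j) : testBlock q n C i ≤ testBlock q n C j := by
  unfold testBlock
  gcongr

theorem copyBlock_zero : copyBlock n C 0 = 8 * n ^ 4 + encodingSize n := by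
  simp [copyBlock]

theorem testBlock_zero : testBlock q n C 0 = copyBlock n C 5 + 1 := by
  simp [testBlock]

theorem reductionGate_copy {c j : ℕ} (hc : c < 5) (hj : j < 8 * n ^ 4 + C.gates.length) :
    reductionGate q n C (copyBlock n C c + j) =
      let m := 8 * n ^ 4
      if j < m then
        if c = 0 then if j = 2 then .one else .zero
        else if c = 1 then if j = 1 then .one else .zero
        else if c = 2 then .copy j
        else .copy (m + 6 + ((c + 3) * m + j))
      else (C.gates.getD (j - m) (.not 0)).toBlock (copyBlock n C c) := by
  have h₀ := copyBlock_mono (C := C) (Nat.zero_le c)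
  have h₁ := copyBlock_mono (C := C) (Nat.succ_le_of_lt hc)
  have h₂ : copyBlock n C c + j - copyBlock n C 0 = j + (8 * n ^ 4 + C.gates.length) * c := by
    unfold copyBlock
    rw [Nat.zero_mul, Nat.add_zero, Nat.add_assoc, Nat.add_sub_cancel_left]
    ring
  have h₃ : 0 < 8 * n ^ 4 + C.gates.length := by omega
  have h₄ := copyBlock_zero (C := C)
  rw [copyBlock_succ] at h₁
  unfold reductionGate
  simp only []
  rw [h₂, Nat.add_mul_div_left _ _ h₃, Nat.div_eq_of_lt hj, Nat.zero_add, Nat.add_mul_mod_self_left,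
    Nat.mod_eq_of_lt hj, if_neg (by omega), if_neg (by omega), if_pos (by omega)]

theorem reductionGate_test {i r : ℕ} (hi : i < 8 * n ^ 4) (hr : r < q + 4) :
    reductionGate q n C (testBlock q n C i + r) =
      let w := testBlock q n C i + r
      if r = 0 then .sub i (copyBlock n C 5)
      else if r = 1 then .mul i (w - 1)
      else if r = 2 then .one
      else if r < q + 2 then .mul (w - 1) (testBlock q n C i + 1)
      else if r = q + 2 then .not (w - 1)
      else .mul (w - 1) (w - (q + 4)) := by
  have h₀ := testBlock_mono (q := q) (C := C) (Nat.zero_le i)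
  have h₁ := testBlock_mono (q := q) (C := C) (Nat.succ_le_of_lt hi)
  have h₂ : testBlock q n C i + r - testBlock q n C 0 = r + (q + 4) * i := by
    unfold testBlock
    rw [Nat.zero_mul, Nat.add_zero, Nat.add_assoc, Nat.add_sub_cancel_left]
    ring
  have h₄ := copyBlock_zero (C := C)
  have h₅ := copyBlock_mono (C := C) (Nat.zero_le 5)
  rw [testBlock_succ] at h₁
  rw [testBlock_zero] at h₀
  unfold reductionGate
  rw [h₂, Nat.add_mul_div_left _ _ (by omega), Nat.div_eq_of_lt hr, Nat.zero_add,
    Nat.add_mul_mod_self_left, Nat.mod_eq_of_lt hr, if_neg (by omega), if_neg (by omega),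
    if_neg (by omega), if_neg (by omega), if_pos (by omega)]

theorem reductionGate_final (d : ℕ) :
    reductionGate q n C (testBlock q n C (8 * n ^ 4) + d) =
      let m := 8 * n ^ 4
      let e := testBlock q n C m
      if d = 0 then .inp m
      else if d = 1 then .inp (m + 1)
      else if d = 2 then .inp (m + 2)
      else if d = 3 then .sub (copyBlock n C 0 + C.out) (copyBlock n C 5)
      else if d = 4 then .mul e (e + 3)
      else if d = 5 then .mul (e + 1) (copyBlock n C 1 + C.out)
      else if d = 6 then .or (copyBlock n C 3 + C.out) (copyBlock n C 4 + C.out)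
      else if d = 7 then .sub (copyBlock n C 2 + C.out) (e + 6)
      else if d = 8 then .mul (e + 2) (e + 7)
      else if d = 9 then .add (e + 4) (e + 5)
      else if d = 10 then .add (e + 9) (e + 8)
      else if d = 11 then .mul (e - 1) (m + 6 + 8 * m + 8)
      else .mul (e + 10) (e + 11) := by
  have h₀ := testBlock_mono (q := q) (C := C) (Nat.zero_le (8 * n ^ 4))
  have h₄ := copyBlock_zero (C := C)
  have h₅ := copyBlock_mono (C := C) (Nat.zero_le 5)
  rw [testBlock_zero] at h₀
  unfold reductionGate
  simp only []
  rw [if_neg (by omega), if_neg (by omega), if_neg (by omega), if_neg (by omega), if_neg (by omega)]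
  simp only [Nat.add_eq_left, Nat.add_left_cancel_iff]

theorem reductionGate_cases {w : ℕ} (hw : w < reductionSize q n C) :
    w < 8 * n ^ 4 ∨ (8 * n ^ 4 ≤ w ∧ w < 8 * n ^ 4 + encodingSize n) ∨
    (∃ c j, c < 5 ∧ j < 8 * n ^ 4 + C.gates.length ∧ w = copyBlock n C c + j) ∨
    w = copyBlock n C 5 ∨ (∃ i r, i < 8 * n ^ 4 ∧ r < q + 4 ∧ w = testBlock q n C i + r) ∨
    ∃ d < 13, w = testBlock q n C (8 * n ^ 4) + d := by
  have key : ∀ s a k w : ℕ, a ≤ w → w < a + k * s → ∃ c j, c < k ∧ j < s ∧ w = a + c * s + j := by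
    intro s a k w h₁ h₂
    have hs : 0 < s := Nat.pos_of_ne_zero (by rintro rfl; omega)
    refine ⟨(w - a) / s, (w - a) % s, ?_, Nat.mod_lt _ hs, ?_⟩
    · rw [Nat.div_lt_iff_lt_mul hs]
      omega
    · have := Nat.div_add_mod (w - a) s
      rw [Nat.mul_comm] at this
      omega
  have h₀ := copyBlock_zero (C := C)
  by_cases h₁ : w < 8 * n ^ 4
  · exact .inl h₁
  by_cases h₂ : w < 8 * n ^ 4 + encodingSize n
  · exact .inr (.inl ⟨by omega, h₂⟩)
  by_cases h₃ : w < copyBlock n C 5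
  · exact .inr (.inr (.inl (key _ _ _ _ (by omega) h₃)))
  by_cases h₄ : w = copyBlock n C 5
  · exact .inr (.inr (.inr (.inl h₄)))
  by_cases h₅ : w < testBlock q n C (8 * n ^ 4)
  · exact .inr (.inr (.inr (.inr (.inl (key _ _ _ _ (by omega) h₅)))))
  · unfold reductionSize at hw
    exact .inr (.inr (.inr (.inr (.inr ⟨w - testBlock q n C (8 * n ^ 4), by omega, by omega⟩))))

theorem reductionGate_bounded (hn : 0 < n) {w : ℕ} (hw : w < reductionSize q n C) :
    (reductionGate q n C w).Bounded (8 * n ^ 4 + 3) w := by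
  have h4 := four_lt_eight_mul_pow hn
  have h₀ := copyBlock_zero (C := C)
  have h₅ := copyBlock_mono (C := C) (Nat.zero_le 5)
  have ho := C.out_lt
  rcases reductionGate_cases hw with h | ⟨h, h'⟩ | ⟨c, j, hc, hj, rfl⟩ | rfl | ⟨i, r, hi, hr, rfl⟩ |
    ⟨d, hd, rfl⟩
  · unfold reductionGate
    simp only [h, if_true, BlockGate.Bounded]
    omega
  · have := BoolGate.bounded_toBlock (N := 8 * n ^ 4 + 3) (B := 0) (encodingGate_bounded hn h h')
    unfold reductionGate
    simp only []
    rw [if_neg (by omega), if_pos (by omega)]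
    simpa using this
  · have hc₀ := copyBlock_mono (C := C) (Nat.zero_le c)
    rw [reductionGate_copy hc hj]
    simp only []
    split_ifs with h₁ h₂ h₃ h₄ h₅ h₆
    any_goals exact trivial
    · simp only [BlockGate.Bounded]
      omega
    · simp only [BlockGate.Bounded]
      have := Nat.mul_le_mul_right (8 * n ^ 4) (show c + 3 ≤ 7 by omega)
      unfold encodingSize at h₀
      omega
    · have hlt : j - 8 * n ^ 4 < C.gates.length := by omega
      have := C.gates_bounded (j - 8 * n ^ 4) _ (List.getElem?_eq_getElem hlt)
      rw [show 8 * n ^ 4 + (j - 8 * n ^ 4) = j by omega] at this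
      rw [List.getD_eq_getElem _ _ hlt]
      exact BoolGate.bounded_toBlock this
  · have := testBlock_mono (q := q) (C := C) (Nat.zero_le (8 * n ^ 4))
    unfold reductionGate
    simp only []
    rw [if_neg (by omega), if_neg (by omega), if_neg (by omega), if_pos trivial]
    trivial
  · have h₁ := testBlock_mono (q := q) (C := C) (Nat.zero_le i)
    rw [testBlock_zero] at h₁
    rw [reductionGate_test hi hr]
    simp only []
    split_ifs <;> simp only [BlockGate.Bounded] <;> omega
  · have h₁ := testBlock_mono (q := q) (C := C) (Nat.zero_le (8 * n ^ 4))
    rw [testBlock_zero] at h₁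
    have hcopy : ∀ c < 5, copyBlock n C c + C.out < copyBlock n C 5 := fun c hc => by
      have := copyBlock_mono (C := C) (Nat.succ_le_of_lt hc)
      rw [copyBlock_succ] at this
      omega
    have c₀ := hcopy 0 (by omega)
    have c₁ := hcopy 1 (by omega)
    have c₂ := hcopy 2 (by omega)
    have c₃ := hcopy 3 (by omega)
    have c₄ := hcopy 4 (by omega)
    unfold encodingSize at h₀
    rw [reductionGate_final]
    interval_cases d <;>
      simp only [if_true, if_false, OfNat.ofNat_ne_zero, OfNat.ofNat_ne_one, one_ne_zero,
        Nat.reduceEqDiff, BlockGate.Bounded] <;> omega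

end

/-- The arithmetic circuit of the reduction. -/
def reductionCircuit (F : Type) [Field F] (q : ℕ) {n : ℕ} (hn : 0 < n)
    (C : BoolCircuit (8 * n ^ 4)) : ArithCircuit F (8 * n ^ 4 + 3) :=
  blockCircuit F (8 * n ^ 4 + 3) (reductionSize q n C) (reductionGate q n C)
    (Nat.succ_pos _) fun _ hw => reductionGate_bounded hn hw

/-- The values of the blocks of the circuit of the reduction, given the values of its inputs. -/
def ReductionValues {R : Type} [CommRing R] (q n : ℕ) (C : BoolCircuit (8 * n ^ 4))
    (x v : ℕ → R) : Prop :=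
  ∀ w < reductionSize q n C, v w = (reductionGate q n C w).eval x v

/-! ### Values of the blocks of the circuit of the reduction -/

namespace ReductionValues

variable {R : Type} [CommRing R] {q n : ℕ} {C : BoolCircuit (8 * n ^ 4)} {x v : ℕ → R}

theorem copyBlock_le : copyBlock n C 5 < reductionSize q n C := by
  have := testBlock_mono (q := q) (C := C) (Nat.zero_le (8 * n ^ 4))
  rw [testBlock_zero] at this
  unfold reductionSize
  omega

theorem input (h : ReductionValues q n C x v) {i : ℕ} (hi : i < 8 * n ^ 4) : v i = x i := by
  have h₀ := copyBlock_zero (C := C)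
  have h₁ := copyBlock_mono (C := C) (Nat.zero_le 5)
  have h₂ := copyBlock_le (q := q) (C := C)
  rw [h i (by omega), reductionGate]
  simp only [hi, if_true, BlockGate.eval]

/-- The program on encodings is laid out once, with unchanged wire numbers. Its arithmetization can
then be read off at any output wire. -/
theorem encoding (h : ReductionValues q n C x v) (hn : 0 < n) (o : ℕ)
    (ho : o < 8 * n ^ 4 + encodingSize n) :
    (encodingCircuit hn o ho).arith (fun i => x i) = v o := by
  have h₀ := copyBlock_zero (C := C)
  have h₁ := copyBlock_mono (C := C) (Nat.zero_le 5)
  have h₂ := copyBlock_le (q := q) (C := C)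
  refine BoolCircuit.arith_eq _ (fun i => h.input i.2) fun t g hg => ?_
  obtain ⟨ht, rfl⟩ := (encodingCircuit_getElem? hn o ho).1 hg
  rw [h _ (by omega), reductionGate]
  simp only []
  rw [if_neg (by omega), if_pos (by omega), BoolGate.eval_toBlock]
  simp

theorem copy_lt {c j : ℕ} (hc : c < 5) (hj : j < 8 * n ^ 4 + C.gates.length) :
    copyBlock n C c + j < reductionSize q n C := by
  have h₁ := copyBlock_mono (C := C) (Nat.succ_le_of_lt hc)
  have h₂ := copyBlock_le (q := q) (C := C)
  rw [copyBlock_succ] at h₁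
  omega

/-- Seen from its first block, copy `c` solves the gate equations of the arithmetization of `C`,
with the first `8 n ^ 4` blocks as inputs. -/
theorem copy (h : ReductionValues q n C x v) {c : ℕ} (hc : c < 5) :
    C.arith (fun j => v (copyBlock n C c + j)) = v (copyBlock n C c + C.out) := by
  refine C.arith_eq (v := fun j => v (copyBlock n C c + j)) (fun _ => rfl) fun t g hg => ?_
  obtain ⟨ht, rfl⟩ := List.getElem?_eq_some_iff.1 hg
  rw [h _ (copy_lt hc (by omega)), reductionGate_copy hc (by omega)]
  simp only [Nat.add_sub_cancel_left, List.getD_eq_getElem _ _ ht]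
  rw [if_neg (by omega), BoolGate.eval_toBlock]

theorem copy_input (h : ReductionValues q n C x v) {c j : ℕ} (hc : c < 5) (hj : j < 8 * n ^ 4) :
    v (copyBlock n C c + j) =
      (if c = 0 then if j = 2 then .one else .zero
        else if c = 1 then if j = 1 then .one else .zero
        else if c = 2 then .copy j
        else .copy (8 * n ^ 4 + 6 + ((c + 3) * (8 * n ^ 4) + j)) : BlockGate).eval x v := by
  rw [h _ (copy_lt hc (by omega)), reductionGate_copy hc (by omega)]
  simp only [hj, if_true]

theorem one (h : ReductionValues q n C x v) : v (copyBlock n C 5) = 1 := by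
  have h₀ := copyBlock_zero (C := C)
  have h₁ := copyBlock_mono (C := C) (Nat.zero_le 5)
  rw [h _ copyBlock_le, reductionGate]
  simp only []
  rw [if_neg (by omega), if_neg (by omega), if_neg (by omega), if_pos trivial, BlockGate.eval]

theorem test_lt {i r : ℕ} (hi : i < 8 * n ^ 4) (hr : r < q + 4) :
    testBlock q n C i + r < reductionSize q n C := by
  have h₁ := testBlock_mono (q := q) (C := C) (Nat.succ_le_of_lt hi)
  rw [testBlock_succ] at h₁
  unfold reductionSize
  omega

theorem pow (h : ReductionValues q n C x v) {i k : ℕ} (hi : i < 8 * n ^ 4) (hk : k < q) :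
    v (testBlock q n C i + (k + 2)) = (x i * (x i - 1)) ^ k := by
  have h₀ : v (testBlock q n C i + 0) = x i - 1 := by
    rw [h _ (test_lt hi (by omega)), reductionGate_test hi (by omega)]
    simp only [if_true, BlockGate.eval, h.one, h.input hi]
  have h₁ : v (testBlock q n C i + 1) = x i * (x i - 1) := by
    rw [h _ (test_lt hi (by omega)), reductionGate_test hi (by omega)]
    simp only [if_true, one_ne_zero, if_false, BlockGate.eval, Nat.add_sub_cancel, h.input hi]
    rw [← h₀, Nat.add_zero]
  induction k with
  | zero =>
    rw [h _ (test_lt hi (by omega)), reductionGate_test hi (by omega)]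
    simp [BlockGate.eval]
  | succ k ih =>
    rw [h _ (test_lt hi (by omega)), reductionGate_test hi (by omega)]
    simp only []
    rw [if_neg (by omega), if_neg (by omega), if_neg (by omega), if_pos (by omega), BlockGate.eval, h₁,
      show testBlock q n C i + (k + 1 + 2) - 1 = testBlock q n C i + (k + 2) by omega,
      ih (by omega), pow_succ]

/-- The block just before test `i` holds the product of the preceding tests, and each test ends by
multiplying in its own value. Positivity of `q` is needed for the power `q - 1` to be among the
computed ones. -/
theorem test (h : ReductionValues q n C x v) (hq : 0 < q) {i : ℕ} (hi : i ≤ 8 * n ^ 4) :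
    v (testBlock q n C i - 1) = ∏ j ∈ Finset.range i, bitTest q (x j) := by
  induction i with
  | zero => simp [testBlock_zero, h.one]
  | succ i ih =>
    have h₀ := testBlock_mono (q := q) (C := C) (Nat.zero_le i)
    rw [testBlock_zero] at h₀
    have h₁ : v (testBlock q n C i + (q + 2)) = bitTest q (x i) := by
      rw [h _ (test_lt hi (by omega)), reductionGate_test hi (by omega)]
      simp only []
      rw [if_neg (by omega), if_neg (by omega), if_neg (by omega), if_neg (by omega), if_pos trivial,
        BlockGate.eval, bitTest, ← h.pow hi (Nat.sub_lt hq one_pos)]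
      congr 3
      omega
    rw [testBlock_succ, show testBlock q n C i + (q + 4) - 1 = testBlock q n C i + (q + 3) by omega,
      h _ (test_lt hi (by omega)), reductionGate_test hi (by omega)]
    simp only []
    rw [if_neg (by omega), if_neg (by omega), if_neg (by omega), if_neg (by omega),
      if_neg (by omega), BlockGate.eval, Finset.prod_range_succ, ← ih (by omega), ← h₁, mul_comm]
    congr 2
    omega

theorem final (h : ReductionValues q n C x v) :
    v (testBlock q n C (8 * n ^ 4) + 12) =
      (x (8 * n ^ 4) * (v (copyBlock n C 0 + C.out) - 1) +
        x (8 * n ^ 4 + 1) * v (copyBlock n C 1 + C.out) +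
        x (8 * n ^ 4 + 2) * (v (copyBlock n C 2 + C.out) -
          (1 - (1 - v (copyBlock n C 3 + C.out)) * (1 - v (copyBlock n C 4 + C.out))))) *
      (v (testBlock q n C (8 * n ^ 4) - 1) * v (8 * n ^ 4 + 6 + 8 * (8 * n ^ 4) + 8)) := by
  have hw : ∀ d < 13, v (testBlock q n C (8 * n ^ 4) + d) =
      (reductionGate q n C (testBlock q n C (8 * n ^ 4) + d)).eval x v := fun d hd =>
    h _ (by unfold reductionSize; omega)
  have w₀ := hw 0 (by omega)
  have w₁ := hw 1 (by omega)
  have w₂ := hw 2 (by omega)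
  have w₃ := hw 3 (by omega)
  have w₄ := hw 4 (by omega)
  have w₅ := hw 5 (by omega)
  have w₆ := hw 6 (by omega)
  have w₇ := hw 7 (by omega)
  have w₈ := hw 8 (by omega)
  have w₉ := hw 9 (by omega)
  have w₁₀ := hw 10 (by omega)
  have w₁₁ := hw 11 (by omega)
  have w₁₂ := hw 12 (by omega)
  rw [reductionGate_final] at w₀ w₁ w₂ w₃ w₄ w₅ w₆ w₇ w₈ w₉ w₁₀ w₁₁ w₁₂
  simp only [if_true, BlockGate.eval, OfNat.ofNat_ne_zero, OfNat.ofNat_ne_one, if_false,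
    one_ne_zero, Nat.add_zero, Nat.reduceEqDiff, h.one]
    at w₀ w₁ w₂ w₃ w₄ w₅ w₆ w₇ w₈ w₉ w₁₀ w₁₁ w₁₂
  rw [w₁₂, w₁₁, w₁₀, w₉, w₈, w₇, w₆, w₅, w₄, w₃, w₂, w₁, w₀]

end ReductionValues

/-- The block equations are solved in an arbitrary commutative `F`-algebra. Polynomial rings give
the formal identity and `F` itself gives the computed function, both from this statement. -/
theorem reductionCircuit_eval {F : Type} [Field F] {q n : ℕ} (hq : 0 < q) (hn : 0 < n)
    (C : BoolCircuit (8 * n ^ 4)) {R : Type} [CommRing R] [Algebra F R]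
    (x : Fin (8 * n ^ 4 + 3) → R) :
    (reductionCircuit F q hn C).eval x =
      recursionFactor n C (restrictor hn false) (restrictor hn true) (fun i => x (Fin.castAdd 3 i))
        (x (Fin.natAdd _ 0)) (x (Fin.natAdd _ 1)) (x (Fin.natAdd _ 2)) *
      guardFactor q (recognizer hn) (fun i => x (Fin.castAdd 3 i)) := by
  obtain ⟨v, hv, he⟩ := exists_blockValues (F := F) (W := reductionSize q n C) (Nat.succ_pos _)
    (fun _ hw => reductionGate_bounded hn hw) x
  have h : ReductionValues q n C (fun i => (List.ofFn x).getD i 0) v := hv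
  have hx : ∀ i : Fin (8 * n ^ 4 + 3), (List.ofFn x).getD i 0 = x i := fun i => by
    rw [List.getD_eq_getElem _ _ (by rw [List.length_ofFn]; exact i.2), List.getElem_ofFn]
  have hx' : (fun i : Fin (8 * n ^ 4) => x (Fin.castAdd 3 i)) =
      fun i : Fin (8 * n ^ 4) => (List.ofFn x).getD i 0 := by
    funext i
    exact (hx _).symm
  have c₀ : C.arith (bitVec ((SatInstance.const true).encode n) : _ → R) =
      v (copyBlock n C 0 + C.out) := by
    rw [← h.copy (by omega)]
    congr 1
    funext j
    rw [h.copy_input (by omega) j.2, bitVec]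
    by_cases hj : (j : ℕ) = 2 <;> simp [SatInstance.encode, hj, BlockGate.eval]
  have c₁ : C.arith (bitVec ((SatInstance.const false).encode n) : _ → R) =
      v (copyBlock n C 1 + C.out) := by
    rw [← h.copy (by omega)]
    congr 1
    funext j
    rw [h.copy_input (by omega) j.2, bitVec]
    by_cases hj : (j : ℕ) = 1 <;> simp [SatInstance.encode, hj, BlockGate.eval]
  have c₂ : C.arith (fun i : Fin (8 * n ^ 4) => (List.ofFn x).getD i 0) =
      v (copyBlock n C 2 + C.out) := by
    rw [← h.copy (by omega)]
    congr 1
    funext j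
    rw [h.copy_input (by omega) j.2]
    simp [BlockGate.eval, h.input j.2]
  have c₃ : C.arith (fun i => (restrictor hn false i).arith
      (fun i : Fin (8 * n ^ 4) => (List.ofFn x).getD i 0)) = v (copyBlock n C 3 + C.out) := by
    rw [← h.copy (by omega)]
    congr 1
    funext j
    rw [h.copy_input (by omega) j.2, restrictor, h.encoding hn]
    simp [BlockGate.eval]
  have c₄ : C.arith (fun i => (restrictor hn true i).arith
      (fun i : Fin (8 * n ^ 4) => (List.ofFn x).getD i 0)) = v (copyBlock n C 4 + C.out) := by
    rw [← h.copy (by omega)]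
    congr 1
    funext j
    rw [h.copy_input (by omega) j.2, restrictor, h.encoding hn]
    simp [BlockGate.eval]
  rw [hx', recursionFactor, guardFactor, c₀, c₁, c₂, c₃, c₄, recognizer, h.encoding hn,
    Finset.prod_fin_eq_prod_range, ← hx (Fin.natAdd _ 0), ← hx (Fin.natAdd _ 1),
    ← hx (Fin.natAdd _ 2)]
  have hp : (∏ i ∈ Finset.range (8 * n ^ 4), if hi : i < 8 * n ^ 4 then
      bitTest q ((List.ofFn x).getD ((⟨i, hi⟩ : Fin (8 * n ^ 4)) : ℕ) 0) else 1) =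
      v (testBlock q n C (8 * n ^ 4) - 1) := by
    rw [h.test hq le_rfl]
    exact Finset.prod_congr rfl fun i hi => by rw [dif_pos (Finset.mem_range.1 hi)]
  rw [hp]
  exact he.trans h.final

/-! ### Reading the code of a boolean circuit -/

namespace BoolSym

def isTick : BoolSym → ℕ
  | tick => 1
  | _ => 0

/-- The operation symbol `not` closes an empty field, so that every gate occupies exactly two
fields. Field `0` is then `n`, fields `2 t + 1` and `2 t + 2` belong to gate `t`, and the field
after the gates is the output wire. -/
def endsField : BoolSym → Bool
  | sep => true
  | not => true
  | _ => false

def isOp : BoolSym → ℕ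
  | tick => 0
  | sep => 0
  | _ => 1

def opNumber : BoolSym → ℕ
  | or => 1
  | not => 2
  | _ => 0

/-- An operation symbol belongs to the segment it closes, so segment `t` has the operation of gate
`t` as its only symbol of possibly nonzero weight `opNumber`. -/
def endsOp : BoolSym → Bool
  | tick => false
  | sep => false
  | _ => true

theorem segSum_unary (i : ℕ) (l : List BoolSym) :
    segSum isTick endsField 1 (unary i ++ l) = i := by
  induction i with
  | zero => simp [unary, segSum, isTick, endsField, segSum_zero]
  | succ i ih => simpa [unary, List.replicate_succ, segSum, isTick, endsField, Nat.add_comm 1] using ih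

theorem segSum_unary_append (c i : ℕ) (l : List BoolSym) :
    segSum isTick endsField (c + 2) (unary i ++ l) = segSum isTick endsField (c + 1) l := by
  induction i with
  | zero => simp [unary, segSum, endsField]
  | succ i ih => simpa [unary, List.replicate_succ, segSum, isTick, endsField] using ih

theorem opSum_unary_append (c i : ℕ) (l : List BoolSym) :
    segSum opNumber endsOp c (unary i ++ l) = segSum opNumber endsOp c l := by
  cases c with
  | zero => simp [segSum_zero]
  | succ c =>
    induction i with
    | zero => simp [unary, segSum, opNumber, endsOp]
    | succ i ih => simpa [unary, List.replicate_succ, segSum, opNumber, endsOp] using ih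

theorem opCount_unary_append (i : ℕ) (l : List BoolSym) :
    segSum isOp (fun _ => false) 1 (unary i ++ l) = segSum isOp (fun _ => false) 1 l := by
  induction i with
  | zero => simp [unary, segSum, isOp]
  | succ i ih => simpa [unary, List.replicate_succ, segSum, isOp] using ih

end BoolSym

namespace BoolGate

def opNumber : BoolGate → ℕ
  | and _ _ => 0
  | or _ _ => 1
  | not _ => 2

def fst : BoolGate → ℕ
  | and i _ => i
  | or i _ => i
  | not _ => 0

def snd : BoolGate → ℕ
  | and _ j => j
  | or _ j => j
  | not i => i

theorem eq_of_opNumber (g : BoolGate) :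
    g = if g.opNumber = 0 then .and g.fst g.snd
      else if g.opNumber = 1 then .or g.fst g.snd else .not g.snd := by
  cases g <;> rfl

open BoolSym in
theorem segSum_code_append (c : ℕ) (g : BoolGate) (l : List BoolSym) :
    segSum isTick endsField (c + 1) (g.code ++ l) =
      if c = 0 then g.fst else if c = 1 then g.snd else segSum isTick endsField (c - 1) l := by
  rcases c with _ | _ | c <;> cases g <;>
    simp [code, segSum_cons, segNext, isTick, endsField, segSum_unary, segSum_unary_append, fst, snd,
      segSum_zero]

open BoolSym in
theorem opSum_code_append (c : ℕ) (g : BoolGate) (l : List BoolSym) :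
    segSum BoolSym.opNumber endsOp (c + 1) (g.code ++ l) =
      if c = 0 then g.opNumber else segSum BoolSym.opNumber endsOp c l := by
  rcases c with _ | c <;> cases g <;>
    simp [code, segSum_cons, segNext, BoolSym.opNumber, endsOp, opSum_unary_append, opNumber,
      segSum_zero]

open BoolSym in
theorem segSum_codes_append (c : ℕ) (gates : List BoolGate) (l : List BoolSym) :
    segSum isTick endsField (2 * gates.length + c + 1) (gates.flatMap code ++ l) =
      segSum isTick endsField (c + 1) l := by
  induction gates with
  | nil => simp
  | cons g gates ih =>
    rw [List.flatMap_cons, List.append_assoc, List.length_cons, segSum_code_append,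
      if_neg (by omega), if_neg (by omega), ← ih]
    congr 1
    omega

open BoolSym in
theorem opCount_codes_append (gates : List BoolGate) (l : List BoolSym) :
    segSum isOp (fun _ => false) 1 (gates.flatMap code ++ l) =
      gates.length + segSum isOp (fun _ => false) 1 l := by
  induction gates with
  | nil => simp
  | cons g gates ih =>
    rw [List.flatMap_cons, List.append_assoc, List.length_cons]
    cases g <;>
      simp [code, segSum_cons, segNext, isOp, opCount_unary_append, ih] <;> omega

open BoolSym in
theorem opSum_codes_append {t : ℕ} {gates : List BoolGate} (ht : t < gates.length)
    (l : List BoolSym) : segSum BoolSym.opNumber endsOp (t + 1) (gates.flatMap code ++ l) =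
      gates[t].opNumber := by
  induction gates generalizing t with
  | nil => simp at ht
  | cons g gates ih =>
    rw [List.flatMap_cons, List.append_assoc, opSum_code_append]
    cases t with
    | zero => simp
    | succ t => simpa using ih (by simpa using ht)

open BoolSym in
theorem segSum_gate {t c : ℕ} {gates : List BoolGate} (ht : t < gates.length) (hc : c < 2)
    (l : List BoolSym) : segSum isTick endsField (2 * t + c + 1) (gates.flatMap code ++ l) =
      if c = 0 then gates[t].fst else gates[t].snd := by
  induction gates generalizing t with
  | nil => simp at ht
  | cons g gates ih =>
    rw [List.flatMap_cons, List.append_assoc, segSum_code_append]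
    cases t with
    | zero => interval_cases c <;> simp
    | succ t =>
      rw [if_neg (by omega), if_neg (by omega),
        show 2 * (t + 1) + c - 1 = 2 * t + c + 1 by omega]
      simpa using ih (by simpa using ht)

end BoolGate

section
open BoolSym
variable {O : Type} {X : Ctx BoolSym O} {p : X.α → Σ n : ℕ, BoolCircuit (8 * n ^ 4)}

theorem evals_size (hx : ∀ a, X.x a = encodeBoolCircuit (p a)) : Evals X fun a => (p a).1 := by
  have h := Evals.segSum (X := X) isTick endsField (.const 1)
  convert h using 2 with a
  rw [hx, encodeBoolCircuit, List.append_assoc, segSum_unary]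

theorem evals_length (hx : ∀ a, X.x a = encodeBoolCircuit (p a)) :
    Evals X fun a => (p a).2.gates.length := by
  have h := Evals.segSum (X := X) isOp (fun _ => false) (.const 1)
  convert h using 2 with a
  rw [hx, encodeBoolCircuit, List.append_assoc, opCount_unary_append,
    BoolGate.opCount_codes_append]
  have := opCount_unary_append (p a).2.out []
  rw [List.append_nil] at this
  simp [this, segSum]

theorem evals_out (hx : ∀ a, X.x a = encodeBoolCircuit (p a)) :
    Evals X fun a => (p a).2.out := by
  have h := Evals.segSum (X := X) isTick endsField
    -- The output wire is field `2 * length + 1`, and `segSum` counts segments from one.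
    (.add (.mul (.const 2) (evals_length hx)) (.const 2))
  convert h using 2 with a
  rw [hx, encodeBoolCircuit, List.append_assoc, segSum_unary_append,
    BoolGate.segSum_codes_append 0]
  have := segSum_unary (p a).2.out []
  rw [List.append_nil] at this
  exact this.symm

/-- Gate `t` is recovered from three numbers, its operation and its two fields, as a case
distinction of the kind that `EmitsGate.ite` can write. -/
theorem evals_gates (hx : ∀ a, X.x a = encodeBoolCircuit (p a)) {t : X.α → ℕ} (ht : Evals X t) :
    ∃ o i j : X.α → ℕ, Evals X o ∧ Evals X i ∧ Evals X j ∧ ∀ a, t a < (p a).2.gates.length →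
      (p a).2.gates.getD (t a) (.not 0) =
        if o a = 0 then .and (i a) (j a) else if o a = 1 then .or (i a) (j a) else .not (j a) := by
  refine ⟨_, _, _, .segSum opNumber endsOp (.add ht (.const 1)),
    .segSum isTick endsField (.add (.mul (.const 2) ht) (.const 2)),
    .segSum isTick endsField (.add (.mul (.const 2) ht) (.const 3)), fun a h => ?_⟩
  have h₁ := BoolGate.segSum_gate h (c := 0) (by omega) (unary (p a).2.out)
  have h₂ := BoolGate.segSum_gate h (c := 1) (by omega) (unary (p a).2.out)
  have h₃ := BoolGate.opSum_codes_append h (unary (p a).2.out)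
  rw [hx, encodeBoolCircuit, List.append_assoc, opSum_unary_append, segSum_unary_append,
    segSum_unary_append, h₃, List.getD_eq_getElem _ _ h]
  refine (BoolGate.eq_of_opNumber _).trans ?_
  simp only [if_true, one_ne_zero, if_false, Nat.add_zero] at h₁ h₂
  rw [h₁, h₂]

end

/-! ### Evaluation of the functions used in the reduction -/

section
variable {I O : Type} {X : Ctx I O}

theorem Evals.inputs {n : X.α → ℕ} (h : Evals X n) : Evals X (fun a => 8 * n a ^ 4) := by
  convert Evals.mul (.const 8) (((h.mul h).mul h).mul h) using 2
  ring

theorem Evals.sq {n : X.α → ℕ} (h : Evals X n) : Evals X (fun a => n a ^ 2) := by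
  convert h.mul h using 2
  ring

theorem Evals.encodingSize {n : X.α → ℕ} (h : Evals X n) :
    Evals X (fun a => encodingSize (n a)) :=
  (Evals.mul (.const 8) h.inputs).add (.const 15)

theorem Evals.clausePos {b i j k : X.α → ℕ} (hb : Evals X b) (hi : Evals X i) (hj : Evals X j)
    (hk : Evals X k) : Evals X (fun a => clausePos (b a) (i a) (j a) (k a)) :=
  (((hi.mul hb).add hj).mul hb).add hk

theorem EvalsP.isClausePos {b p : X.α → ℕ} (hb : Evals X b) (hp : Evals X p)
    (h0 : ∀ a, 0 < b a) : EvalsP X (fun a => IsClausePos (b a) (p a)) := by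
  have hi := hp.div hb.sq fun a => Nat.pow_pos (h0 a)
  have hj := (hp.div hb h0).mod hb h0
  have hk := hp.mod hb h0
  exact (EvalsP.le hi hj).and ((EvalsP.le hj hk).and (((EvalsP.eq hi hj).imp (.eq hj hk)).and
    (((EvalsP.eq (hi.div (.const 2) fun _ => two_pos) (hj.div (.const 2) fun _ => two_pos)).imp
      (.eq hi hj)).and
    ((EvalsP.eq (hj.div (.const 2) fun _ => two_pos) (hk.div (.const 2) fun _ => two_pos)).imp
      (.eq hj hk)))))

theorem EvalsP.hasDigit {b p t : X.α → ℕ} (hb : Evals X b) (hp : Evals X p) (ht : Evals X t)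
    (h0 : ∀ a, 0 < b a) : EvalsP X (fun a => HasDigit (b a) (t a) (p a)) :=
  (EvalsP.eq ht (hp.div hb.sq fun a => Nat.pow_pos (h0 a))).or
    ((EvalsP.eq ht ((hp.div hb h0).mod hb h0)).or (.eq ht (hp.mod hb h0)))

end

/-! ### Writing the code of an arithmetic circuit -/

section
variable {I F : Type} {X : Ctx I (ArithSym F)}

theorem Emits.unary {e : X.α → ℕ} (h : Evals X e) : Emits X (fun a => ArithSym.unary (e a)) :=
  (Emits.replicate h _).append (.cons _ .nil)

section
variable {N e e₁ e₂ : X.α → ℕ}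

theorem Emits.code_add (h₁ : Evals X e₁) (h₂ : Evals X e₂) :
    Emits X (fun a => (ArithGate.add (F := F) (e₁ a) (e₂ a)).code) :=
  .cons _ ((Emits.unary h₁).append (.unary h₂))

theorem Emits.code_sub (h₁ : Evals X e₁) (h₂ : Evals X e₂) :
    Emits X (fun a => (ArithGate.sub (F := F) (e₁ a) (e₂ a)).code) :=
  .cons _ ((Emits.unary h₁).append (.unary h₂))

theorem Emits.code_mul (h₁ : Evals X e₁) (h₂ : Evals X e₂) :
    Emits X (fun a => (ArithGate.mul (F := F) (e₁ a) (e₂ a)).code) :=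
  .cons _ ((Emits.unary h₁).append (.unary h₂))

theorem Emits.code_const (c : F) : Emits X (fun _ => (ArithGate.const c).code) :=
  .cons _ .nil

theorem Emits.three {g₁ g₂ g₃ : X.α → ArithGate F} (h₁ : Emits X fun a => (g₁ a).code)
    (h₂ : Emits X fun a => (g₂ a).code) (h₃ : Emits X fun a => (g₃ a).code) :
    Emits X fun a => [g₁ a, g₂ a, g₃ a].flatMap ArithGate.code :=
  h₁.append (h₂.append (h₃.append .nil))

theorem Evals.wire (hN : Evals X N) (h : Evals X e) :
    Evals X (fun a => BlockGate.wire (N a) (e a)) :=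
  hN.add ((Evals.mul (.const 3) h).add (.const 2))

end

variable [Field F]

/-- The gates of the block `g a` at position `w a` of a circuit with `N a` inputs can be written in
polynomial time. -/
def EmitsBlock (X : Ctx I (ArithSym F)) (N w : X.α → ℕ) (g : X.α → BlockGate) : Prop :=
  Emits X fun a => ((g a).block F (N a) (w a)).flatMap ArithGate.code

namespace EmitsBlock

variable {N w e e₁ e₂ : X.α → ℕ}

theorem ite {p : X.α → Prop} [DecidablePred p] {g₁ g₂ : X.α → BlockGate} (hp : EvalsP X p)
    (h₁ : EmitsBlock X N w g₁) (h₂ : EmitsBlock X N w g₂) :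
    EmitsBlock X N w (fun a => if p a then g₁ a else g₂ a) := by
  unfold EmitsBlock
  convert Emits.ite hp h₁ h₂ using 2 with a
  by_cases h : p a <;> simp only [h, if_true, if_false]

theorem zero : EmitsBlock X N w (fun _ => .zero) :=
  Emits.three (.code_const 0) (.code_const 0) (.code_const 0)

theorem one : EmitsBlock X N w (fun _ => .one) :=
  Emits.three (.code_const 0) (.code_const 0) (.code_const 1)

theorem inp (hN : Evals X N) (hw : Evals X w) (h : Evals X e) :
    EmitsBlock X N w (fun a => .inp (e a)) :=
  Emits.three (.code_const 0) (.code_const 0) (.code_add h (hN.add (.mul (.const 3) hw)))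

theorem copy (hN : Evals X N) (hw : Evals X w) (h : Evals X e) :
    EmitsBlock X N w (fun a => .copy (e a)) :=
  Emits.three (.code_const 0) (.code_const 0) (.code_add (.wire hN h) (hN.add (.mul (.const 3) hw)))

theorem add (hN : Evals X N) (h₁ : Evals X e₁) (h₂ : Evals X e₂) :
    EmitsBlock X N w (fun a => .add (e₁ a) (e₂ a)) :=
  Emits.three (.code_const 0) (.code_const 0) (.code_add (.wire hN h₁) (.wire hN h₂))

theorem sub (hN : Evals X N) (h₁ : Evals X e₁) (h₂ : Evals X e₂) :
    EmitsBlock X N w (fun a => .sub (e₁ a) (e₂ a)) :=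
  Emits.three (.code_const 0) (.code_const 0) (.code_sub (.wire hN h₁) (.wire hN h₂))

theorem mul (hN : Evals X N) (h₁ : Evals X e₁) (h₂ : Evals X e₂) :
    EmitsBlock X N w (fun a => .mul (e₁ a) (e₂ a)) :=
  Emits.three (.code_const 0) (.code_const 0) (.code_mul (.wire hN h₁) (.wire hN h₂))

theorem or (hN : Evals X N) (hw : Evals X w) (h₁ : Evals X e₁) (h₂ : Evals X e₂) :
    EmitsBlock X N w (fun a => .or (e₁ a) (e₂ a)) :=
  Emits.three (.code_add (.wire hN h₁) (.wire hN h₂))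
    (.code_mul (.wire hN h₁) (.wire hN h₂))
    (.code_sub (hN.add (.mul (.const 3) hw)) (hN.add ((Evals.mul (.const 3) hw).add (.const 1))))

theorem not (hN : Evals X N) (hw : Evals X w) (h : Evals X e) :
    EmitsBlock X N w (fun a => .not (e a)) :=
  Emits.three (.code_const 0) (.code_const 1)
    (.code_sub (hN.add ((Evals.mul (.const 3) hw).add (.const 1))) (.wire hN h))

end EmitsBlock

/-- The blocks for boolean gates, with wires numbered from `B a` on, can be written in polynomial
time. -/
def EmitsGate (X : Ctx I (ArithSym F)) (N w B : X.α → ℕ) (g : X.α → BoolGate) : Prop :=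
  EmitsBlock X N w fun a => (g a).toBlock (B a)

namespace EmitsGate

variable {N w B e e₁ e₂ : X.α → ℕ}

theorem ite {p : X.α → Prop} [DecidablePred p] {g₁ g₂ : X.α → BoolGate} (hp : EvalsP X p)
    (h₁ : EmitsGate X N w B g₁) (h₂ : EmitsGate X N w B g₂) :
    EmitsGate X N w B (fun a => if p a then g₁ a else g₂ a) := by
  unfold EmitsGate
  convert EmitsBlock.ite hp h₁ h₂ using 2 with a
  by_cases h : p a <;> simp only [h, if_true, if_false]

theorem and (hN : Evals X N) (hB : Evals X B) (h₁ : Evals X e₁) (h₂ : Evals X e₂) :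
    EmitsGate X N w B (fun a => .and (e₁ a) (e₂ a)) :=
  EmitsBlock.mul hN (hB.add h₁) (hB.add h₂)

theorem or (hN : Evals X N) (hw : Evals X w) (hB : Evals X B) (h₁ : Evals X e₁)
    (h₂ : Evals X e₂) : EmitsGate X N w B (fun a => .or (e₁ a) (e₂ a)) :=
  EmitsBlock.or hN hw (hB.add h₁) (hB.add h₂)

theorem not (hN : Evals X N) (hw : Evals X w) (hB : Evals X B) (h : Evals X e) :
    EmitsGate X N w B (fun a => .not (e a)) :=
  EmitsBlock.not hN hw (hB.add h)

end EmitsGate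

/-! ### Writing the circuit of the reduction -/

/-- The proof term repeats the branches of `encodingGate`, with one closure lemma for each operation
and each condition. The positivity of `n` makes all divisors positive. -/
theorem EmitsGate.encodingGate {N w B n v : X.α → ℕ} (hN : Evals X N) (hw : Evals X w)
    (hB : Evals X B) (hn : Evals X n) (hv : Evals X v) (h0 : ∀ a, 0 < n a) :
    EmitsGate X N w B (fun a => encodingGate (n a) (v a)) := by
  have hm := hn.inputs
  have h0m : ∀ a, 0 < 8 * n a ^ 4 := fun a => Nat.mul_pos (by omega) (Nat.pow_pos (h0 a))
  have hb := Evals.mul (.const 2) hn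
  have h0b : ∀ a, 0 < 2 * n a := fun a => Nat.mul_pos two_pos (h0 a)
  have hm6 := hm.add (.const 6)
  have hc := (hv.sub hm6).div hm h0m
  have hp := (hv.sub hm6).mod hm h0m
  have ht := hc.mod (.const 2) fun _ => two_pos
  have hm1 := hm.add (.const 1)
  have hprev := Evals.ite (EvalsP.eq hp (.const 0)) hm1 (hv.sub (.const 1))
  have hfam : ∀ {c p : X.α → ℕ}, Evals X c → Evals X p →
      Evals X fun a => 8 * n a ^ 4 + 6 + (c a * (8 * n a ^ 4) + p a) :=
    fun hc hp => hm6.add ((hc.mul hm).add hp)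
  have hlast := hm.sub (.const 1)
  have he := hm6.add (Evals.mul (.const 8) hm)
  have hcl := EvalsP.isClausePos hb hp h0b
  have hi := hp.div hb.sq fun a => Nat.pow_pos (h0b a)
  have hj := (hp.div hb h0b).mod hb h0b
  have hk := hp.mod hb h0b
  have hcl' := hcl.and (.lt (hk.add (.const 2)) hb)
  have or : ∀ {i j : X.α → ℕ}, Evals X i → Evals X j →
    EmitsGate X N w B (fun a => .or (i a) (j a)) := .or hN hw hB
  have and : ∀ {i j : X.α → ℕ}, Evals X i → Evals X j →
    EmitsGate X N w B (fun a => .and (i a) (j a)) := .and hN hB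
  have not : ∀ {i : X.α → ℕ}, Evals X i →
    EmitsGate X N w B (fun a => .not (i a)) := .not hN hw hB
  refine .ite (.eq hv hm) (not (.const 0)) <|
    .ite (.eq hv hm1) (and (.const 0) hm) <|
    .ite (.eq hv (hm.add (.const 2)))
      (or (.const 1) (.clausePos hb (.const 1) (.const 1) (.const 1))) <|
    .ite (.eq hv (hm.add (.const 3))) (not (hm.add (.const 2))) <|
    .ite (.eq hv (hm.add (.const 4)))
      (or (.const 1) (.clausePos hb (.const 0) (.const 0) (.const 0))) <|
    .ite (.eq hv (hm.add (.const 5))) (not (hm.add (.const 4))) <|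
    .ite (.le he hv) ?_ <|
    .ite (.eq hc (.const 0))
      (or hprev (.ite (hcl.or ((EvalsP.eq hp (.const 1)).or (.eq hp (.const 2)))) hm1 hp)) <|
    .ite (.eq hc (.const 1)) (or hprev (.ite hcl hp hm1)) <|
    .ite (.lt hc (.const 4))
      (or hprev (.ite ((EvalsP.eq hp (.const 1)).or (hcl.and (EvalsP.hasDigit hb hp ht h0b).not))
        hp hm1)) <|
    .ite (.lt hc (.const 6))
      (or (.ite hcl' (.clausePos hb (hi.add (.const 2)) (hj.add (.const 2)) (hk.add (.const 2))) hm1)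
        (.ite (hcl'.and (.eq hj hk))
          (.clausePos hb (Evals.sub (.const 1) ht) (hi.add (.const 2)) (hk.add (.const 2))) hm1)) <|
    .ite (.eq hp (.const 1))
      (or ((hm.add (.const 2)).add (Evals.mul (.const 2) ht))
        ((hm.add (.const 2)).add (Evals.mul (.const 2) ht))) <|
    .ite (.eq hp (.const 2)) (not (hfam (Evals.add (.const 2) ht) hlast)) <|
    and (hfam (Evals.add (.const 4) ht) hp) ((hm.add (.const 3)).add (Evals.mul (.const 2) ht))
  exact .ite (.eq hv he) (or (.const 1) (.const 2)) <|
    .ite (.eq hv (he.add (.const 1))) (and (.const 1) (.const 2)) <|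
    .ite (.eq hv (he.add (.const 2))) (and he (hfam (.const 1) hlast)) <|
    .ite (.eq hv (he.add (.const 3))) (or he (hfam (.const 1) hlast)) <|
    .ite (.eq hv (he.add (.const 4))) (not (he.add (.const 3))) <|
    .ite (.eq hv (he.add (.const 5))) (or (he.add (.const 1)) (he.add (.const 2))) <|
    .ite (.eq hv (he.add (.const 6))) (or (he.add (.const 5)) (he.add (.const 4))) <|
    .ite (.eq hv (he.add (.const 7))) (or (he.add (.const 6)) (hfam (.const 0) hlast)) <|
    not (he.add (.const 7))

end

/-! ### The reduction is computable in polynomial time -/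

/-- Without inputs the first gate has no wire to read, and no gate is constant. There is thus no
circuit on zero inputs, and the reduction needs no value for `n = 0`. -/
theorem BoolCircuit.pos_of_inputs {n : ℕ} (C : BoolCircuit (8 * n ^ 4)) : 0 < n := by
  rcases Nat.eq_zero_or_pos n with rfl | h
  · have hpos : 0 < C.gates.length := by simpa using C.out_lt.pos
    have := C.gates_bounded 0 _ (List.getElem?_eq_getElem hpos)
    cases hg : C.gates[0] <;> simp [hg, BoolGate.Bounded] at this
  · exact h

section
variable {O : Type} {X : Ctx BoolSym O} {p : X.α → Σ n : ℕ, BoolCircuit (8 * n ^ 4)}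

theorem Evals.copyBlock (hx : ∀ a, X.x a = encodeBoolCircuit (p a)) {c : X.α → ℕ}
    (hc : Evals X c) : Evals X fun a => copyBlock (p a).1 (p a).2 (c a) :=
  have hn := evals_size hx
  (hn.inputs.add hn.encodingSize).add (hc.mul (hn.inputs.add (evals_length hx)))

theorem Evals.testBlock (hx : ∀ a, X.x a = encodeBoolCircuit (p a)) (q : ℕ) {i : X.α → ℕ}
    (hi : Evals X i) : Evals X fun a => testBlock q (p a).1 (p a).2 (i a) :=
  ((Evals.copyBlock hx (.const 5)).add (.const 1)).add (hi.mul (.const (q + 4)))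

end

section
variable {F : Type} [Field F] {X : Ctx BoolSym (ArithSym F)}
  {p : X.α → Σ n : ℕ, BoolCircuit (8 * n ^ 4)}

/-- Beyond the end of the gate list the fields read are meaningless, so the default gate is written
there explicitly. -/
theorem EmitsGate.gates (hx : ∀ a, X.x a = encodeBoolCircuit (p a)) {N w B t : X.α → ℕ}
    (hN : Evals X N) (hw : Evals X w) (hB : Evals X B) (ht : Evals X t) :
    EmitsGate X N w B fun a => (p a).2.gates.getD (t a) (.not 0) := by
  obtain ⟨o, i, j, ho, hi, hj, h⟩ := evals_gates hx ht
  convert EmitsGate.ite (.lt ht (evals_length hx)) (.ite (.eq ho (.const 0)) (.and hN hB hi hj)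
    (.ite (.eq ho (.const 1)) (.or hN hw hB hi hj) (.not hN hw hB hj))) (.not hN hw hB (.const 0))
    using 2 with a
  split_ifs with h₁
  · rw [h a h₁]
    simp_all
  all_goals first
    | exact List.getD_eq_default _ _ (not_lt.1 h₁)
    | (rw [h a h₁]; simp_all)

theorem EmitsBlock.reductionGate (hx : ∀ a, X.x a = encodeBoolCircuit (p a)) (q : ℕ)
    {N w : X.α → ℕ} (hN : Evals X N) (hw : Evals X w) :
    EmitsBlock X N w fun a => reductionGate q (p a).1 (p a).2 (w a) := by
  have h0 : ∀ a, 0 < (p a).1 := fun a => (p a).2.pos_of_inputs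
  have hn := evals_size hx
  have hm := hn.inputs
  have h0m : ∀ a, 0 < 8 * (p a).1 ^ 4 := fun a => Nat.mul_pos (by omega) (Nat.pow_pos (h0 a))
  have hs := hm.add (evals_length hx)
  have h0s : ∀ a, 0 < 8 * (p a).1 ^ 4 + (p a).2.gates.length := fun a => by have := h0m a; omega
  have hcb : ∀ k, Evals X fun a => copyBlock (p a).1 (p a).2 k := fun k => .copyBlock hx (.const k)
  have hc := (hw.sub (hcb 0)).div hs h0s
  have hj := (hw.sub (hcb 0)).mod hs h0s
  have ht0 := Evals.testBlock hx q (.const 0)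
  have he := Evals.testBlock hx q hm
  have hi := (hw.sub ht0).div (.const (q + 4)) fun _ => Nat.succ_pos _
  have hr := (hw.sub ht0).mod (.const (q + 4)) fun _ => Nat.succ_pos _
  have ho : ∀ k, Evals X fun a => copyBlock (p a).1 (p a).2 k + (p a).2.out := fun k =>
    (hcb k).add (evals_out hx)
  have hw1 := hw.sub (.const 1)
  have hem := (hm.add (.const 6)).add (Evals.mul (.const 8) hm)
  refine .ite (.lt hw hm) (.inp hN hw hw) <|
    .ite (.lt hw (hcb 0)) (EmitsGate.encodingGate hN hw (.const 0) hn hw h0) <|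
    .ite (.lt hw (hcb 5)) (.ite (.lt hj hm)
      (.ite (.eq hc (.const 0)) (.ite (.eq hj (.const 2)) .one .zero) <|
        .ite (.eq hc (.const 1)) (.ite (.eq hj (.const 1)) .one .zero) <|
        .ite (.eq hc (.const 2)) (.copy hN hw hj) <|
        .copy hN hw ((hm.add (.const 6)).add (((hc.add (.const 3)).mul hm).add hj)))
      (EmitsGate.gates hx hN hw (.copyBlock hx hc) (hj.sub hm))) <|
    .ite (.eq hw (hcb 5)) .one <|
    .ite (.lt hw he) (.ite (.eq hr (.const 0)) (.sub hN hi (hcb 5)) <|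
      .ite (.eq hr (.const 1)) (.mul hN hi hw1) <|
      .ite (.eq hr (.const 2)) .one <|
      .ite (.lt hr (.const (q + 2))) (.mul hN hw1 ((Evals.testBlock hx q hi).add (.const 1))) <|
      .ite (.eq hr (.const (q + 2))) (.not hN hw hw1) <|
      .mul hN hw1 (hw.sub (.const (q + 4)))) ?_
  exact .ite (.eq hw he) (.inp hN hw hm) <|
    .ite (.eq hw (he.add (.const 1))) (.inp hN hw (hm.add (.const 1))) <|
    .ite (.eq hw (he.add (.const 2))) (.inp hN hw (hm.add (.const 2))) <|
    .ite (.eq hw (he.add (.const 3))) (.sub hN (ho 0) (hcb 5)) <|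
    .ite (.eq hw (he.add (.const 4))) (.mul hN he (he.add (.const 3))) <|
    .ite (.eq hw (he.add (.const 5))) (.mul hN (he.add (.const 1)) (ho 1)) <|
    .ite (.eq hw (he.add (.const 6))) (.or hN hw (ho 3) (ho 4)) <|
    .ite (.eq hw (he.add (.const 7))) (.sub hN (ho 2) (he.add (.const 6))) <|
    .ite (.eq hw (he.add (.const 8))) (.mul hN (he.add (.const 2)) (he.add (.const 7))) <|
    .ite (.eq hw (he.add (.const 9))) (.add hN (he.add (.const 4)) (he.add (.const 5))) <|
    .ite (.eq hw (he.add (.const 10))) (.add hN (he.add (.const 9)) (he.add (.const 8))) <|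
    .ite (.eq hw (he.add (.const 11))) (.mul hN (he.sub (.const 1)) (hem.add (.const 8))) <|
    .mul hN (he.add (.const 10)) (he.add (.const 11))

end

/-- The code is a loop over the block number between two unary fields; inside the loop the block
number is the additional counter. -/
theorem Emits.encode_reductionCircuit {F : Type} [Field F] {X : Ctx BoolSym (ArithSym F)}
    {p : X.α → Σ n : ℕ, BoolCircuit (8 * n ^ 4)} (hx : ∀ a, X.x a = encodeBoolCircuit (p a))
    (q : ℕ) : Emits X fun a => encodeArithCircuit
      ⟨8 * (p a).1 ^ 4 + 3, reductionCircuit F q (p a).2.pos_of_inputs (p a).2⟩ := by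
  have hx' : ∀ a : X.ext.α, X.ext.x a = encodeBoolCircuit (p a.1) := fun a => hx a.1
  have hN := (evals_size hx).inputs.add (.const 3)
  have hW := (Evals.testBlock hx q (evals_size hx).inputs).add (.const 13)
  have hg : Emits X.ext fun a => ((reductionGate q (p a.1).1 (p a.1).2 a.2).block F
      (8 * (p a.1).1 ^ 4 + 3) a.2).flatMap ArithGate.code :=
    EmitsBlock.reductionGate hx' q hN.weaken .last
  have hgates := Emits.flatMap (f := fun a w => ((reductionGate q (p a).1 (p a).2 w).block F
    (8 * (p a).1 ^ 4 + 3) w).flatMap ArithGate.code) hW hg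
  have h := ((Emits.unary hN).append hgates).append (.unary (.wire hN (hW.sub (.const 1))))
  convert h using 2 with a
  simp only [encodeArithCircuit, reductionCircuit, blockCircuit, List.flatMap_assoc]
  rfl

/-- The circuit of the reduction can be computed in polynomial time. -/
theorem computable_reductionCircuit (F : Type) [Field F] (q : ℕ) :
    Nonempty (TM2ComputableInPolyTime encodeBoolCircuit encodeArithCircuit
      (fun p : Σ n : ℕ, BoolCircuit (8 * n ^ 4) =>
        (⟨8 * p.1 ^ 4 + 3, reductionCircuit F q p.2.pos_of_inputs p.2⟩ :
          Σ N : ℕ, ArithCircuit F N))) := by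
  have : Inhabited BoolSym := ⟨.tick⟩
  refine Emits.computableInPolyTime ?_
  exact Emits.encode_reductionCircuit (X := ⟨Σ n : ℕ, BoolCircuit (8 * n ^ 4), 0, fun _ _ => 0,
    encodeBoolCircuit, fun p => (encodeBoolCircuit p).length, _, _⟩) (p := fun p => p)
    (fun _ => rfl) q

/-! ### Correctness of the reduction -/

/-- If `x * (x - 1)` is nonzero, its power with exponent `q - 1` is `1`. -/
theorem bitTest_eq_zero_or {F : Type} [Field F] [Fintype F] (x : F) :
    bitTest (Fintype.card F) x = 0 ∨ x = 0 ∨ x = 1 := by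
  by_cases h : x * (x - 1) = 0
  · rcases mul_eq_zero.1 h with h | h
    · exact .inr (.inl h)
    · exact .inr (.inr (sub_eq_zero.1 h))
  · left
    rw [bitTest, FiniteField.pow_card_sub_one_eq_one _ h, sub_self]

/-- A field has at least two elements, so the exponent is positive and the power of zero vanishes.
-/
theorem bitTest_bit {F : Type} [Field F] [Fintype F] (b : Bool) :
    bitTest (Fintype.card F) (if b then 1 else 0 : F) = 1 := by
  have : Fintype.card F - 1 ≠ 0 := by
    have := Fintype.one_lt_card (α := F)
    omega
  cases b <;> simp [bitTest, this]

/-- Off the encodings of instances the guard factor vanishes. -/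
theorem guardFactor_eq_zero_or {F : Type} [Field F] [Fintype F] {n : ℕ}
    {V : BoolCircuit (8 * n ^ 4)} (hV : DecidesEncodings n V) (x : Fin (8 * n ^ 4) → F) :
    guardFactor (Fintype.card F) V x = 0 ∨
      ∃ f : SatInstance, f.IsNormalized n ∧ x = bitVec (f.encode n) := by
  by_cases h : ∃ i, bitTest (Fintype.card F) (x i) = 0
  · obtain ⟨i, hi⟩ := h
    left
    rw [guardFactor, Finset.prod_eq_zero (Finset.mem_univ i) hi, zero_mul]
  · push Not at h
    classical
    have hs : x = bitVec (fun i => decide (x i = 1)) := by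
      funext i
      rcases (bitTest_eq_zero_or (x i)).resolve_left (h i) with h | h <;> simp [bitVec, h]
    generalize (fun i => decide (x i = 1)) = s at hs
    subst hs
    cases he : V.eval s with
    | false =>
      left
      simp [guardFactor, V.arith_bitVec, he]
    | true =>
      obtain ⟨f, hf, rfl⟩ := (hV s).1 he
      exact .inr ⟨f, hf, rfl⟩

theorem guardFactor_encode {F : Type} [Field F] [Fintype F] {n : ℕ}
    {V : BoolCircuit (8 * n ^ 4)} (hV : DecidesEncodings n V) {f : SatInstance}
    (hf : f.IsNormalized n) :
    guardFactor (Fintype.card F) V (bitVec (f.encode n) : _ → F) = 1 := by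
  rw [guardFactor, V.arith_bitVec, if_pos ((hV _).2 ⟨f, hf, rfl⟩), mul_one]
  exact Finset.prod_eq_one fun i _ => bitTest_bit _

/-- On an encoding all arguments of `C` are bit vectors, so every arithmetization becomes a truth
value of `C`. -/
theorem recursionFactor_encode {R : Type} [CommRing R] {n : ℕ} (C : BoolCircuit (8 * n ^ 4))
    {S₀ S₁ : Fin (8 * n ^ 4) → BoolCircuit (8 * n ^ 4)} (h₀ : ComputesRestriction n false S₀)
    (h₁ : ComputesRestriction n true S₁) {f : SatInstance} (hf : f.IsNormalized n) (y₀ y₁ y₂ : R) :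
    recursionFactor n C S₀ S₁ (bitVec (f.encode n)) y₀ y₁ y₂ =
      y₀ * ((if C.eval ((SatInstance.const true).encode n) then 1 else 0) - 1) +
      y₁ * (if C.eval ((SatInstance.const false).encode n) then 1 else 0) +
      y₂ * ((if C.eval (f.encode n) then 1 else 0) -
        (1 - (1 - if C.eval ((f.restrict false).encode n) then 1 else 0) *
          (1 - if C.eval ((f.restrict true).encode n) then 1 else 0))) := by
  have key : ∀ b (S : Fin (8 * n ^ 4) → BoolCircuit (8 * n ^ 4)), ComputesRestriction n b S →
      (fun i => (S i).arith (bitVec (f.encode n) : _ → R)) = bitVec ((f.restrict b).encode n) := by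
    intro b S hS
    rw [← hS f hf]
    funext i
    rw [(S i).arith_bitVec, bitVec]
  rw [recursionFactor, key _ _ h₀, key _ _ h₁]
  simp only [C.arith_bitVec]

/-- Off the encodings the guard vanishes, and on them it is `1`. What remains is the vanishing of
`H` at all encodings for all `y`, which says that `C` is right on the constants and obeys the
recursion of satisfiability. -/
theorem decides3SAT_iff {F : Type} [Field F] [Fintype F] {n : ℕ} (C : BoolCircuit (8 * n ^ 4))
    {V : BoolCircuit (8 * n ^ 4)} {S₀ S₁ : Fin (8 * n ^ 4) → BoolCircuit (8 * n ^ 4)}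
    (hV : DecidesEncodings n V) (h₀ : ComputesRestriction n false S₀)
    (h₁ : ComputesRestriction n true S₁) :
    Decides3SAT n C ↔ ∀ (x : Fin (8 * n ^ 4) → F) (y₀ y₁ y₂ : F),
      recursionFactor n C S₀ S₁ x y₀ y₁ y₂ * guardFactor (Fintype.card F) V x = 0 := by
  constructor
  · intro hC x y₀ y₁ y₂
    rcases guardFactor_eq_zero_or hV x with h | ⟨f, hf, rfl⟩
    · rw [h, mul_zero]
    -- Restriction lowers the number of variables only from a positive one; here `n > 0` because `C`
    -- is a circuit on `8 n ^ 4` inputs.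
    · have hr : ∀ b, (f.restrict b).IsNormalized n := fun b => by
        obtain ⟨k, rfl⟩ := Nat.exists_eq_succ_of_ne_zero C.pos_of_inputs.ne'
        exact (hf.restrict b).mono (Nat.le_succ k)
      have ht : (SatInstance.const true).Satisfiable := rfl
      have hff : ¬ (SatInstance.const false).Satisfiable := Bool.false_ne_true
      rw [recursionFactor_encode C h₀ h₁ hf]
      classical
      simp only [hC f hf, hC _ (hr _), hC (.const _) trivial, satisfiable_iff_restrict f]
      by_cases h₂ : (f.restrict false).Satisfiable <;>
        by_cases h₃ : (f.restrict true).Satisfiable <;>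
        simp [ht, hff, h₂, h₃]
  · intro h
    have key : ∀ f : SatInstance, f.IsNormalized n → ∀ y₀ y₁ y₂ : F, _ := fun f hf y₀ y₁ y₂ => by
      have := h (bitVec (f.encode n)) y₀ y₁ y₂
      rwa [guardFactor_encode hV hf, mul_one, recursionFactor_encode C h₀ h₁ hf] at this
    have ht : C.eval ((SatInstance.const true).encode n) = true := by
      by_contra hC
      -- The unit vectors for `(y₀, y₁, y₂)` isolate the three requirements: here the value on
      -- `true`, below the value on `false` and the recursion.
      simpa [hC] using key (.const true) trivial 1 0 0
    have hf : ¬ C.eval ((SatInstance.const false).encode n) = true := fun hC => by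
      simpa [hC] using key (.const true) trivial 0 1 0
    refine satisfiable_of_recursion (P := fun f => C.eval (f.encode n) = true) ht hf fun f hf' => ?_
    have := key f hf' 0 0 1
    by_cases h₁ : C.eval (f.encode n) = true <;>
      by_cases h₂ : C.eval ((f.restrict false).encode n) = true <;>
      by_cases h₃ : C.eval ((f.restrict true).encode n) = true <;>
      simp_all

theorem mainTheorem2 (F : Type) [Field F] [Fintype F] :
    ∃ A : (p : Σ n : ℕ, BoolCircuit (8 * n ^ 4)) → ArithCircuit F (8 * p.1 ^ 4 + 3),
      Nonempty (TM2ComputableInPolyTime encodeBoolCircuit encodeArithCircuit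
        (fun p => (⟨8 * p.1 ^ 4 + 3, A p⟩ : Σ N : ℕ, ArithCircuit F N))) ∧
      ∀ n : ℕ, 0 < n →
        ∃ (V : BoolCircuit (8 * n ^ 4)) (S₀ S₁ : Fin (8 * n ^ 4) → BoolCircuit (8 * n ^ 4)),
          DecidesEncodings n V ∧ ComputesRestriction n false S₀ ∧ ComputesRestriction n true S₁ ∧
          ∀ C : BoolCircuit (8 * n ^ 4),
            (Decides3SAT n C ↔ (A ⟨n, C⟩).IdenticallyZero) ∧
            (A ⟨n, C⟩).poly =
              recursionFactor n C S₀ S₁ (fun i => MvPolynomial.X (Fin.castAdd 3 i))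
                  (MvPolynomial.X (Fin.natAdd _ 0)) (MvPolynomial.X (Fin.natAdd _ 1))
                  (MvPolynomial.X (Fin.natAdd _ 2)) *
                guardFactor (Fintype.card F) V (fun i => MvPolynomial.X (Fin.castAdd 3 i)) := by
  refine ⟨fun p => reductionCircuit F (Fintype.card F) p.2.pos_of_inputs p.2,
    computable_reductionCircuit F _, fun n hn => ⟨recognizer hn, restrictor hn false,
    restrictor hn true, decidesEncodings_recognizer hn, computesRestriction_restrictor hn false,
    computesRestriction_restrictor hn true,
    -- For the formal polynomial the evaluation is taken in the polynomial ring, at the variables.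
    fun C => ⟨?_, reductionCircuit_eval Fintype.card_pos hn C _⟩⟩⟩
  rw [decides3SAT_iff (F := F) C (decidesEncodings_recognizer hn)
    (computesRestriction_restrictor hn false) (computesRestriction_restrictor hn true)]
  constructor
  · intro h x
    rw [reductionCircuit_eval Fintype.card_pos hn]
    exact h _ _ _ _
  · intro h x y₀ y₁ y₂
    have := h (Fin.append x ![y₀, y₁, y₂])
    rw [reductionCircuit_eval Fintype.card_pos hn] at this
    simpa using this
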